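/- Let $\{\xi_{ij}\}_{1\le i\le j}$ be independent real random variables such that the $\xi_{ii}$ ($i\ge1$) are identically distributed, the $\xi_{ij}$ ($1\le i<j$) are identically distributed, $\mathbb E\,\xi_{11}=\mathbb E\,\xi_{12}=0$, $\mathbb E\,\xi_{12}^2=1$, and all moments of $\xi_{11}$ and $\xi_{12}$ are finite. For $N\ge1$ let $X_N$ be the real symmetric $N\times N$ matrix with $X_N(i,j)=X_N(j,i)=\xi_{ij}/\sqrt N$ for $1\le i\le j\le N$, and put $$\bar S_{N,k}=\sqrt N\,\bigl(X_N^k(1,1)-\mathbb E[X_N^k(1,1)]\bigr),\qquad k\ge 1 .$$ **Words.** A word $w=s_1\cdots s_m$ ($m\ge1$) is a finite sequence of positive integers (letters); its length is $\ell(w)=m$, its support is the set of its letters. It is closed if $s_1=s_m$. Its edge set $E_w$ is the set of unordered pairs $(s_i,s_{i+1})$, $1\le i<m$ (self-edges $(u,u)$ allowed), and $N_e^w$ is the number of $i$ with $(s_i,s_{i+1})=e$. Two words are equivalent if a bijection between their supports maps one to the other; two pairs $(w_1,w_2)$ and $(w_1',w_2')$ of words are equivalent if one bijection between $\operatorname{supp}(w_1)\cup\operatorname{supp}(w_2)$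 and $\operatorname{supp}(w_1')\cup\operatorname{supp}(w_2')$ maps $w_1$ to $w_1'$ and $w_2$ to $w_2'$. Put $T_w=\prod_{e\in E_w}\xi_e^{N_e^w}$ and $\bar T_w=T_w-\mathbb E[T_w]$, where $\xi_{(i,j)}=\xi_{(j,i)}=\xi_{ij}$ for $i\le j$. A pair $(w_1,w_2)$ of words is a CLT pair if $N_e^{w_1}+N_e^{w_2}\ge2$ for all $e\in E_{w_1}\cup E_{w_2}$, $E_{w_1}\cap E_{w_2}\neq\emptyset$, and $\#(\operatorname{supp}(w_1)\cup\operatorname{supp}(w_2))=\frac{\ell(w_1)+\ell(w_2)}2-1$. For $k,l\ge2$ let $\mathcal U_{k,l}$ be a set of representatives of the equivalence classes of CLT pairs $(u_1,u_2)$ of closed words without self-edges, starting at $1$, of lengths $k+1$ and $l+1$, with letters in $\{1,\dots,\lfloor (k+l)/2\rfloor\}$ (so $\mathcal U_{k,l}=\emptyset$ if $k+l$ is odd), and put $$A(k,l)=\sum_{(u_1,u_2)\in\mathcal U_{k,l}}\mathbb E[\bar T_{u_1}\bar T_{u_2}].$$ A Wigner word is a closed word $w$ with $N_e^w\ge2$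 for all $e\in E_w$ and $\#\operatorname{supp}(w)=(\ell(w)+1)/2$. For a word $w$ let $\check w$ be the word obtained by replacing each block of equal adjacent letters by a single letter. For odd $k\ge3$ let $a_k$ be the number of equivalence classes of closed words $w$ of length $k+1$ starting at $1$ for which $N^w_{(1,1)}=1$ and $\check w$ is a Wigner word of length $k$ (so the only self-edge passage of $w$ is a single passage of $(1,1)$). **Theorem.** There exist, on some probability space, centred jointly Gaussian random variables $\{\eta_k\}_{k\ge2}$ with $\mathbb E[\eta_k\eta_l]=A(k,l)$ for all $k,l\ge2$, and a random variable $\zeta$ independent of $\{\eta_k\}_{k\ge2}$ with the same distribution as $\xi_{11}$. For any such $\{\eta_k\}_{k\ge2}$ and $\zeta$, as $N\to\infty$: (i) for even $k\ge2$, $\bar S_{N,k}\to\eta_k$ in distribution; (ii) for odd $k\ge3$, $\bar S_{N,k}\to a_k\zeta+\eta_k$ in distribution; (iii) for every fixed $K$, $(\bar S_{N,1},\bar S_{N,2},\dots,\bar S_{N,K})$ converges in distribution to the vector whose entries, for $k=1,\dots,K$, are $\zeta$ if $k=1$, $\eta_k$ if $k$ is even, and $a_k\zeta+\eta_k$ if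 $k\ge3$ is odd, that is, to $(\zeta,\eta_2,a_3\zeta+\eta_3,\eta_4,\dots)$. -/

import Mathlib

open MeasureTheory ProbabilityTheory Filter

namespace WignerCLT

/-! ### Words and their graphs -/

/-- A word is a finite sequence of letters, the letters being positive integers. -/
abbrev Word := List ℕ+

/-- The support of a word: the set of its letters. -/
def supp (w : Word) : Finset ℕ+ := w.toFinset

/-- The weight of a word: the number of its distinct letters. -/
def wt (w : Word) : ℕ := (supp w).card

/-- The successive (undirected) edges traversed by a word. -/
def steps (w : Word) : List (Sym2 ℕ+) := List.zipWith (fun a b => s(a, b)) w w.tail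

/-- The edge set of the graph of a word (self-edges included). -/
def edgeSet (w : Word) : Finset (Sym2 ℕ+) := (steps w).toFinset

/-- The passage count: the number of times the word traverses the edge `e`, in any direction. -/
def passages (w : Word) (e : Sym2 ℕ+) : ℕ := (steps w).count e

/-- A closed word: first and last letter agree. -/
def IsClosedWord (w : Word) : Prop := w ≠ [] ∧ w.head? = w.getLast?

/-- A closed word whose first (and last) letter is `1`. -/
def IsClosedFromOne (w : Word) : Prop := w.head? = some 1 ∧ w.getLast? = some 1

/-- The word traverses no self-edge. -/
def NoSelfEdge (w : Word) : Prop := ∀ e ∈ edgeSet w, ¬ e.IsDiag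

/-- All the letters are at most `t`. -/
def IsBoundedWord (t : ℕ) (w : Word) : Prop := ∀ s ∈ w, (s : ℕ) ≤ t

/-- Weak Wigner word: a closed word visiting each of its edges at least twice. -/
def IsWeakWigner (w : Word) : Prop :=
  IsClosedWord w ∧ ∀ e ∈ edgeSet w, 2 ≤ passages w e

/-- Wigner word: a weak Wigner word of weight `(length + 1) / 2`. A single-letter word is one. -/
def IsWigner (w : Word) : Prop := IsWeakWigner w ∧ 2 * wt w = w.length + 1

/-- The reduced word: in each block of equal adjacent letters only one letter is kept. -/
def reduced (w : Word) : Word := w.destutter (· ≠ ·)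

/-- Two words are equivalent if a bijection between their supports maps one to the other. -/
def WordEquiv (w w' : Word) : Prop :=
  ∃ f : ℕ+ → ℕ+, Set.BijOn f (supp w) (supp w') ∧ w' = w.map f

/-! ### Pairs of words -/

/-- The support of a pair of words. -/
def pairSupp (a : Word × Word) : Finset ℕ+ := supp a.1 ∪ supp a.2

/-- The weight of a pair of words. -/
def pairWt (a : Word × Word) : ℕ := (pairSupp a).card

/-- Two pairs of words are equivalent if one bijection between their supports maps both words
of the first pair to the respective words of the second. -/
def PairEquiv (a b : Word × Word) : Prop :=
  ∃ f : ℕ+ → ℕ+, Set.BijOn f (pairSupp a) (pairSupp b) ∧ b.1 = a.1.map f ∧ b.2 = a.2.map f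

/-- Weak CLT pair: every edge is traversed at least twice by the two words together,
and the two words have a common edge. -/
def IsWeakCLTPair (a : Word × Word) : Prop :=
  (∀ e ∈ edgeSet a.1 ∪ edgeSet a.2, 2 ≤ passages a.1 e + passages a.2 e) ∧
    (edgeSet a.1 ∩ edgeSet a.2).Nonempty

/-- CLT pair: a weak CLT pair of weight `(length₁ + length₂) / 2 - 1`. -/
def IsCLTPair (a : Word × Word) : Prop :=
  IsWeakCLTPair a ∧ 2 * pairWt a + 2 = a.1.length + a.2.length

/-! ### Equivalence classes -/

lemma supp_map (f : ℕ+ → ℕ+) (w : Word) : supp (w.map f) = (supp w).image f := by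
  ext x
  simp [supp]

lemma map_eq_self_of {f : ℕ+ → ℕ+} {w : Word} (h : ∀ x ∈ supp w, f x = x) : w.map f = w := by
  conv_rhs => rw [← List.map_id w]
  exact List.map_congr_left fun x hx => h x (by simpa [supp] using hx)

lemma pairEquiv_equivalence : Equivalence PairEquiv where
  refl a := ⟨id, Set.bijOn_id _, by simp, by simp⟩
  symm := by
    rintro a b ⟨f, hf, h1, h2⟩
    have hl := hf.invOn_invFunOn
    refine ⟨Function.invFunOn f (pairSupp a), hf.symm hl.symm, ?_, ?_⟩
    · rw [h1, List.map_map]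
      exact (map_eq_self_of fun x hx => hl.1 (by simp [pairSupp, hx])).symm
    · rw [h2, List.map_map]
      exact (map_eq_self_of fun x hx => hl.1 (by simp [pairSupp, hx])).symm
  trans := by
    rintro a b c ⟨f, hf, h1, h2⟩ ⟨g, hg, h3, h4⟩
    exact ⟨g ∘ f, hg.comp hf, by rw [h3, h1, List.map_map], by rw [h4, h2, List.map_map]⟩

lemma wordEquiv_iff (w w' : Word) : WordEquiv w w' ↔ PairEquiv (w, w) (w', w') := by
  simp [WordEquiv, PairEquiv, pairSupp]

lemma wordEquiv_equivalence : Equivalence WordEquiv where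
  refl w := (wordEquiv_iff w w).2 (pairEquiv_equivalence.refl _)
  symm h := (wordEquiv_iff _ _).2 (pairEquiv_equivalence.symm ((wordEquiv_iff _ _).1 h))
  trans h h' := (wordEquiv_iff _ _).2
    (pairEquiv_equivalence.trans ((wordEquiv_iff _ _).1 h) ((wordEquiv_iff _ _).1 h'))

/-- The CLT pairs `(u₁, u₂)` of closed words starting at `1`, without self-edges, of lengths
`k + 1` and `l + 1` (that is, with `k` and `l` steps), with letters in `{1, …, (k + l) / 2}`.
For `k + l` odd there are none, because of the weight condition. -/
def CLTPairs (k l : ℕ) : Type :=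
  {a : Word × Word //
    (IsClosedFromOne a.1 ∧ NoSelfEdge a.1 ∧ a.1.length = k + 1 ∧ IsBoundedWord ((k + l) / 2) a.1) ∧
    (IsClosedFromOne a.2 ∧ NoSelfEdge a.2 ∧ a.2.length = l + 1 ∧ IsBoundedWord ((k + l) / 2) a.2) ∧
    IsCLTPair a}

lemma finite_bounded (n t : ℕ) : {w : Word | w.length = n ∧ IsBoundedWord t w}.Finite := by
  have hfin : Finite {s : ℕ+ // (s : ℕ) ≤ t} :=
    Finite.of_injective (fun s => (⟨(s.1 : ℕ), Nat.lt_succ_of_le s.2⟩ : Fin (t + 1)))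
      (fun a b h => by
        have h' := congrArg Fin.val h
        exact Subtype.ext (PNat.coe_injective h'))
  refine ((List.finite_length_eq {s : ℕ+ // (s : ℕ) ≤ t} n).image
    (List.map Subtype.val)).subset ?_
  rintro w ⟨hw, hb⟩
  lift w to List {s : ℕ+ // (s : ℕ) ≤ t} using hb
  exact ⟨w, by simpa using hw, rfl⟩

instance (k l : ℕ) : Finite (CLTPairs k l) := by
  refine Set.Finite.subset ((finite_bounded (k + 1) ((k + l) / 2)).prod
    (finite_bounded (l + 1) ((k + l) / 2))) ?_
  rintro a ⟨h1, h2, -⟩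
  exact ⟨⟨h1.2.2.1, h1.2.2.2⟩, h2.2.2.1, h2.2.2.2⟩

/-- Equivalence of pairs, on `CLTPairs k l`. -/
def cltSetoid (k l : ℕ) : Setoid (CLTPairs k l) :=
  Setoid.comap (fun a => a.1) ⟨PairEquiv, pairEquiv_equivalence⟩

noncomputable instance (k l : ℕ) : Fintype (Quotient (cltSetoid k l)) := Fintype.ofFinite _

/-- The words `w` of length `k + 1`, closed and starting at `1`, which traverse the self-edge
`(1, 1)` exactly once and whose reduced word is a Wigner word of length `k`
(so that the word contains no other self-edge). -/
def OneLoopWords (k : ℕ) : Type :=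
  {w : Word // IsClosedFromOne w ∧ w.length = k + 1 ∧ passages w s(1, 1) = 1 ∧
    IsWigner (reduced w) ∧ (reduced w).length = k}

/-- Equivalence of words, on `OneLoopWords k`. -/
def oneLoopSetoid (k : ℕ) : Setoid (OneLoopWords k) :=
  Setoid.comap (fun w => w.1) ⟨WordEquiv, wordEquiv_equivalence⟩

/-- The constant `a_k`: the number of equivalence classes of words in `OneLoopWords k`. -/
noncomputable def aConst (k : ℕ) : ℕ := Nat.card (Quotient (oneLoopSetoid k))

/-! ### Wigner matrices -/

section
variable {Ω : Type*} [MeasurableSpace Ω]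

/-- The Wigner ensemble: independent real random variables `ξ_{ij}`, `1 ≤ i ≤ j`, here indexed by
the unordered pair `s(i, j)`; diagonal ones are identically distributed, off-diagonal ones
are identically distributed, all are centred with finite moments, and `ξ_{12}` has variance `1`. -/
structure IsWignerEnsemble (ξ : Sym2 ℕ+ → Ω → ℝ) (P : Measure Ω) : Prop where
  measurable : ∀ e, Measurable (ξ e)
  indep : iIndepFun ξ P
  identDistrib_diag : ∀ i : ℕ+, IdentDistrib (ξ s(i, i)) (ξ s(1, 1)) P P
  identDistrib_offDiag : ∀ i j : ℕ+, i < j → IdentDistrib (ξ s(i, j)) (ξ s(1, 2)) P P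
  memLp_diag : ∀ p : ℕ, MemLp (ξ s(1, 1)) p P
  memLp_offDiag : ∀ p : ℕ, MemLp (ξ s(1, 2)) p P
  mean_diag : ∫ ω, ξ s(1, 1) ω ∂P = 0
  mean_offDiag : ∫ ω, ξ s(1, 2) ω ∂P = 0
  variance_offDiag : ∫ ω, ξ s(1, 2) ω ^ 2 ∂P = 1

/-- The `N × N` Wigner matrix `X_N(i, j) = ξ_{ij} / √N`; the index `i : Fin N` stands for the
integer `i + 1`. -/
noncomputable def wignerMatrix (ξ : Sym2 ℕ+ → Ω → ℝ) (N : ℕ) (ω : Ω) :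
    Matrix (Fin N) (Fin N) ℝ :=
  Matrix.of fun i j => ξ s((i : ℕ).succPNat, (j : ℕ).succPNat) ω / √(N : ℝ)

/-- `√N (X_N^k(1,1) - E X_N^k(1,1))`. -/
noncomputable def SBar (ξ : Sym2 ℕ+ → Ω → ℝ) (P : Measure Ω) (N : ℕ) [NeZero N] (k : ℕ)
    (ω : Ω) : ℝ :=
  √(N : ℝ) * ((wignerMatrix ξ N ω ^ k) 0 0 - ∫ ω', (wignerMatrix ξ N ω' ^ k) 0 0 ∂P)

/-- `T_w`, the product of `ξ_e ^ N_e^w` over the edges `e` of the word `w`. -/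
noncomputable def T (ξ : Sym2 ℕ+ → Ω → ℝ) (w : Word) (ω : Ω) : ℝ :=
  ∏ e ∈ edgeSet w, ξ e ω ^ passages w e

/-- The centred variable `T_w - E T_w`. -/
noncomputable def TBar (ξ : Sym2 ℕ+ → Ω → ℝ) (P : Measure Ω) (w : Word) (ω : Ω) : ℝ :=
  T ξ w ω - ∫ ω', T ξ w ω' ∂P

/-- The covariance `A(k, l)`: the sum, over one representative `(u₁, u₂)` of each equivalence
class of CLT pairs, of `E[(T_{u₁} - E T_{u₁}) (T_{u₂} - E T_{u₂})]`. -/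
noncomputable def covA (ξ : Sym2 ℕ+ → Ω → ℝ) (P : Measure Ω) (k l : ℕ) : ℝ :=
  ∑ q : Quotient (cltSetoid k l), ∫ ω, TBar ξ P q.out.1.1 ω * TBar ξ P q.out.1.2 ω ∂P

/-- The limiting objects: `(η_k)_{k ≥ 2}` is a centred Gaussian family with covariance `A(k, l)`,
and `ζ` is independent of it and distributed as `ξ_{11}`. (The values `η 0`, `η 1` play no role.) -/
structure IsLimitFamily (ξ : Sym2 ℕ+ → Ω → ℝ) (P : Measure Ω)
    {Ω' : Type*} [MeasurableSpace Ω'] (P' : Measure Ω') (ζ : Ω' → ℝ) (η : ℕ → Ω' → ℝ) : Prop where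
  gaussian : IsGaussianProcess (fun k : {k : ℕ // 2 ≤ k} => η k) P'
  mean : ∀ k, 2 ≤ k → ∫ ω, η k ω ∂P' = 0
  cov : ∀ k l, 2 ≤ k → 2 ≤ l → ∫ ω, η k ω * η l ω ∂P' = covA ξ P k l
  law : IdentDistrib ζ (ξ s(1, 1)) P' P
  indep : IndepFun ζ (fun ω (k : {k : ℕ // 2 ≤ k}) => η k ω) P'

/-- The components of the joint limit `(ζ, η_2, a_3 ζ + η_3, η_4, …)`. -/
noncomputable def limitEntry {Ω' : Type*} (ζ : Ω' → ℝ) (η : ℕ → Ω' → ℝ) (k : ℕ) (ω : Ω') : ℝ :=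
  if k = 1 then ζ ω else if Even k then η k ω else aConst k * ζ ω + η k ω

end

end WignerCLT

/-! Expanding the matrix power writes `SBar` as `√N ^ (1 - k)` times the sum of the centred
variables `TBar` over closed words with `k` steps from `1` (`SBar_eq_sum`). Mixed moments of such
sums run over tuples of words. By independence only linked tuples contribute: every edge is passed
at least twice in total, and every word shares an edge with another one
(`integral_prod_TBar_eq_zero`). A tuple with `q` distinct letters has of order `N ^ (q - 1)`
relabellings fixing `1`, so everything depends on how large `q` can be.

A linked tuple of `m` closed words with `s` steps in all satisfies `2q + m ≤ s + 2`. Take a spanning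
tree of the union of the graphs and select two passages of each of its `q - 1` edges, from different
words when the edge is shared. Every word keeps at least one unselected passage, because a closed
walk crosses every cut an even number of times; cuts are encoded by `ZMod 2`-colourings of the
vertices. In case of equality every word keeps exactly one, whatever the tree and the selection.

This rigidity has two consequences. Without self-edges, a word of an extremal tuple shares edges
with one other word only (`eq_of_shares`). Hence the parts of `SBar` without self-edges satisfy
Wick's pairing rule in the limit (`defect_TBar_eq_zero`, `tendsto_defect_freePart`), with the
covariances given by CLT pairs (`tendsto_integral_freePart_mul_freePart`). If an extremal pair has a
self-edge, it is the loop at `1`, passed once by each word, and the words share no other edge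
(`loop_pair`, `IsLinked.isOneLoop`). The variable of a one-loop word is `ξ₁₁` times squares of mean
one, so after normalization the words with self-edges contribute `a_k ξ₁₁` up to an error vanishing
in `L²` (`tendsto_integral_sq_remainder`).

The pairing rule makes the moments of linear combinations of the free parts converge to Gaussian
ones, and a Taylor estimate turns this into convergence of characteristic functions
(`tendsto_integral_exp_of_moments`). Since `ξ₁₁` is independent of the off-diagonal entries, the
characteristic function of the main part factorizes, and Lévy's continuity theorem concludes. The
limit family exists because `A(k, l)`, a limit of covariances, is positive semidefinite
(`exists_triangular_factor`). -/

namespace WignerCLT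

/-! ### Cuts and spanning trees -/

section Combinatorics

variable {V : Type*}

/-- The coboundary of a `ZMod 2`-valued colouring: the edges it cuts have value `1`. -/
def cob (c : V → ZMod 2) : Sym2 V → ZMod 2 :=
  Sym2.lift ⟨fun x y => c x + c y, fun _ _ => add_comm _ _⟩

@[simp] lemma cob_mk (c : V → ZMod 2) (x y : V) : cob c s(x, y) = c x + c y := rfl

lemma zmod_two_eq_one {a : ZMod 2} (h : a ≠ 0) : a = 1 := by
  revert a; decide

lemma zmod_two_add_eq_zero {a b : ZMod 2} : a + b = 0 ↔ a = b := by
  revert a b; decide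

lemma cob_of_isDiag (c : V → ZMod 2) {e : Sym2 V} (h : e.IsDiag) : cob c e = 0 := by
  induction e with
  | h x y =>
    have : x = y := by simpa using h
    subst this
    simp [zmod_two_add_eq_zero]

/-- The edges `E` connect the vertices `S`: every colouring constant along `E` is constant. -/
def Connects (E : Finset (Sym2 V)) (S : Finset V) : Prop :=
  ∀ c : V → ZMod 2, (∀ e ∈ E, cob c e = 0) → ∀ x ∈ S, ∀ y ∈ S, c x = c y

/-- A tree on the vertices `S`, each edge `f` coming with the colouring `C f` which cuts, among
the edges of the tree, only `f`. -/
structure IsTreeOn (S : Finset V) (F : Finset (Sym2 V)) (C : Sym2 V → V → ZMod 2) : Prop where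
  card : F.card + 1 = S.card
  mem : ∀ f ∈ F, ∀ x ∈ f, x ∈ S
  cut_self : ∀ f ∈ F, cob (C f) f = 1
  cut_other : ∀ f ∈ F, ∀ g ∈ F, g ≠ f → cob (C f) g = 0
  sep : ∀ x ∈ S, ∀ y ∈ S, x ≠ y → ∃ f ∈ F, C f x ≠ C f y

lemma isTreeOn_singleton (x : V) : IsTreeOn {x} ∅ (fun _ _ => 0) where
  card := by simp
  mem := by simp
  cut_self := by simp
  cut_other := by simp
  sep := by simp +contextual

variable [DecidableEq V]

lemma cob_update_of_notMem (c : V → ZMod 2) (v : V) (a : ZMod 2) {e : Sym2 V} (h : v ∉ e) :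
    cob (Function.update c v a) e = cob c e := by
  induction e with
  | h x y =>
    have : x ≠ v ∧ y ≠ v := by
      constructor <;> rintro rfl <;> simp at h
    simp [this]

/-- Hanging a leaf `v` on `u`: the indicator of `v` cuts the new edge only, and an earlier cut stays
valid once `v` receives the colour of `u`. -/
lemma IsTreeOn.insert {S : Finset V} {F : Finset (Sym2 V)} {C : Sym2 V → V → ZMod 2}
    (hT : IsTreeOn S F C) {u v : V} (hu : u ∈ S) (hv : v ∉ S) :
    IsTreeOn (insert v S) (insert s(u, v) F)
      (fun f => if f = s(u, v) then Pi.single v 1 else Function.update (C f) v (C f u)) := by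
  have huv : u ≠ v := fun h => hv (h ▸ hu)
  have hF : ∀ f ∈ F, v ∉ f := fun f hf h => hv (hT.mem f hf v h)
  have hne : ∀ f ∈ F, f ≠ s(u, v) := by
    rintro f hf rfl
    exact hF _ hf (by simp)
  have hnot : s(u, v) ∉ F := fun h => hne _ h rfl
  have hnew : ∀ f ∈ F, cob (Pi.single v (1 : ZMod 2)) f = 0 := by
    intro f hf
    have := cob_update_of_notMem (0 : V → ZMod 2) v 1 (hF f hf)
    rw [Pi.single, this]
    induction f with
    | h x y => simp
  refine ⟨?_, ?_, ?_, ?_, ?_⟩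
  · rw [Finset.card_insert_of_notMem hnot, Finset.card_insert_of_notMem hv, hT.card]
  · intro f hf x hx
    rcases Finset.mem_insert.1 hf with rfl | hf
    · rcases Sym2.mem_iff.1 hx with rfl | rfl
      · exact Finset.mem_insert_of_mem hu
      · exact Finset.mem_insert_self _ _
    · exact Finset.mem_insert_of_mem (hT.mem f hf x hx)
  · intro f hf
    rcases Finset.mem_insert.1 hf with rfl | hf
    · simp [huv]
    · rw [if_neg (hne f hf), cob_update_of_notMem _ _ _ (hF f hf), hT.cut_self f hf]
  · intro f hf g hg hgf
    rcases Finset.mem_insert.1 hf with rfl | hf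
    · rw [if_pos rfl]
      exact hnew g ((Finset.mem_insert.1 hg).resolve_left hgf)
    · rw [if_neg (hne f hf)]
      rcases Finset.mem_insert.1 hg with rfl | hg
      · simp [huv, zmod_two_add_eq_zero]
      · rw [cob_update_of_notMem _ _ _ (hF g hg), hT.cut_other f hf g hg hgf]
  · intro x hx y hy hxy
    rcases Finset.mem_insert.1 hx with rfl | hx
    · have hy' := (Finset.mem_insert.1 hy).resolve_left hxy.symm
      exact ⟨_, Finset.mem_insert_self _ _, by simp [hxy.symm]⟩
    · have hxv : x ≠ v := fun h => hv (h ▸ hx)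
      rcases Finset.mem_insert.1 hy with rfl | hy
      · exact ⟨_, Finset.mem_insert_self _ _, by simp [hxy]⟩
      · have hyv : y ≠ v := fun h => hv (h ▸ hy)
        obtain ⟨f, hf, hne'⟩ := hT.sep x hx y hy hxy
        exact ⟨f, Finset.mem_insert_of_mem hf, by simpa [hne f hf, hxv, hyv] using hne'⟩

/-- Otherwise the indicator of `A` would be constant along every edge without being constant on `S`.
-/
lemma Connects.exists_crossing {E : Finset (Sym2 V)} {S A : Finset V} (h : Connects E S)
    (hE : ∀ e ∈ E, ∀ x ∈ e, x ∈ S) (hA : A ⊂ S) (hne : A.Nonempty) :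
    ∃ u ∈ A, ∃ v ∈ S, v ∉ A ∧ s(u, v) ∈ E := by
  by_contra! hcon
  obtain ⟨y, hyS, hyA⟩ := Finset.exists_of_ssubset hA
  obtain ⟨x, hx⟩ := hne
  have := h (fun z => if z ∈ A then 1 else 0) ?_ x (hA.1 hx) y hyS
  · simp [hx, hyA] at this
  · intro e he
    induction e with
    | h a b =>
      have ha := hE _ he a (by simp)
      have hb := hE _ he b (by simp)
      by_cases haA : a ∈ A <;> by_cases hbA : b ∈ A
      · simp only [cob_mk, haA, hbA, if_true]; decide
      · exact absurd he (hcon a haA b hb hbA)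
      · exact absurd (Sym2.eq_swap ▸ he) (hcon b hbA a ha haA)
      · simp [haA, hbA]

/-- Greedy growth: while a vertex is missing, a crossing edge supplies a new leaf. Starting from an
arbitrary tree makes it possible to prescribe an edge, as in `exists_tree_mem`. -/
lemma IsTreeOn.exists_extend {E : Finset (Sym2 V)} {S : Finset V} (h : Connects E S)
    (hE : ∀ e ∈ E, ∀ x ∈ e, x ∈ S) (A : Finset V) (F : Finset (Sym2 V)) (C : Sym2 V → V → ZMod 2)
    (hT : IsTreeOn A F C) (hAS : A ⊆ S) (hne : A.Nonempty) (hFE : F ⊆ E) :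
    ∃ F' C', IsTreeOn S F' C' ∧ F ⊆ F' ∧ F' ⊆ E := by
  induction hk : (S \ A).card generalizing A F C with
  | zero =>
    have : A = S := hAS.antisymm (Finset.sdiff_eq_empty_iff_subset.1 (Finset.card_eq_zero.1 hk))
    subst this
    exact ⟨F, C, hT, subset_rfl, hFE⟩
  | succ k ih =>
    have hA : A ⊂ S := by
      refine hAS.ssubset_of_ne ?_
      rintro rfl
      simp at hk
    obtain ⟨u, hu, v, hv, hvA, he⟩ := h.exists_crossing hE hA hne
    obtain ⟨F', C', hT', h1, h2⟩ := ih _ _ _ (hT.insert hu hvA)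
      (Finset.insert_subset hv hAS) (Finset.insert_nonempty _ _)
      (Finset.insert_subset he hFE) (by
        have : v ∈ S \ A := by simp [hv, hvA]
        rw [Finset.sdiff_insert, Finset.card_erase_of_mem this, hk, Nat.add_sub_cancel])
    exact ⟨F', C', hT', (Finset.subset_insert _ _).trans h1, h2⟩

lemma Connects.exists_tree {E : Finset (Sym2 V)} {S : Finset V} (h : Connects E S)
    (hE : ∀ e ∈ E, ∀ x ∈ e, x ∈ S) (hS : S.Nonempty) : ∃ F C, IsTreeOn S F C ∧ F ⊆ E := by
  obtain ⟨x, hx⟩ := hS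
  obtain ⟨F, C, h1, -, h2⟩ := IsTreeOn.exists_extend h hE {x} ∅ _ (isTreeOn_singleton x)
    (by simpa) (by simp) (by simp)
  exact ⟨F, C, h1, h2⟩

lemma Connects.exists_tree_mem {E : Finset (Sym2 V)} {S : Finset V} (h : Connects E S)
    (hE : ∀ e ∈ E, ∀ x ∈ e, x ∈ S) {e : Sym2 V} (he : e ∈ E) (hd : ¬ e.IsDiag) :
    ∃ F C, IsTreeOn S F C ∧ F ⊆ E ∧ e ∈ F := by
  induction e with
  | h x y =>
    have hxy : x ≠ y := by simpa using hd
    obtain ⟨F, C, h1, h3, h2⟩ := IsTreeOn.exists_extend h hE _ _ _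
      ((isTreeOn_singleton x).insert (v := y) (Finset.mem_singleton_self x) (by simpa using hxy.symm))
      (by
        intro z hz
        rcases Finset.mem_insert.1 hz with rfl | hz
        · exact hE _ he _ (by simp)
        · rw [Finset.mem_singleton.1 hz]; exact hE _ he _ (by simp)) (by simp) (by simpa using he)
    exact ⟨F, C, h1, h2, h3 (by simp)⟩

end Combinatorics

/-! ### Systems of closed walks -/

section WalkSystems

variable {V ι : Type*}

/-- Passage counts `n i e` of closed walks `i` through the edges `e ∈ E` of a connected graph on
the vertices `S`, such that each edge is passed at least twice and each walk shares an edge with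
another one. -/
structure IsWalkSystem [Fintype ι] (S : Finset V) (E : Finset (Sym2 V)) (n : ι → Sym2 V → ℕ) :
    Prop where
  nonempty : S.Nonempty
  mem_of_ne_zero : ∀ i e, n i e ≠ 0 → e ∈ E
  mem : ∀ e ∈ E, ∀ x ∈ e, x ∈ S
  even : ∀ i c, ∑ e ∈ E, (n i e : ZMod 2) * cob c e = 0
  connects : Connects E S
  two_le : ∀ e ∈ E, 2 ≤ ∑ i, n i e
  shares : ∀ i, ∃ j, i ≠ j ∧ ∃ e, n i e ≠ 0 ∧ n j e ≠ 0

/-- Two selected passages for each edge of `F`, by different walks if the edge is shared. -/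
structure IsSelection [Fintype ι] (n : ι → Sym2 V → ℕ) (F : Finset (Sym2 V))
    (σ : Sym2 V → ι → ℕ) : Prop where
  le : ∀ e i, σ e i ≤ n i e
  sum : ∀ e ∈ F, ∑ i, σ e i = 2
  zero : ∀ e ∉ F, ∀ i, σ e i = 0
  le_one : ∀ e i j, i ≠ j → n i e ≠ 0 → n j e ≠ 0 → ∀ l, σ e l ≤ 1

variable [Fintype ι] {S : Finset V} {E F : Finset (Sym2 V)} {n : ι → Sym2 V → ℕ}
  {C : Sym2 V → V → ZMod 2} {σ : Sym2 V → ι → ℕ}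

/-- The walk `l` is to be spared: if two other walks use the edge, both passages are taken from
them. Failing that, any two walks sharing the edge give one passage each; failing that too, a single
walk uses the edge and gives both. -/
lemma exists_edge_selection (m : ι → ℕ) (h : 2 ≤ ∑ i, m i) (l : ι) :
    ∃ s : ι → ℕ, (∀ i, s i ≤ m i) ∧ ∑ i, s i = 2 ∧
      (∀ i j, i ≠ j → m i ≠ 0 → m j ≠ 0 → ∀ k, s k ≤ 1) ∧
      (∀ i j, i ≠ j → i ≠ l → j ≠ l → m i ≠ 0 → m j ≠ 0 → s l = 0) := by
  classical
  have key : ∀ i j, i ≠ j → m i ≠ 0 → m j ≠ 0 →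
      ∃ s : ι → ℕ, (∀ k, s k ≤ m k) ∧ ∑ k, s k = 2 ∧ (∀ k, s k ≤ 1) ∧
        (i ≠ l → j ≠ l → s l = 0) := by
    intro i j hij hi hj
    refine ⟨fun k => if k ∈ ({i, j} : Finset ι) then 1 else 0, ?_, ?_, ?_, ?_⟩
    · intro k
      dsimp only
      by_cases hk : k ∈ ({i, j} : Finset ι)
      · rw [if_pos hk]
        rcases Finset.mem_insert.1 hk with rfl | hk
        · omega
        · rw [Finset.mem_singleton.1 hk]; omega
      · simp [hk]
    · rw [Finset.sum_ite_mem, Finset.univ_inter, Finset.sum_const, Finset.card_pair hij]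
      rfl
    · intro k
      dsimp only
      split_ifs <;> simp
    · intro h1 h2
      simp [h1.symm, h2.symm]
  by_cases h3 : ∃ i j, i ≠ j ∧ i ≠ l ∧ j ≠ l ∧ m i ≠ 0 ∧ m j ≠ 0
  · obtain ⟨i, j, hij, hil, hjl, hi, hj⟩ := h3
    obtain ⟨s, h1, h2, h3, h4⟩ := key i j hij hi hj
    exact ⟨s, h1, h2, fun _ _ _ _ _ => h3, fun _ _ _ _ _ _ _ => h4 hil hjl⟩
  by_cases h2 : ∃ i j, i ≠ j ∧ m i ≠ 0 ∧ m j ≠ 0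
  · obtain ⟨i, j, hij, hi, hj⟩ := h2
    obtain ⟨s, h1, h2, h4, -⟩ := key i j hij hi hj
    exact ⟨s, h1, h2, fun _ _ _ _ _ => h4,
      fun a b h5 h6 h7 h8 h9 => absurd ⟨a, b, h5, h6, h7, h8, h9⟩ h3⟩
  · have h0 : ∃ i, m i ≠ 0 := by
      by_contra! h0
      simp [h0] at h
    obtain ⟨i, hi⟩ := h0
    have hz : ∀ j, j ≠ i → m j = 0 := by
      intro j hj
      by_contra hmj
      exact h2 ⟨j, i, hj, hmj, hi⟩
    have hsum : ∑ j, m j = m i := Fintype.sum_eq_single i hz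
    refine ⟨Pi.single i 2, ?_, by simp, fun a b h5 h6 h7 => absurd ⟨a, b, h5, h6, h7⟩ h2,
      fun a b h5 h6 h7 h8 h9 => absurd ⟨a, b, h5, h6, h7, h8, h9⟩ h3⟩
    intro k
    by_cases hk : k = i
    · subst hk; simp; omega
    · simp [hk]

lemma exists_selection (h2 : ∀ e ∈ E, 2 ≤ ∑ i, n i e) (hF : F ⊆ E) (l : ι) :
    ∃ σ, IsSelection n F σ ∧ ∀ e ∈ F, ∀ i j, i ≠ j → i ≠ l → j ≠ l → n i e ≠ 0 → n j e ≠ 0 →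
      σ e l = 0 := by
  classical
  choose! s hs using fun e (he : e ∈ F) => exists_edge_selection (fun i => n i e) (h2 e (hF he)) l
  refine ⟨fun e i => if e ∈ F then s e i else 0, ⟨?_, ?_, ?_, ?_⟩, ?_⟩
  · intro e i
    by_cases he : e ∈ F
    · simpa [he] using (hs e he).1 i
    · simp [he]
  · intro e he
    simpa [he] using (hs e he).2.1
  · intro e he i
    simp [he]
  · intro e i j hij hi hj l
    by_cases he : e ∈ F
    · simpa [he] using (hs e he).2.2.1 i j hij hi hj l
    · simp [he]
  · intro e he i j hij hi hj h4 h5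
    simpa [he] using (hs e he).2.2.2 i j hij hi hj h4 h5

/-! ### Unselected passages and the extremal case -/

namespace IsWalkSystem

/-- A closed walk crosses a cut an even number of times; when `f` is its only edge in the cut, the
parity bears on `n i f` alone. -/
lemma even_passages (h : IsWalkSystem S E n) {i : ι} {c : V → ZMod 2} {f : Sym2 V}
    (hf : cob c f = 1) (hc : ∀ g, n i g ≠ 0 → g ≠ f → cob c g = 0) : Even (n i f) := by
  classical
  by_cases hn : n i f = 0
  · simp [hn]
  have := h.even i c
  rw [Finset.sum_eq_single f, hf, mul_one] at this
  · exact (ZMod.natCast_eq_zero_iff_even).1 this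
  · intro g _ hgf
    by_cases hg : n i g = 0
    · simp [hg]
    · simp [hc g hg hgf]
  · intro hfE
    exact absurd (h.mem_of_ne_zero i f hn) hfE

lemma two_le_passages (h : IsWalkSystem S E n) {i : ι} {c : V → ZMod 2} {f : Sym2 V}
    (hf : cob c f = 1) (hc : ∀ g, n i g ≠ 0 → g ≠ f → cob c g = 0) (hn : n i f ≠ 0) :
    2 ≤ n i f := by
  obtain ⟨r, hr⟩ := h.even_passages hf hc
  omega

/-- The sum on the right is the excess of the walk, the number of passages that `σ` leaves
unselected. It is bounded below through one edge here, through two in `add_le_excess`. -/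
lemma le_excess (h : IsWalkSystem S E n) (i : ι) (e : Sym2 V) (σ : Sym2 V → ι → ℕ) :
    n i e - σ e i ≤ ∑ g ∈ E, (n i g - σ g i) := by
  by_cases he : e ∈ E
  · exact Finset.single_le_sum (f := fun g => n i g - σ g i) (fun _ _ => Nat.zero_le _) he
  · have : n i e = 0 := by
      by_contra hn
      exact he (h.mem_of_ne_zero i e hn)
    simp [this]

lemma add_le_excess (h : IsWalkSystem S E n) (i : ι) {e f : Sym2 V} (hef : e ≠ f)
    (he : n i e ≠ 0) (hf : n i f ≠ 0) :
    (n i e - σ e i) + (n i f - σ f i) ≤ ∑ g ∈ E, (n i g - σ g i) := by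
  classical
  rw [← Finset.sum_pair (f := fun g => n i g - σ g i) hef]
  apply Finset.sum_le_sum_of_subset
  intro g hg
  rcases Finset.mem_insert.1 hg with rfl | hg
  · exact h.mem_of_ne_zero i g he
  · rw [Finset.mem_singleton.1 hg]; exact h.mem_of_ne_zero i f hf

/-- A walk leaving the tree has an unselected passage there. A walk inside the tree passes a shared
edge at least twice, by parity across the cut of that edge, and at most one of these passages is
selected. -/
lemma one_le_excess (h : IsWalkSystem S E n) (hT : IsTreeOn S F C)
    (hσ : IsSelection n F σ) (i : ι) : 1 ≤ ∑ e ∈ E, (n i e - σ e i) := by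
  by_cases hg : ∃ g, g ∉ F ∧ n i g ≠ 0
  · obtain ⟨g, hgF, hg⟩ := hg
    have := h.le_excess i g σ
    rw [hσ.zero g hgF] at this
    omega
  · push Not at hg
    obtain ⟨j, hij, e, hi, hj⟩ := h.shares i
    have heF : e ∈ F := by
      by_contra he
      exact hi (hg e he)
    have h2 : 2 ≤ n i e := h.two_le_passages (hT.cut_self e heF)
      (fun g hgi hge => hT.cut_other e heF g (by by_contra hgF; exact hgi (hg g hgF)) hge) hi
    have := h.le_excess i e σ
    have := hσ.le_one e i j hij hi hj i
    omega

/-- Double counting: exactly two passages are selected on each edge of `F` and none elsewhere. -/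
lemma sum_excess (hσ : IsSelection n F σ) (hF : F ⊆ E) :
    ∑ i, ∑ e ∈ E, (n i e - σ e i) + 2 * F.card = ∑ i, ∑ e ∈ E, n i e := by
  have h1 : ∑ e ∈ E, ∑ i, σ e i = 2 * F.card := by
    rw [← Finset.sum_subset hF (fun e _ he => by simp [hσ.zero e he]), Finset.sum_congr rfl hσ.sum]
    simp [mul_comm]
  rw [← h1, Finset.sum_comm (s := E), ← Finset.sum_add_distrib]
  refine Finset.sum_congr rfl fun i _ => ?_
  rw [← Finset.sum_add_distrib]
  exact Finset.sum_congr rfl fun e _ => Nat.sub_add_cancel (hσ.le e i)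

/-- The excesses are all at least one and sum to at most the number of walks. As this holds for
every tree and every selection, both can be chosen later so as to contradict it. -/
lemma excess_eq_one (h : IsWalkSystem S E n)
    (heq : ∑ i, ∑ e ∈ E, n i e + 2 ≤ 2 * S.card + Fintype.card ι) (hT : IsTreeOn S F C)
    (hF : F ⊆ E) (hσ : IsSelection n F σ) (i : ι) : ∑ e ∈ E, (n i e - σ e i) = 1 := by
  have h1 := sum_excess hσ hF
  have h2 := hT.card
  have h3 : ∑ i, ∑ e ∈ E, (n i e - σ e i) ≤ ∑ _i : ι, 1 := by
    simp only [Finset.sum_const, Finset.card_univ, smul_eq_mul, mul_one]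
    omega
  have h4 := (Finset.sum_eq_sum_iff_of_le (fun i _ => h.one_le_excess hT hσ i)).1
    (le_antisymm (Finset.sum_le_sum fun i _ => h.one_le_excess hT hσ i) h3) i (Finset.mem_univ i)
  exact h4.symm

variable [DecidableEq V]

/-- The weight of a system of closed walks is at most half of the number of steps, minus half of
the number of walks, plus one. -/
theorem two_mul_card_add_card_le (h : IsWalkSystem S E n) :
    2 * S.card + Fintype.card ι ≤ ∑ i, ∑ e ∈ E, n i e + 2 := by
  obtain ⟨F, C, hT, hF⟩ := h.connects.exists_tree h.mem h.nonempty
  by_cases hι : Nonempty ι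
  · obtain ⟨l⟩ := hι
    obtain ⟨σ, hσ, -⟩ := exists_selection h.two_le hF l
    have h1 := sum_excess hσ hF
    have h2 : Fintype.card ι ≤ ∑ i, ∑ e ∈ E, (n i e - σ e i) := by
      simpa using Finset.card_nsmul_le_sum Finset.univ (fun i => ∑ e ∈ E, (n i e - σ e i)) 1
        (fun i _ => h.one_le_excess hT hσ i)
    have := hT.card
    omega
  -- Without walks there are no edges, so the tree is a single vertex.
  · have hE : E = ∅ := by
      rw [Finset.eq_empty_iff_forall_notMem]
      intro e he
      have := h.two_le e he
      simp [not_nonempty_iff.1 hι] at this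
    have := hT.card
    rw [hE, Finset.subset_empty] at hF
    simp [hF] at this
    simp [not_nonempty_iff.1 hι, ← this]

/-- Put `e` in the tree and spare `a` in the selection. One unselected passage of `a` through `e`
uses up its excess, so `a` stays inside the tree; parity then gives a second passage through `e`,
unselected as well. -/
lemma eq_of_shared_edge (h : IsWalkSystem S E n)
    (heq : ∑ i, ∑ e ∈ E, n i e + 2 ≤ 2 * S.card + Fintype.card ι) {e : Sym2 V}
    (hd : ¬ e.IsDiag) {a b c : ι} (hab : a ≠ b) (hac : a ≠ c) (ha : n a e ≠ 0)
    (hb : n b e ≠ 0) (hc : n c e ≠ 0) : b = c := by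
  by_contra hbc
  obtain ⟨F, C, hT, hF, heF⟩ := h.connects.exists_tree_mem h.mem (h.mem_of_ne_zero a e ha) hd
  obtain ⟨σ, hσ, hσ0⟩ := exists_selection h.two_le hF a
  have h0 : σ e a = 0 := hσ0 e heF b c hbc hab.symm hac.symm hb hc
  have h1 := h.excess_eq_one heq hT hF hσ a
  have h2 : 2 ≤ n a e := h.two_le_passages (hT.cut_self e heF) (fun g hga hge => by
    refine hT.cut_other e heF g ?_ hge
    by_contra hgF
    have h3 := h.add_le_excess (σ := σ) a hge hga ha
    rw [h0, hσ.zero g hgF] at h3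
    omega) ha
  have h3 := h.le_excess a e σ
  omega

lemma exists_selected_tree (h : IsWalkSystem S E n) (i : ι) {E' : Finset (Sym2 V)} (hE' : E' ⊆ E)
    (hc : Connects E' S) : ∃ F C σ, IsTreeOn S F C ∧ F ⊆ E' ∧ IsSelection n F σ := by
  obtain ⟨F, C, hT, hF⟩ := hc.exists_tree (fun e he => h.mem e (hE' he)) h.nonempty
  obtain ⟨σ, hσ, -⟩ := exists_selection h.two_le (hF.trans hE') i
  exact ⟨F, C, σ, hT, hF, hσ⟩

/-- A bridge is a cut by itself: a colouring which witnesses the disconnection must cut `e`, and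
cuts no other edge. -/
lemma two_le_of_not_connects (h : IsWalkSystem S E n) {e : Sym2 V}
    (hc : ¬ Connects (E.erase e) S) {i : ι} (hi : n i e ≠ 0) : 2 ≤ n i e := by
  simp only [Connects, not_forall] at hc
  obtain ⟨c, h1, x, hx, y, hy, hxy⟩ := hc
  have hce : cob c e ≠ 0 := by
    intro h0
    refine hxy (h.connects c (fun g hg => ?_) x hx y hy)
    by_cases hge : g = e
    · rw [hge, h0]
    · exact h1 g (Finset.mem_erase.2 ⟨hge, hg⟩)
  exact h.two_le_passages (zmod_two_eq_one hce)
    (fun g hg hge => h1 g (Finset.mem_erase.2 ⟨hge, h.mem_of_ne_zero i g hg⟩)) hi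

/-- In the case of equality in the bound on the weight, a walk shares edges with only one other
walk. -/
theorem eq_of_shares (h : IsWalkSystem S E n)
    (heq : ∑ i, ∑ e ∈ E, n i e + 2 ≤ 2 * S.card + Fintype.card ι)
    (hd : ∀ e ∈ E, ¬ e.IsDiag) {a b c : ι} (hab : a ≠ b) (hac : a ≠ c) {e f : Sym2 V}
    (hae : n a e ≠ 0) (hbe : n b e ≠ 0) (haf : n a f ≠ 0) (hcf : n c f ≠ 0) : b = c := by
  by_contra hbc
  have heE := h.mem_of_ne_zero a e hae
  have hfE := h.mem_of_ne_zero a f haf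
  have hbf : n b f = 0 := by
    by_contra hbf
    exact hbc (h.eq_of_shared_edge heq (hd f hfE) hab hac haf hbf hcf)
  have hef : e ≠ f := by
    rintro rfl
    exact hbe hbf
  -- It remains to make two passages of `a` through `e` and `f` unselected. An edge which is not a
  -- bridge can be left out of the tree; a bridge is passed at least twice, and only one of its
  -- passages by `a` is selected since it is shared.
  have hone : ∀ F C σ, IsTreeOn S F C → F ⊆ E → IsSelection n F σ →
      (n a e - σ e a) + (n a f - σ f a) ≤ 1 := fun F C σ hT hF hσ =>
    (h.add_le_excess a hef hae haf).trans (h.excess_eq_one heq hT hF hσ a).le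
  by_cases hce : Connects (E.erase e) S
  · by_cases hcf' : Connects (E.erase f) S
    · by_cases hcef : Connects ((E.erase e).erase f) S
      · obtain ⟨F, C, σ, hT, hF, hσ⟩ := h.exists_selected_tree a
          ((Finset.erase_subset _ _).trans (Finset.erase_subset _ _)) hcef
        have h1 := hone F C σ hT (hF.trans ((Finset.erase_subset _ _).trans
          (Finset.erase_subset _ _))) hσ
        have he0 : e ∉ F := fun he => by simpa using hF he
        have hf0 : f ∉ F := fun he => by simpa using hF he
        rw [hσ.zero e he0, hσ.zero f hf0] at h1
        omega
      -- Neither edge is a bridge, but together they form a cut. The walk `b` meets this cut in `e`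
      -- only, hence at least twice, and a tree avoiding `e` gives `b` an excess of two.
      · simp only [Connects, not_forall] at hcef
        obtain ⟨c', h1, x, hx, y, hy, hxy⟩ := hcef
        have he1 : cob c' e = 1 := by
          apply zmod_two_eq_one
          intro h0
          refine hxy (hcf' c' (fun g hg => ?_) x hx y hy)
          by_cases hge : g = e
          · rw [hge, h0]
          · rw [Finset.mem_erase] at hg
            exact h1 g (by simp [hg, hge])
        have h2 : 2 ≤ n b e := h.two_le_passages he1 (fun g hg hge => h1 g (by
          simp only [Finset.mem_erase, ne_eq]
          refine ⟨?_, hge, h.mem_of_ne_zero b g hg⟩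
          rintro rfl
          exact hg hbf)) hbe
        obtain ⟨F, C, σ, hT, hF, hσ⟩ := h.exists_selected_tree a (Finset.erase_subset _ _) hce
        have h3 := h.excess_eq_one heq hT (hF.trans (Finset.erase_subset _ _)) hσ b
        have h4 := h.le_excess b e σ
        rw [hσ.zero e (fun he => by simpa using hF he)] at h4
        omega
    · obtain ⟨F, C, σ, hT, hF, hσ⟩ := h.exists_selected_tree a (Finset.erase_subset _ _) hce
      have h1 := hone F C σ hT (hF.trans (Finset.erase_subset _ _)) hσ
      rw [hσ.zero e (fun he => by simpa using hF he)] at h1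
      have h2 := h.two_le_of_not_connects hcf' haf
      have h3 := hσ.le_one f a c hac haf hcf a
      omega
  · have h2 := h.two_le_of_not_connects hce hae
    by_cases hcf' : Connects (E.erase f) S
    · obtain ⟨F, C, σ, hT, hF, hσ⟩ := h.exists_selected_tree a (Finset.erase_subset _ _) hcf'
      have h1 := hone F C σ hT (hF.trans (Finset.erase_subset _ _)) hσ
      rw [hσ.zero f (fun he => by simpa using hF he)] at h1
      have h3 := hσ.le_one e a b hab hae hbe a
      omega
    · obtain ⟨F, C, σ, hT, hF, hσ⟩ := h.exists_selected_tree a subset_rfl h.connects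
      have h1 := hone F C σ hT hF hσ
      have h4 := h.two_le_of_not_connects hcf' haf
      have h3 := hσ.le_one e a b hab hae hbe a
      have h5 := hσ.le_one f a c hac haf hcf a
      omega

/-- In the case of equality for two walks, one of which passes a loop: the loop is passed once,
at the common point `x₀` of the walks, and there is no other shared edge and no other loop. -/
theorem loop_pair {n : Fin 2 → Sym2 V → ℕ} (h : IsWalkSystem S E n)
    (heq : ∑ i, ∑ e ∈ E, n i e + 2 ≤ 2 * S.card + 2) (x₀ : V) (hx₀ : x₀ ∈ S)
    (hconn : ∀ (i : Fin 2) (c : V → ZMod 2), (∀ e, n i e ≠ 0 → cob c e = 0) →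
      ∀ e, n i e ≠ 0 → ∀ x ∈ e, c x = c x₀)
    {g : Sym2 V} (hg : g.IsDiag) (hgE : g ∈ E) :
    g = s(x₀, x₀) ∧ ∀ i j, i ≠ j →
      n i g = 1 ∧ ∀ e, e ≠ g → n i e ≠ 0 → n i e = 2 ∧ n j e = 0 ∧ ¬ e.IsDiag := by
  obtain ⟨F, C, σ, hT, hF, hσ⟩ := h.exists_selected_tree 0 subset_rfl h.connects
  have hex := h.excess_eq_one (by simpa using heq) hT hF hσ
  have hFd : ∀ e ∈ F, ¬ e.IsDiag := fun e he hd => by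
    have h1 := hT.cut_self e he
    rw [cob_of_isDiag _ hd] at h1
    exact zero_ne_one h1
  have hgF : g ∉ F := fun hgF => hFd g hgF hg
  -- A passage of the loop is never selected, so it uses up the excess of the walk. All other
  -- passages are selected: they lie on tree edges, which parity forces to be passed twice, and
  -- which cannot be shared.
  have key : ∀ i j, i ≠ j → n i g ≠ 0 →
      n i g = 1 ∧ ∀ e, e ≠ g → n i e ≠ 0 → e ∈ F ∧ n i e = 2 ∧ n j e = 0 := by
    intro i j hij hi
    have h1 := h.le_excess i g σ
    rw [hex, hσ.zero g hgF] at h1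
    have hsel : ∀ e, e ≠ g → n i e = σ e i := by
      intro e he
      by_contra hne
      have h0 : n i e ≠ 0 := by
        intro h0
        have := hσ.le e i
        omega
      have h2 := h.add_le_excess (σ := σ) i he h0 hi
      rw [hex, hσ.zero g hgF] at h2
      have := hσ.le e i
      omega
    refine ⟨by omega, fun e he h0 => ?_⟩
    have heF : ∀ e, e ≠ g → n i e ≠ 0 → e ∈ F := by
      intro e he h0
      by_contra heF
      rw [hsel e he, hσ.zero e heF] at h0
      exact h0 rfl
    have h2 : 2 ≤ n i e := by
      refine h.two_le_passages (hT.cut_self e (heF e he h0)) (fun f hf hfe => ?_) h0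
      by_cases hfg : f = g
      · rw [hfg, cob_of_isDiag _ hg]
      · exact hT.cut_other e (heF e he h0) f (heF f hfg hf) hfe
    refine ⟨heF e he h0, ?_, ?_⟩
    · have h3 := hσ.sum e (heF e he h0)
      have h4 : σ e i ≤ ∑ k, σ e k := Finset.single_le_sum (fun _ _ => Nat.zero_le _)
        (Finset.mem_univ i)
      rw [h3] at h4
      have := hsel e he
      omega
    · by_contra hj
      have := hσ.le_one e i j hij h0 hj i
      have := hsel e he
      omega
  -- The two walks share some edge, and by `key` it can only be the loop.
  have hother : ∀ i j : Fin 2, i ≠ j → n i g ≠ 0 → n j g ≠ 0 := by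
    intro i j hij hi hj
    obtain ⟨k, hk, e, h1, h2⟩ := h.shares i
    have hkj : k = j := by omega
    subst hkj
    by_cases heg : e = g
    · subst heg
      exact h2 hj
    · exact h2 ((key i k hij hi).2 e heg h1).2.2
  have hall : ∀ i, n i g ≠ 0 := by
    have h2 := h.two_le g hgE
    rw [Fin.sum_univ_two] at h2
    have : n 0 g ≠ 0 ∨ n 1 g ≠ 0 := by omega
    rcases this with h0 | h1
    · have := hother 0 1 (by decide) h0
      intro i
      fin_cases i <;> assumption
    · have := hother 1 0 (by decide) h1
      intro i
      fin_cases i <;> assumption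
  refine ⟨?_, fun i j hij => ⟨(key i j hij (hall i)).1, fun e he h0 => ?_⟩⟩
  · induction g with
    | h u v =>
      have huv : u = v := by simpa using hg
      subst huv
      by_contra hne
      have hux : u ≠ x₀ := by
        rintro rfl
        exact hne rfl
      -- A loop away from `x₀` would force both walks through a tree edge separating `u` from `x₀`,
      -- and that edge would be shared.
      obtain ⟨f, hf, hfne⟩ := hT.sep u (h.mem _ hgE u (by simp)) x₀ hx₀ hux
      have hpass : ∀ i, n i f ≠ 0 := by
        intro i hif
        refine hfne (hconn i (C f) (fun e he => ?_) _ (hall i) u (by simp))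
        by_cases heg : e = s(u, u)
        · rw [heg, cob_of_isDiag _ hg]
        · obtain ⟨j, hj⟩ := exists_ne i
          refine hT.cut_other f hf e ((key i j hj.symm (hall i)).2 e heg he).1 ?_
          rintro rfl
          exact he hif
      have hfg : f ≠ s(u, u) := by
        rintro rfl
        exact hgF hf
      exact hpass 1 ((key 0 1 (by decide) (hall 0)).2 f hfg (hpass 0)).2.2
  · obtain ⟨h1, h2, h3⟩ := (key i j hij (hall i)).2 e he h0
    exact ⟨h2, h3, hFd e h1⟩

end IsWalkSystem

end WalkSystems

/-! ### Steps of words -/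

@[simp] lemma steps_nil : steps [] = [] := rfl

@[simp] lemma steps_singleton (a : ℕ+) : steps [a] = [] := rfl

@[simp] lemma steps_cons_cons (a b : ℕ+) (l : Word) :
    steps (a :: b :: l) = s(a, b) :: steps (b :: l) := rfl

lemma length_steps (w : Word) : (steps w).length = w.length - 1 := by
  simp [steps]

lemma mem_edgeSet {w : Word} {e : Sym2 ℕ+} : e ∈ edgeSet w ↔ passages w e ≠ 0 := by
  simp [edgeSet, passages, List.count_eq_zero]

lemma mem_supp {w : Word} {x : ℕ+} : x ∈ supp w ↔ x ∈ w := by simp [supp]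

lemma mem_of_mem_steps {w : Word} {e : Sym2 ℕ+} (he : e ∈ steps w) {x : ℕ+} (hx : x ∈ e) :
    x ∈ w := by
  induction w with
  | nil => simp at he
  | cons a l ih =>
    cases l with
    | nil => simp at he
    | cons b l =>
      rw [steps_cons_cons, List.mem_cons] at he
      rcases he with rfl | he
      · rcases Sym2.mem_iff.1 hx with rfl | rfl <;> simp
      · exact List.mem_cons_of_mem _ (ih he)

lemma mem_supp_of_mem_edgeSet {w : Word} {e : Sym2 ℕ+} (he : e ∈ edgeSet w) {x : ℕ+}
    (hx : x ∈ e) : x ∈ supp w :=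
  mem_supp.2 (mem_of_mem_steps (by simpa [edgeSet] using he) hx)

/-- Telescoping modulo two. For a closed word the sum vanishes, which is the parity axiom of a walk
system. -/
lemma sum_cob_steps (c : ℕ+ → ZMod 2) (w : Word) (a b : ℕ+) (ha : w.head? = some a)
    (hb : w.getLast? = some b) : ((steps w).map (cob c)).sum = c a + c b := by
  induction w generalizing a with
  | nil => simp at ha
  | cons x l ih =>
    cases l with
    | nil =>
      simp only [List.head?_cons, Option.some.injEq, List.getLast?_singleton] at ha hb
      subst ha hb
      exact (zmod_two_add_eq_zero.2 rfl).symm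
    | cons y l =>
      obtain rfl : x = a := by simpa using ha
      have := ih y rfl (by simpa using hb)
      rw [steps_cons_cons, List.map_cons, List.sum_cons, this, cob_mk, add_assoc,
        ← add_assoc (c y), zmod_two_add_eq_zero.2 rfl, zero_add]

lemma eq_head_of_cob_eq_zero (c : ℕ+ → ZMod 2) (w : Word) (h : ∀ e ∈ steps w, cob c e = 0) (a : ℕ+)
    (ha : w.head? = some a) : ∀ x ∈ w, c x = c a := by
  induction w generalizing a with
  | nil => simp
  | cons x l ih =>
    obtain rfl : x = a := by simpa using ha
    cases l with
    | nil => simp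
    | cons y l =>
      intro z hz
      rcases List.mem_cons.1 hz with rfl | hz
      · rfl
      · rw [ih (fun e he => h e (by simp [he])) y rfl z hz]
        have := h s(x, y) (by simp)
        rw [cob_mk, zmod_two_add_eq_zero] at this
        exact this.symm

lemma sum_passages_mul {R : Type*} [CommSemiring R] (w : Word) (E : Finset (Sym2 ℕ+))
    (hE : edgeSet w ⊆ E) (g : Sym2 ℕ+ → R) :
    ∑ e ∈ E, (passages w e : R) * g e = ((steps w).map g).sum := by
  rw [Finset.sum_list_map_count, ← Finset.sum_subset hE]
  · simp [edgeSet, passages, nsmul_eq_mul]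
  · intro e _ he
    rw [mem_edgeSet, not_not] at he
    simp [he]

lemma sum_passages (w : Word) (E : Finset (Sym2 ℕ+)) (hE : edgeSet w ⊆ E) :
    ∑ e ∈ E, passages w e = w.length - 1 := by
  have := sum_passages_mul (R := ℕ) w E hE (fun _ => 1)
  simpa [length_steps] using this

lemma one_mem_supp {w : Word} (h : IsClosedFromOne w) : 1 ∈ supp w :=
  mem_supp.2 (List.mem_of_mem_head? h.1)

/-! ### Tuples of words -/

section Tuples

variable {ι : Type*} [Fintype ι]

/-- The support of a tuple of words. -/
def tupleSupp (w : ι → Word) : Finset ℕ+ := Finset.univ.biUnion fun i => supp (w i)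

/-- The edges of a tuple of words. -/
def tupleEdges (w : ι → Word) : Finset (Sym2 ℕ+) := Finset.univ.biUnion fun i => edgeSet (w i)

/-- Two words share an edge. -/
def ShareEdge (w w' : Word) : Prop := ∃ e, passages w e ≠ 0 ∧ passages w' e ≠ 0

lemma ShareEdge.symm {w w' : Word} (h : ShareEdge w w') : ShareEdge w' w := by
  obtain ⟨e, h1, h2⟩ := h
  exact ⟨e, h2, h1⟩

/-- Every edge of the tuple is passed at least twice, and every word shares an edge with another
word of the tuple. -/
def IsLinked (w : ι → Word) : Prop :=
  (∀ e ∈ tupleEdges w, 2 ≤ ∑ i, passages (w i) e) ∧ ∀ i, ∃ j, i ≠ j ∧ ShareEdge (w i) (w j)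

lemma supp_subset_tupleSupp (w : ι → Word) (i : ι) : supp (w i) ⊆ tupleSupp w :=
  Finset.subset_biUnion_of_mem (fun i => supp (w i)) (Finset.mem_univ i)

lemma edgeSet_subset_tupleEdges (w : ι → Word) (i : ι) : edgeSet (w i) ⊆ tupleEdges w :=
  Finset.subset_biUnion_of_mem (fun i => edgeSet (w i)) (Finset.mem_univ i)

lemma connects_tupleEdges {w : ι → Word} (hw : ∀ i, IsClosedFromOne (w i)) :
    Connects (tupleEdges w) (tupleSupp w) := by
  have key : ∀ c : ℕ+ → ZMod 2, (∀ e ∈ tupleEdges w, cob c e = 0) → ∀ x ∈ tupleSupp w,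
      c x = c 1 := by
    intro c hc x hx
    obtain ⟨i, -, hi⟩ := Finset.mem_biUnion.1 hx
    exact eq_head_of_cob_eq_zero c (w i)
      (fun e he => hc e (edgeSet_subset_tupleEdges w i (by simpa [edgeSet] using he))) 1 (hw i).1 x
      (mem_supp.1 hi)
  intro c hc x hx y hy
  rw [key c hc x hx, key c hc y hy]

lemma mem_tupleSupp_of_mem_tupleEdges {w : ι → Word} {e : Sym2 ℕ+} (he : e ∈ tupleEdges w)
    {x : ℕ+} (hx : x ∈ e) : x ∈ tupleSupp w := by
  obtain ⟨i, -, hi⟩ := Finset.mem_biUnion.1 he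
  exact supp_subset_tupleSupp w i (mem_supp_of_mem_edgeSet hi hx)

/-- The common starting letter `1` makes the union of the graphs connected, and closedness gives the
parity across cuts. -/
lemma isWalkSystem [Nonempty ι] {w : ι → Word} (hw : ∀ i, IsClosedFromOne (w i))
    (hl : IsLinked w) :
    IsWalkSystem (tupleSupp w) (tupleEdges w) (fun i => passages (w i)) where
  nonempty := ⟨1, supp_subset_tupleSupp w (Classical.arbitrary ι) (one_mem_supp (hw _))⟩
  mem_of_ne_zero i e he := edgeSet_subset_tupleEdges w i (mem_edgeSet.2 he)
  mem e he x hx := mem_tupleSupp_of_mem_tupleEdges he hx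
  even i c := by
    rw [sum_passages_mul _ _ (edgeSet_subset_tupleEdges w i), sum_cob_steps c _ 1 1 (hw i).1 (hw i).2,
      zmod_two_add_eq_zero]
  connects := connects_tupleEdges hw
  two_le := hl.1
  shares := hl.2

lemma sum_sum_passages (w : ι → Word) :
    ∑ i, ∑ e ∈ tupleEdges w, passages (w i) e = ∑ i, ((w i).length - 1) :=
  Finset.sum_congr rfl fun i _ => sum_passages _ _ (edgeSet_subset_tupleEdges w i)

/-- The weight of a linked tuple of closed words. -/
theorem IsLinked.two_mul_card_add_card_le [Nonempty ι] {w : ι → Word}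
    (hw : ∀ i, IsClosedFromOne (w i)) (hl : IsLinked w) :
    2 * (tupleSupp w).card + Fintype.card ι ≤ ∑ i, ((w i).length - 1) + 2 := by
  rw [← sum_sum_passages]
  exact (isWalkSystem hw hl).two_mul_card_add_card_le

/-- In a linked tuple of maximal weight the words are matched in pairs. -/
theorem IsLinked.eq_of_shareEdge [Nonempty ι] {w : ι → Word}
    (hw : ∀ i, IsClosedFromOne (w i)) (hl : IsLinked w) (hs : ∀ i, NoSelfEdge (w i))
    (heq : ∑ i, ((w i).length - 1) + 2 ≤ 2 * (tupleSupp w).card + Fintype.card ι) {a b c : ι}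
    (hab : a ≠ b) (hac : a ≠ c) (h1 : ShareEdge (w a) (w b)) (h2 : ShareEdge (w a) (w c)) :
    b = c := by
  obtain ⟨e, h3, h4⟩ := h1
  obtain ⟨f, h5, h6⟩ := h2
  rw [← sum_sum_passages] at heq
  refine (isWalkSystem hw hl).eq_of_shares heq ?_ hab hac h3 h4 h5 h6
  intro e he
  obtain ⟨i, -, hi⟩ := Finset.mem_biUnion.1 he
  exact hs i e hi

end Tuples

/-! ### One-loop words -/

/-- A closed word of weight `(number of steps + 1) / 2` which passes the loop at `1` once and its
other edges twice. -/
structure IsOneLoop (w : Word) : Prop where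
  closed : IsClosedFromOne w
  passages_one : passages w s(1, 1) = 1
  passages_two : ∀ e ∈ edgeSet w, e ≠ s(1, 1) → passages w e = 2 ∧ ¬ e.IsDiag
  weight : 2 * wt w = w.length

/-- The edges of a spanning tree; none of them is a loop, since no colouring cuts a loop. -/
lemma exists_spanning_edges {w : Word} (hw : IsClosedFromOne w) :
    ∃ F ⊆ {e ∈ edgeSet w | ¬ e.IsDiag}, F.card + 1 = wt w := by
  classical
  have hc := connects_tupleEdges (ι := Unit) (w := fun _ => w) (fun _ => hw)
  obtain ⟨F, C, hT, hF⟩ := hc.exists_tree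
    (fun e he x hx => mem_tupleSupp_of_mem_tupleEdges he hx)
    ⟨1, by simpa [tupleSupp] using one_mem_supp hw⟩
  have hE : tupleEdges (ι := Unit) (fun _ => w) = edgeSet w := by simp [tupleEdges]
  have hS : tupleSupp (ι := Unit) (fun _ => w) = supp w := by simp [tupleSupp]
  rw [hE] at hF
  rw [hS] at hT
  refine ⟨F, fun e he => Finset.mem_filter.2 ⟨hF he, fun hd => ?_⟩, hT.card⟩
  have h1 := hT.cut_self e he
  rw [cob_of_isDiag _ hd] at h1
  exact zero_ne_one h1

lemma sum_diag_add_sum_not_diag {w : Word} (hw : IsClosedFromOne w) :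
    ∑ e ∈ edgeSet w with e.IsDiag, passages w e + ∑ e ∈ edgeSet w with ¬ e.IsDiag, passages w e + 1
      = w.length := by
  rw [Finset.sum_filter_add_sum_filter_not, sum_passages w _ subset_rfl]
  have h6 : w.length ≠ 0 := by
    rw [ne_eq, List.length_eq_zero_iff]
    rintro rfl
    simpa using hw.1
  omega

/-- Each tree edge accounts for two steps at least, and the diagonal steps come on top. -/
lemma two_mul_wt_le {w : Word} (hw : IsClosedFromOne w)
    (h2 : ∀ e ∈ edgeSet w, ¬ e.IsDiag → 2 ≤ passages w e) :
    2 * wt w + ∑ e ∈ edgeSet w with e.IsDiag, passages w e ≤ w.length + 1 := by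
  obtain ⟨F, hF, hcard⟩ := exists_spanning_edges hw
  have h1 : F.card * 2 ≤ ∑ e ∈ F, passages w e :=
    Finset.card_nsmul_le_sum F _ 2 fun e he => by
      have := Finset.mem_filter.1 (hF he)
      exact h2 e this.1 this.2
  have h3 := Finset.sum_le_sum_of_subset (f := passages w) hF
  have h4 := sum_diag_add_sum_not_diag hw
  omega

/-- The same count with `f` charged its actual number of passages instead of two. For a word with
one diagonal step and maximal weight this excludes a third passage. -/
lemma passages_add_two_mul_wt_le {w : Word} (hw : IsClosedFromOne w)
    (h2 : ∀ e ∈ edgeSet w, ¬ e.IsDiag → 2 ≤ passages w e) {f : Sym2 ℕ+} (hf : f ∈ edgeSet w)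
    (hd : ¬ f.IsDiag) :
    2 * wt w + ∑ e ∈ edgeSet w with e.IsDiag, passages w e + passages w f ≤ w.length + 3 := by
  classical
  obtain ⟨F, hF, hcard⟩ := exists_spanning_edges hw
  have hF' : insert f F ⊆ {e ∈ edgeSet w | ¬ e.IsDiag} :=
    Finset.insert_subset (Finset.mem_filter.2 ⟨hf, hd⟩) hF
  have h1 : ((insert f F).erase f).card * 2 ≤ ∑ e ∈ (insert f F).erase f, passages w e :=
    Finset.card_nsmul_le_sum _ _ 2 fun e he => by
      have := Finset.mem_filter.1 (hF' (Finset.mem_of_mem_erase he))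
      exact h2 e this.1 this.2
  have h3 := Finset.sum_le_sum_of_subset (f := passages w) hF'
  rw [← Finset.add_sum_erase _ _ (Finset.mem_insert_self f F)] at h3
  have h4 := sum_diag_add_sum_not_diag hw
  rw [Finset.card_erase_of_mem (Finset.mem_insert_self f F)] at h1
  have h5 := Finset.card_le_card (Finset.subset_insert f F)
  omega

/-- A linked pair of words of maximal weight, one of which has a loop, consists of one-loop words
which share no edge but the loop at `1`. -/
theorem IsLinked.isOneLoop {w : Fin 2 → Word} (hw : ∀ i, IsClosedFromOne (w i)) (hl : IsLinked w)
    (heq : ∑ i, ((w i).length - 1) ≤ 2 * (tupleSupp w).card)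
    {g : Sym2 ℕ+} (hg : g.IsDiag) (hgE : g ∈ tupleEdges w) :
    ∀ i j, i ≠ j → IsOneLoop (w i) ∧ ∀ e ∈ edgeSet (w i), e ≠ s(1, 1) → e ∉ edgeSet (w j) := by
  have hs := isWalkSystem hw hl
  obtain ⟨hg1, h1⟩ := hs.loop_pair (by rw [sum_sum_passages]; omega) 1
    (supp_subset_tupleSupp w 0 (one_mem_supp (hw _))) (fun i c hc e he x hx =>
      eq_head_of_cob_eq_zero c (w i) (fun f hf => hc f (by simpa [passages, List.count_eq_zero])) 1
        (hw i).1 x (mem_supp.1 (mem_supp_of_mem_edgeSet (mem_edgeSet.2 he) hx))) hg hgE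
  subst hg1
  have hlen : ∀ i, (w i).length ≠ 0 := by
    intro i h6
    rw [List.length_eq_zero_iff] at h6
    have := (hw i).1
    simp [h6] at this
  have hle : ∀ i, 2 * wt (w i) ≤ (w i).length := by
    intro i
    obtain ⟨j, hij⟩ := exists_ne i
    have h2 := two_mul_wt_le (hw i) (fun e he hd => by
      rw [((h1 i j hij.symm).2 e (by rintro rfl; exact hd hg) (mem_edgeSet.1 he)).1])
    have h3 : passages (w i) s(1, 1) ≤ ∑ e ∈ edgeSet (w i) with e.IsDiag, passages (w i) e :=
      Finset.single_le_sum (fun _ _ => Nat.zero_le _) (by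
        rw [Finset.mem_filter, mem_edgeSet]
        exact ⟨by have := (h1 i j hij.symm).1; omega, hg⟩)
    rw [(h1 i j hij.symm).1] at h3
    omega
  -- Both words contain the letter `1`, so the supports overlap; together with `heq` this forces
  -- equality in both instances of `hle`.
  have hcard : (tupleSupp w).card + 1 ≤ wt (w 0) + wt (w 1) := by
    have h2 : tupleSupp w = supp (w 0) ∪ supp (w 1) := by
      ext x; simp [tupleSupp, Fin.exists_fin_two]
    have h3 : 0 < (supp (w 0) ∩ supp (w 1)).card :=
      Finset.card_pos.2 ⟨1, Finset.mem_inter.2 ⟨one_mem_supp (hw 0), one_mem_supp (hw 1)⟩⟩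
    have h4 := Finset.card_union_add_card_inter (supp (w 0)) (supp (w 1))
    rw [h2]
    simp only [wt]
    omega
  rw [Fin.sum_univ_two] at heq
  have hwt : ∀ i, 2 * wt (w i) = (w i).length := by
    have h01 := hle 0
    have h02 := hle 1
    have h03 := hlen 0
    have h04 := hlen 1
    intro i
    fin_cases i <;> simp only [Fin.zero_eta, Fin.mk_one] <;> omega
  intro i j hij
  refine ⟨⟨hw i, (h1 i j hij).1, fun e he hne => ?_, hwt i⟩, fun e he hne hej => ?_⟩
  · have := (h1 i j hij).2 e hne (mem_edgeSet.1 he)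
    exact ⟨this.1, this.2.2⟩
  · exact mem_edgeSet.1 hej ((h1 i j hij).2 e hne (mem_edgeSet.1 he)).2.1

/-! ### Reduced words -/

/-- Dropping a letter equal to its neighbour removes one diagonal step and changes nothing else. -/
lemma destutter'_ne_spec (a : ℕ+) (l : Word) :
    (l.destutter' (· ≠ ·) a).head? = some a ∧
    (l.destutter' (· ≠ ·) a).getLast? = (a :: l).getLast? ∧
    supp (l.destutter' (· ≠ ·) a) = supp (a :: l) ∧
    steps (l.destutter' (· ≠ ·) a) = (steps (a :: l)).filter (fun e => ¬ e.IsDiag) := by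
  induction l generalizing a with
  | nil => simp
  | cons b l ih =>
    obtain ⟨h1, h2, h3, h4⟩ := ih b
    by_cases hab : a = b
    · subst hab
      rw [List.destutter'_cons, if_neg (by simp)]
      refine ⟨h1, by simpa using h2, ?_, ?_⟩
      · rw [h3]; simp [supp]
      · rw [h4]; simp
    · rw [List.destutter'_cons, if_pos hab]
      obtain ⟨t, ht⟩ : ∃ t, l.destutter' (· ≠ ·) b = b :: t := by
        cases h : l.destutter' (· ≠ ·) b with
        | nil => rw [h] at h1; simp at h1
        | cons c t =>
          rw [h] at h1
          exact ⟨t, by simpa using h1⟩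
      rw [ht] at h2 h3 h4 ⊢
      refine ⟨rfl, by simpa using h2, ?_, ?_⟩
      · simp only [supp, List.toFinset_cons] at h3 ⊢
        rw [h3]
      · simp [hab, h4]

lemma reduced_spec {w : Word} (hw : w ≠ []) :
    (reduced w).head? = w.head? ∧ (reduced w).getLast? = w.getLast? ∧ supp (reduced w) = supp w ∧
      steps (reduced w) = (steps w).filter (fun e => ¬ e.IsDiag) := by
  cases w with
  | nil => exact absurd rfl hw
  | cons a l => exact destutter'_ne_spec a l

lemma passages_reduced {w : Word} (hw : w ≠ []) (e : Sym2 ℕ+) :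
    passages (reduced w) e = if e.IsDiag then 0 else passages w e := by
  rw [passages, (reduced_spec hw).2.2.2]
  split_ifs with h
  · exact List.count_eq_zero.2 (by simp [h])
  · rw [List.count_filter (by simpa using h), passages]

lemma edgeSet_reduced {w : Word} (hw : w ≠ []) :
    edgeSet (reduced w) = {e ∈ edgeSet w | ¬ e.IsDiag} := by
  ext e
  rw [mem_edgeSet, passages_reduced hw, Finset.mem_filter, mem_edgeSet]
  split_ifs with h <;> simp [h]

/-- Reduction shortens the word by its number of diagonal steps, so the lengths leave only the
passage of `(1, 1)`. The weight of a Wigner word then rules out a third passage of any edge. -/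
lemma isOneLoop_iff (w : Word) (k : ℕ) :
    (IsClosedFromOne w ∧ w.length = k + 1 ∧ passages w s(1, 1) = 1 ∧
      IsWigner (reduced w) ∧ (reduced w).length = k) ↔ IsOneLoop w ∧ w.length = k + 1 := by
  by_cases hw0 : w = []
  · subst hw0
    simp
  have hspec := reduced_spec hw0
  have hne : reduced w ≠ [] := by
    intro h
    have := hspec.1
    rw [h] at this
    exact hw0 (by simpa using this.symm)
  have hlen : (reduced w).length ≠ 0 := by simpa using hne
  have hwt : wt (reduced w) = wt w := by simp only [wt, hspec.2.2.1]
  have hsum : ∑ e ∈ edgeSet w with ¬ e.IsDiag, passages w e + 1 = (reduced w).length := by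
    have := sum_passages (reduced w) _ subset_rfl
    have h1 : ∑ e ∈ edgeSet w with ¬ e.IsDiag, passages (reduced w) e =
        ∑ e ∈ edgeSet w with ¬ e.IsDiag, passages w e := Finset.sum_congr rfl fun e he => by
      rw [passages_reduced hw0, if_neg (Finset.mem_filter.1 he).2]
    rw [edgeSet_reduced hw0, h1] at this
    omega
  have hd : Sym2.IsDiag s((1 : ℕ+), 1) := by simp
  constructor
  · rintro ⟨h1, h2, h3, h4, h5⟩
    refine ⟨⟨h1, h3, ?_, ?_⟩, h2⟩
    · have h11 : s((1 : ℕ+), 1) ∈ edgeSet w := by rw [mem_edgeSet, h3]; simp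
      have hdiag := sum_diag_add_sum_not_diag h1
      have hdiag1 : ∑ e ∈ edgeSet w with e.IsDiag, passages w e = 1 := by omega
      have htwo : ∀ e ∈ edgeSet w, ¬ e.IsDiag → 2 ≤ passages w e := by
        intro e he hed
        have := h4.1.2 e (by rw [edgeSet_reduced hw0]; exact Finset.mem_filter.2 ⟨he, hed⟩)
        rwa [passages_reduced hw0, if_neg hed] at this
      intro e he hne1
      have hed : ¬ e.IsDiag := by
        intro hed
        have h6 : ∑ f ∈ ({s(1, 1), e} : Finset (Sym2 ℕ+)), passages w f ≤
            ∑ e ∈ edgeSet w with e.IsDiag, passages w e := by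
          apply Finset.sum_le_sum_of_subset
          intro f hf
          rcases Finset.mem_insert.1 hf with rfl | hf
          · exact Finset.mem_filter.2 ⟨h11, hd⟩
          · rw [Finset.mem_singleton.1 hf]; exact Finset.mem_filter.2 ⟨he, hed⟩
        rw [Finset.sum_pair hne1.symm, hdiag1, h3] at h6
        exact mem_edgeSet.1 he (by omega)
      refine ⟨?_, hed⟩
      have h7 := passages_add_two_mul_wt_le h1 htwo he hed
      have h8 := htwo e he hed
      have h9 := h4.2
      omega
    · have h9 := h4.2
      omega
  · rintro ⟨h, h2⟩
    have hdiag := sum_diag_add_sum_not_diag h.closed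
    have hdiag1 : ∑ e ∈ edgeSet w with e.IsDiag, passages w e = 1 := by
      rw [Finset.sum_eq_single s(1, 1), h.passages_one]
      · intro e he hne1
        rw [Finset.mem_filter] at he
        exact absurd he.2 (h.passages_two e he.1 hne1).2
      · intro h6
        exact absurd (Finset.mem_filter.2 ⟨by rw [mem_edgeSet, h.passages_one]; simp, hd⟩) h6
    have hk : (reduced w).length = k := by omega
    refine ⟨h.closed, h2, h.passages_one, ⟨⟨⟨hne, ?_⟩, ?_⟩, ?_⟩, hk⟩
    · rw [hspec.1, hspec.2.1, h.closed.1, h.closed.2]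
    · intro e he
      rw [edgeSet_reduced hw0, Finset.mem_filter] at he
      rw [passages_reduced hw0, if_neg he.2,
        (h.passages_two e he.1 (by rintro rfl; exact he.2 hd)).1]
    · have := h.weight
      rw [hwt]
      omega

/-! ### Random variables with all moments -/

section Moments

variable {Ω : Type*} [MeasurableSpace Ω] {P : Measure Ω}

/-- A random variable all of whose moments are finite. -/
def HasMoments (f : Ω → ℝ) (P : Measure Ω) : Prop := ∀ p : ℕ, MemLp f p P

lemma HasMoments.memLp_two {f : Ω → ℝ} (hf : HasMoments f P) : MemLp f 2 P := hf 2

lemma HasMoments.integrable {f : Ω → ℝ} (hf : HasMoments f P) : Integrable f P :=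
  memLp_one_iff_integrable.1 (by simpa using hf 1)

lemma HasMoments.mul {f g : Ω → ℝ} (hf : HasMoments f P) (hg : HasMoments g P) :
    HasMoments (fun ω => f ω * g ω) P := by
  intro p
  have : ENNReal.HolderTriple (((2 * p : ℕ) : ENNReal)) ((2 * p : ℕ) : ENNReal) (p : ENNReal) := by
    constructor
    push_cast
    rw [ENNReal.mul_inv (by simp) (by simp), ← add_mul, ENNReal.inv_two_add_inv_two, one_mul]
  exact MemLp.mul' (hg (2 * p)) (hf (2 * p))

lemma HasMoments.add {f g : Ω → ℝ} (hf : HasMoments f P) (hg : HasMoments g P) :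
    HasMoments (fun ω => f ω + g ω) P := fun p => (hf p).add (hg p)

lemma HasMoments.sub {f g : Ω → ℝ} (hf : HasMoments f P) (hg : HasMoments g P) :
    HasMoments (fun ω => f ω - g ω) P := fun p => (hf p).sub (hg p)

lemma HasMoments.const_mul {f : Ω → ℝ} (hf : HasMoments f P) (c : ℝ) :
    HasMoments (fun ω => c * f ω) P := fun p => (hf p).const_mul c

lemma HasMoments.abs {f : Ω → ℝ} (hf : HasMoments f P) : HasMoments (fun ω => |f ω|) P :=
  fun p => (hf p).abs

lemma hasMoments_sum {ι : Type*} (s : Finset ι) {f : ι → Ω → ℝ}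
    (hf : ∀ i ∈ s, HasMoments (f i) P) : HasMoments (fun ω => ∑ i ∈ s, f i ω) P :=
  fun p => memLp_finsetSum s fun i hi => hf i hi p

variable [IsProbabilityMeasure P]

lemma hasMoments_const (c : ℝ) : HasMoments (fun _ : Ω => c) P := fun _ => memLp_const c

lemma HasMoments.pow {f : Ω → ℝ} (hf : HasMoments f P) (n : ℕ) :
    HasMoments (fun ω => f ω ^ n) P := by
  induction n with
  | zero => simpa using hasMoments_const 1
  | succ n ih => simpa only [pow_succ] using ih.mul hf

lemma hasMoments_prod {ι : Type*} (s : Finset ι) {f : ι → Ω → ℝ}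
    (hf : ∀ i ∈ s, HasMoments (f i) P) : HasMoments (fun ω => ∏ i ∈ s, f i ω) P := by
  classical
  induction s using Finset.induction_on with
  | empty => simpa using hasMoments_const 1
  | insert a s ha ih =>
    simp only [Finset.prod_insert ha]
    exact (hf a (by simp)).mul (ih fun i hi => hf i (by simp [hi]))

end Moments

/-! ### Independence and moments of the entries -/

section Entries

variable {Ω : Type*} {ξ : Sym2 ℕ+ → Ω → ℝ}

/-- The σ-algebra generated by the entries in `A`. -/
abbrev sigmaEdges (ξ : Sym2 ℕ+ → Ω → ℝ) (A : Set (Sym2 ℕ+)) : MeasurableSpace Ω :=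
  ⨆ e ∈ A, MeasurableSpace.comap (ξ e) inferInstance

lemma sigmaEdges_mono {A B : Set (Sym2 ℕ+)} (h : A ⊆ B) : sigmaEdges ξ A ≤ sigmaEdges ξ B :=
  biSup_mono h

lemma measurable_sigmaEdges {A : Set (Sym2 ℕ+)} {e : Sym2 ℕ+} (he : e ∈ A) :
    Measurable[sigmaEdges ξ A] (ξ e) := by
  have h : Measurable[MeasurableSpace.comap (ξ e) inferInstance] (ξ e) := comap_measurable _
  exact h.mono (le_iSup₂_of_le e he le_rfl) le_rfl

lemma T_eq_prod_steps (ξ : Sym2 ℕ+ → Ω → ℝ) (w : Word) (ω : Ω) :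
    T ξ w ω = ((steps w).map fun e => ξ e ω).prod := by
  rw [Finset.prod_list_map_count]
  rfl

lemma T_eq_prod (ξ : Sym2 ℕ+ → Ω → ℝ) {w : Word} {E : Finset (Sym2 ℕ+)} (hE : edgeSet w ⊆ E)
    (ω : Ω) : T ξ w ω = ∏ e ∈ E, ξ e ω ^ passages w e := by
  refine Finset.prod_subset hE fun e _ he => ?_
  rw [mem_edgeSet, not_not] at he
  simp [he]

variable [MeasurableSpace Ω] {P : Measure Ω}

/-- The representative of the law of the entry `ξ e`. -/
noncomputable def repEdge (e : Sym2 ℕ+) : Sym2 ℕ+ :=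
  open Classical in if e.IsDiag then s(1, 1) else s(1, 2)

namespace IsWignerEnsemble

lemma identDistrib_repEdge (h : IsWignerEnsemble ξ P) (e : Sym2 ℕ+) :
    IdentDistrib (ξ e) (ξ (repEdge e)) P P := by
  induction e with
  | h i j =>
    by_cases hij : i = j
    · subst hij
      simpa [repEdge] using h.identDistrib_diag i
    · have : repEdge s(i, j) = s(1, 2) := by simp [repEdge, hij]
      rw [this]
      rcases lt_or_gt_of_ne hij with hlt | hlt
      · exact h.identDistrib_offDiag i j hlt
      · rw [Sym2.eq_swap]
        exact h.identDistrib_offDiag j i hlt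

lemma hasMoments (h : IsWignerEnsemble ξ P) (e : Sym2 ℕ+) : HasMoments (ξ e) P := by
  intro p
  rw [(h.identDistrib_repEdge e).memLp_iff]
  rw [repEdge]
  split_ifs
  · exact h.memLp_diag p
  · exact h.memLp_offDiag p

lemma integral_comp (h : IsWignerEnsemble ξ P) (e : Sym2 ℕ+) {φ : ℝ → ℝ} (hφ : Measurable φ) :
    ∫ ω, φ (ξ e ω) ∂P = ∫ ω, φ (ξ (repEdge e) ω) ∂P :=
  ((h.identDistrib_repEdge e).comp hφ).integral_eq

lemma integral_eq_zero (h : IsWignerEnsemble ξ P) (e : Sym2 ℕ+) : ∫ ω, ξ e ω ∂P = 0 := by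
  rw [h.integral_comp e (φ := fun x => x) measurable_id]
  rw [repEdge]
  split_ifs
  · exact h.mean_diag
  · exact h.mean_offDiag

lemma integral_sq (h : IsWignerEnsemble ξ P) {e : Sym2 ℕ+} (he : ¬ e.IsDiag) :
    ∫ ω, ξ e ω ^ 2 ∂P = 1 := by
  rw [h.integral_comp e (φ := fun x => x ^ 2) (by fun_prop)]
  simpa [repEdge, he] using h.variance_offDiag

lemma integral_prod (h : IsWignerEnsemble ξ P) (s : Finset (Sym2 ℕ+)) (φ : Sym2 ℕ+ → ℝ → ℝ)
    (hφ : ∀ e, Measurable (φ e)) :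
    ∫ ω, ∏ e ∈ s, φ e (ξ e ω) ∂P = ∏ e ∈ s, ∫ ω, φ e (ξ e ω) ∂P := by
  have h1 : iIndepFun (fun e : s => ξ e) P := h.indep.precomp Subtype.val_injective
  have h2 := h1.integral_fun_prod_comp (f := fun e : s => φ e)
    (fun e => (h.measurable e).aemeasurable) (fun e => (hφ e).aestronglyMeasurable)
  rw [← Finset.prod_coe_sort s (fun e => ∫ ω, φ e (ξ e ω) ∂P), ← h2]
  congr 1 with ω
  exact (Finset.prod_coe_sort s (fun e => φ e (ξ e ω))).symm

end IsWignerEnsemble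

namespace IsWignerEnsemble

lemma sigmaEdges_le (h : IsWignerEnsemble ξ P) (A : Set (Sym2 ℕ+)) :
    sigmaEdges ξ A ≤ ‹MeasurableSpace Ω› :=
  iSup₂_le fun e _ => (h.measurable e).comap_le

lemma indepFun_of_disjoint (h : IsWignerEnsemble ξ P) {A B : Set (Sym2 ℕ+)} (hAB : Disjoint A B)
    {X Y : Ω → ℝ} (hX : Measurable[sigmaEdges ξ A] X) (hY : Measurable[sigmaEdges ξ B] Y) :
    IndepFun X Y P := by
  rw [IndepFun_iff_Indep]
  have h1 : Indep (sigmaEdges ξ A) (sigmaEdges ξ B) P :=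
    indep_iSup_of_disjoint (fun e => (h.measurable e).comap_le) h.indep.iIndep hAB
  exact indep_of_indep_of_le h1 (measurable_iff_comap_le.1 hX) (measurable_iff_comap_le.1 hY)

lemma integral_mul_of_disjoint (h : IsWignerEnsemble ξ P) {A B : Set (Sym2 ℕ+)}
    (hAB : Disjoint A B) {X Y : Ω → ℝ} (hX : Measurable[sigmaEdges ξ A] X)
    (hY : Measurable[sigmaEdges ξ B] Y) :
    ∫ ω, X ω * Y ω ∂P = (∫ ω, X ω ∂P) * ∫ ω, Y ω ∂P :=
  (h.indepFun_of_disjoint hAB hX hY).integral_fun_mul_eq_mul_integral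
    (hX.mono (h.sigmaEdges_le A) le_rfl).aestronglyMeasurable
    (hY.mono (h.sigmaEdges_le B) le_rfl).aestronglyMeasurable

end IsWignerEnsemble

/-! ### The variables of words -/

omit [MeasurableSpace Ω] in
lemma measurable_T {w : Word} {A : Set (Sym2 ℕ+)} (hA : ↑(edgeSet w) ⊆ A) :
    Measurable[sigmaEdges ξ A] (T ξ w) :=
  Finset.measurable_fun_prod _ fun _ he => (measurable_sigmaEdges (hA he)).pow_const _

lemma measurable_TBar {w : Word} {A : Set (Sym2 ℕ+)} (hA : ↑(edgeSet w) ⊆ A) :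
    Measurable[sigmaEdges ξ A] (TBar ξ P w) :=
  (measurable_T hA).sub_const _

namespace IsWignerEnsemble

lemma integral_T_mul_T (h : IsWignerEnsemble ξ P) (u v : Word) :
    ∫ ω, T ξ u ω * T ξ v ω ∂P =
      ∏ e ∈ edgeSet u ∪ edgeSet v, ∫ ω, ξ e ω ^ (passages u e + passages v e) ∂P := by
  rw [← h.integral_prod _ (fun e x => x ^ (passages u e + passages v e)) (by fun_prop)]
  simp_rw [pow_add, Finset.prod_mul_distrib]
  congr 1 with ω
  rw [T_eq_prod ξ Finset.subset_union_left, T_eq_prod ξ Finset.subset_union_right]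

lemma integral_T (h : IsWignerEnsemble ξ P) (w : Word) :
    ∫ ω, T ξ w ω ∂P = ∏ e ∈ edgeSet w, ∫ ω, ξ e ω ^ passages w e ∂P :=
  h.integral_prod _ (fun e x => x ^ passages w e) (by fun_prop)

lemma integral_T_eq_zero (h : IsWignerEnsemble ξ P) {w : Word} {e : Sym2 ℕ+}
    (he : passages w e = 1) : ∫ ω, T ξ w ω ∂P = 0 := by
  rw [h.integral_T]
  refine Finset.prod_eq_zero (i := e) (by rw [mem_edgeSet, he]; simp) ?_
  simpa [he] using h.integral_eq_zero e

variable [IsProbabilityMeasure P]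

lemma hasMoments_T (h : IsWignerEnsemble ξ P) (w : Word) : HasMoments (T ξ w) P :=
  hasMoments_prod _ fun e _ => (h.hasMoments e).pow _

lemma hasMoments_TBar (h : IsWignerEnsemble ξ P) (w : Word) : HasMoments (TBar ξ P w) P :=
  (h.hasMoments_T w).sub (hasMoments_const _)

lemma integral_TBar (h : IsWignerEnsemble ξ P) (w : Word) : ∫ ω, TBar ξ P w ω ∂P = 0 := by
  simp [TBar, integral_sub (h.hasMoments_T w).integrable (integrable_const _)]

lemma integral_TBar_mul_TBar (h : IsWignerEnsemble ξ P) (u v : Word) :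
    ∫ ω, TBar ξ P u ω * TBar ξ P v ω ∂P =
      ∫ ω, T ξ u ω * T ξ v ω ∂P - (∫ ω, T ξ u ω ∂P) * ∫ ω, T ξ v ω ∂P := by
  have h1 : ∀ ω, TBar ξ P u ω * TBar ξ P v ω = T ξ u ω * T ξ v ω
      - (∫ ω, T ξ u ω ∂P) * T ξ v ω - (∫ ω, T ξ v ω ∂P) * TBar ξ P u ω := by
    intro ω
    simp only [TBar]
    ring
  simp_rw [h1]
  rw [integral_sub, integral_sub, integral_const_mul, integral_const_mul, h.integral_TBar]
  · ring
  · exact ((h.hasMoments_T u).mul (h.hasMoments_T v)).integrable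
  · exact ((h.hasMoments_T v).const_mul _).integrable
  · exact (((h.hasMoments_T u).mul (h.hasMoments_T v)).sub ((h.hasMoments_T v).const_mul _)).integrable
  · exact ((h.hasMoments_TBar u).const_mul _).integrable

/-- The expectation of a product of centred word variables vanishes unless the words are
linked. -/
lemma integral_prod_TBar_eq_zero (h : IsWignerEnsemble ξ P) {ι : Type*} [Fintype ι] (w : ι → Word)
    (hl : ¬ IsLinked w) : ∫ ω, ∏ i, TBar ξ P (w i) ω ∂P = 0 := by
  classical
  rw [IsLinked, not_and_or] at hl
  rcases hl with hl | hl
  -- Some edge is passed once by the whole tuple. The word containing it has `E T = 0`, so its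
  -- `TBar` is `T`; the centred entry factors out and is independent of all the rest.
  · push Not at hl
    obtain ⟨e, he, hlt⟩ := hl
    obtain ⟨i, -, hi⟩ := Finset.mem_biUnion.1 he
    have hsum := Finset.add_sum_erase Finset.univ (fun j => passages (w j) e) (Finset.mem_univ i)
    have hi1 : passages (w i) e = 1 := by
      have := mem_edgeSet.1 hi
      omega
    have hj : ∀ j ∈ Finset.univ.erase i, e ∉ edgeSet (w j) := by
      intro j hj
      have := Finset.single_le_sum (f := fun j => passages (w j) e) (fun _ _ => Nat.zero_le _) hj
      rw [mem_edgeSet, not_not]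
      omega
    have hT : ∀ ω, T ξ (w i) ω = ξ e ω * ∏ f ∈ (edgeSet (w i)).erase e, ξ f ω ^ passages (w i) f := by
      intro ω
      rw [T, ← Finset.mul_prod_erase _ _ hi, hi1, pow_one]
    have hcongr : ∀ ω, ∏ i, TBar ξ P (w i) ω = ξ e ω *
        ((∏ f ∈ (edgeSet (w i)).erase e, ξ f ω ^ passages (w i) f) *
          ∏ j ∈ Finset.univ.erase i, TBar ξ P (w j) ω) := by
      intro ω
      rw [← Finset.mul_prod_erase _ _ (Finset.mem_univ i), TBar, h.integral_T_eq_zero hi1, sub_zero, hT]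
      ring
    simp_rw [hcongr]
    rw [h.integral_mul_of_disjoint (A := {e}) (B := {e}ᶜ) disjoint_compl_right
      (measurable_sigmaEdges rfl), h.integral_eq_zero, zero_mul]
    refine Measurable.mul ?_ ?_
    · exact Finset.measurable_fun_prod _ fun f hf =>
        (measurable_sigmaEdges (by simpa using (Finset.mem_erase.1 hf).1)).pow_const _
    · exact Finset.measurable_fun_prod _ fun j hj' => measurable_TBar fun f hf => by
        rintro rfl
        exact hj j hj' hf
  -- Some word shares no edge with the others, so its centred variable is independent of their
  -- product.
  · push Not at hl
    obtain ⟨i, hi⟩ := hl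
    simp_rw [← Finset.mul_prod_erase Finset.univ _ (Finset.mem_univ i)]
    rw [h.integral_mul_of_disjoint (A := edgeSet (w i)) (B := (↑(edgeSet (w i)))ᶜ) disjoint_compl_right
      (measurable_TBar subset_rfl), h.integral_TBar, zero_mul]
    refine Finset.measurable_fun_prod _ fun j hj => measurable_TBar fun f hf hfi => ?_
    exact hi j (Finset.mem_erase.1 hj).1.symm ⟨f, mem_edgeSet.1 hfi, mem_edgeSet.1 hf⟩

/-! ### Uniform bounds -/

/-- The entries have only two laws, so one constant bounds all their relevant moments; a word of
length at most `k` has at most `k` edges. -/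
lemma exists_integral_abs_T_pow_le (h : IsWignerEnsemble ξ P) (k m : ℕ) :
    ∃ M : ℝ, ∀ w : Word, w.length ≤ k → ∫ ω, |T ξ w ω| ^ m ∂P ≤ M := by
  -- The summand `1` ensures `1 ≤ B`, so that the number of edges can be replaced by `k` in the
  -- exponent.
  set B : ℝ := ∫ ω, (1 + |ξ s(1, 1) ω|) ^ (k * m) ∂P + ∫ ω, (1 + |ξ s(1, 2) ω|) ^ (k * m) ∂P + 1
    with hB
  have hpos : ∀ e, 0 ≤ ∫ ω, (1 + |ξ e ω|) ^ (k * m) ∂P := fun e =>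
    integral_nonneg fun ω => by positivity
  have hB1 : 1 ≤ B := by
    have := hpos s(1, 1)
    have := hpos s(1, 2)
    linarith
  have hle : ∀ e, ∀ p ≤ k * m, ∫ ω, |ξ e ω| ^ p ∂P ≤ B := by
    intro e p hp
    have h1 : ∫ ω, |ξ e ω| ^ p ∂P ≤ ∫ ω, (1 + |ξ e ω|) ^ (k * m) ∂P := by
      refine integral_mono (((h.hasMoments e).abs).pow p).integrable
        (((hasMoments_const 1).add (h.hasMoments e).abs).pow _).integrable fun ω => ?_
      have h0 := abs_nonneg (ξ e ω)
      calc |ξ e ω| ^ p ≤ (1 + |ξ e ω|) ^ p := by gcongr; linarith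
        _ ≤ (1 + |ξ e ω|) ^ (k * m) := pow_le_pow_right₀ (by linarith) hp
    rw [h.integral_comp e (φ := fun x => (1 + |x|) ^ (k * m)) (by fun_prop)] at h1
    refine h1.trans ?_
    have := hpos s(1, 1)
    have := hpos s(1, 2)
    rw [repEdge]
    split_ifs <;> linarith
  refine ⟨B ^ k, fun w hw => ?_⟩
  have hpas : ∀ e, passages w e ≤ k := fun e =>
    List.count_le_length.trans ((length_steps w).le.trans (by omega))
  have h1 : ∀ ω, |T ξ w ω| ^ m = ∏ e ∈ edgeSet w, |ξ e ω| ^ (passages w e * m) := by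
    intro ω
    rw [T, Finset.abs_prod, ← Finset.prod_pow]
    simp_rw [abs_pow, pow_mul]
  simp_rw [h1]
  rw [h.integral_prod _ (fun e x => |x| ^ (passages w e * m)) (by fun_prop)]
  calc ∏ e ∈ edgeSet w, ∫ ω, |ξ e ω| ^ (passages w e * m) ∂P ≤ ∏ e ∈ edgeSet w, B :=
        Finset.prod_le_prod (fun e _ => integral_nonneg fun ω => by positivity)
          (fun e _ => hle e _ (Nat.mul_le_mul_right m (hpas e)))
    _ = B ^ (edgeSet w).card := by simp
    _ ≤ B ^ k := pow_le_pow_right₀ hB1 ((List.toFinset_card_le _).trans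
        ((length_steps w).le.trans (by omega)))

lemma exists_integral_abs_TBar_pow_le (h : IsWignerEnsemble ξ P) (k m : ℕ) :
    ∃ M : ℝ, ∀ w : Word, w.length ≤ k → ∫ ω, |TBar ξ P w ω| ^ m ∂P ≤ M := by
  obtain ⟨M, hM⟩ := h.exists_integral_abs_T_pow_le k m
  obtain ⟨M', hM'⟩ := h.exists_integral_abs_T_pow_le k 1
  refine ⟨2 ^ (m - 1) * (M + M' ^ m), fun w hw => ?_⟩
  have h1 : |∫ ω, T ξ w ω ∂P| ≤ M' := (abs_integral_le_integral_abs).trans (by simpa using hM' w hw)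
  have hmono : ∫ ω, |TBar ξ P w ω| ^ m ∂P ≤ ∫ ω, 2 ^ (m - 1) * (|T ξ w ω| ^ m + M' ^ m) ∂P := by
    refine integral_mono ((h.hasMoments_TBar w).abs.pow m).integrable
      ((((h.hasMoments_T w).abs.pow m).add (hasMoments_const _)).const_mul _).integrable fun ω => ?_
    calc |TBar ξ P w ω| ^ m ≤ (|T ξ w ω| + |∫ ω, T ξ w ω ∂P|) ^ m := by
          gcongr
          exact abs_sub _ _
      _ ≤ 2 ^ (m - 1) * (|T ξ w ω| ^ m + |∫ ω, T ξ w ω ∂P| ^ m) :=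
          add_pow_le (abs_nonneg _) (abs_nonneg _) m
      _ ≤ _ := by gcongr
  refine hmono.trans ?_
  rw [integral_const_mul, integral_add ((h.hasMoments_T w).abs.pow m).integrable (integrable_const _)]
  simp only [integral_const, probReal_univ, one_smul]
  gcongr
  exact hM w hw

/-- A crude substitute for Hölder's inequality: the product is at most a power of its largest
factor. The `1` covers an empty index type. -/
lemma abs_prod_le_one_add_sum {ι : Type*} [Fintype ι] (x : ι → ℝ) :
    |∏ i, x i| ≤ 1 + ∑ i, |x i| ^ Fintype.card ι := by
  have hs : 0 ≤ ∑ i, |x i| ^ Fintype.card ι := Finset.sum_nonneg fun i _ => by positivity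
  rw [Finset.abs_prod]
  by_cases hι : Nonempty ι
  · obtain ⟨j, -, hj⟩ := Finset.exists_max_image Finset.univ (fun i => |x i|) Finset.univ_nonempty
    have h1 : ∏ i, |x i| ≤ |x j| ^ Fintype.card ι := by
      refine (Finset.prod_le_prod (fun i _ => abs_nonneg _) (fun i hi => hj i hi)).trans ?_
      simp
    have h2 := Finset.single_le_sum (f := fun i => |x i| ^ Fintype.card ι)
      (fun i _ => by positivity) (Finset.mem_univ j)
    linarith
  · simp [not_nonempty_iff.1 hι]

lemma exists_abs_integral_prod_TBar_le (h : IsWignerEnsemble ξ P) (ι : Type*) [Fintype ι] (k : ℕ) :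
    ∃ M : ℝ, 0 ≤ M ∧ ∀ w : ι → Word, (∀ i, (w i).length ≤ k) →
      |∫ ω, ∏ i, TBar ξ P (w i) ω ∂P| ≤ M := by
  obtain ⟨M, hM⟩ := h.exists_integral_abs_TBar_pow_le k (Fintype.card ι)
  refine ⟨|1 + Fintype.card ι * M|, abs_nonneg _, fun w hw => ?_⟩
  refine abs_integral_le_integral_abs.trans (le_trans ?_ (le_abs_self _))
  have hint : ∀ i, Integrable (fun ω => |TBar ξ P (w i) ω| ^ Fintype.card ι) P := fun i =>
    ((h.hasMoments_TBar (w i)).abs.pow _).integrable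
  calc ∫ ω, |∏ i, TBar ξ P (w i) ω| ∂P
      ≤ ∫ ω, (1 + ∑ i, |TBar ξ P (w i) ω| ^ Fintype.card ι) ∂P :=
        integral_mono (hasMoments_prod _ fun i _ => h.hasMoments_TBar (w i)).abs.integrable
          ((integrable_const _).add (integrable_finsetSum _ fun i _ => hint i))
          fun ω => abs_prod_le_one_add_sum _
    _ = 1 + ∑ i, ∫ ω, |TBar ξ P (w i) ω| ^ Fintype.card ι ∂P := by
        rw [integral_add (integrable_const _) (integrable_finsetSum _ fun i _ => hint i),
          integral_finsetSum _ fun i _ => hint i]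
        simp
    _ ≤ 1 + Fintype.card ι * M := by
        gcongr
        refine (Finset.sum_le_card_nsmul _ _ M fun i _ => hM (w i) (hw i)).trans ?_
        simp

end IsWignerEnsemble

/-! ### Relabelling -/

lemma steps_map (f : ℕ+ → ℕ+) (w : Word) : steps (w.map f) = (steps w).map (Sym2.map f) := by
  induction w with
  | nil => rfl
  | cons a l ih =>
    cases l with
    | nil => rfl
    | cons b l =>
      rw [List.map_cons, List.map_cons, steps_cons_cons, ← List.map_cons, ih]
      simp

lemma edgeSet_map (f : ℕ+ → ℕ+) (w : Word) :
    edgeSet (w.map f) = (edgeSet w).image (Sym2.map f) := by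
  ext e
  simp [edgeSet, steps_map]

lemma sym2_map_injOn {f : ℕ+ → ℕ+} {S : Set ℕ+} (hf : Set.InjOn f S) {e e' : Sym2 ℕ+}
    (he : ∀ x ∈ e, x ∈ S) (he' : ∀ x ∈ e', x ∈ S) (h : Sym2.map f e = Sym2.map f e') : e = e' := by
  induction e with
  | h a b =>
    induction e' with
    | h c d =>
      have ha := he a (by simp)
      have hb := he b (by simp)
      have hc := he' c (by simp)
      have hd := he' d (by simp)
      simp only [Sym2.map_mk, Sym2.eq_iff] at h ⊢
      rcases h with ⟨h1, h2⟩ | ⟨h1, h2⟩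
      · exact Or.inl ⟨hf ha hc h1, hf hb hd h2⟩
      · exact Or.inr ⟨hf ha hd h1, hf hb hc h2⟩

lemma passages_map {f : ℕ+ → ℕ+} {S : Set ℕ+} (hf : Set.InjOn f S) {w : Word}
    (hw : ∀ x ∈ w, x ∈ S) {e : Sym2 ℕ+} (he : ∀ x ∈ e, x ∈ S) :
    passages (w.map f) (Sym2.map f e) = passages w e := by
  rw [passages, passages, steps_map, List.count, List.countP_map, List.count]
  refine List.countP_congr fun e' he' => ?_
  simp only [Function.comp_apply, beq_iff_eq]
  exact ⟨sym2_map_injOn hf (fun x hx => hw x (mem_of_mem_steps he' hx)) he, fun h => by rw [h]⟩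

lemma repEdge_map {f : ℕ+ → ℕ+} {S : Set ℕ+} (hf : Set.InjOn f S) {e : Sym2 ℕ+}
    (he : ∀ x ∈ e, x ∈ S) : repEdge (Sym2.map f e) = repEdge e := by
  have : (Sym2.map f e).IsDiag ↔ e.IsDiag := by
    induction e with
    | h a b =>
      simp only [Sym2.map_mk, Sym2.mk_isDiag_iff]
      exact ⟨fun h => hf (he a (by simp)) (he b (by simp)) h, fun h => by rw [h]⟩
  simp [repEdge, this]

namespace IsWignerEnsemble

/-- The moment factorizes over the edges. An injective relabelling keeps the passage counts and the
distinction between loops and other edges, which determines the laws. -/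
lemma integral_T_mul_T_map (h : IsWignerEnsemble ξ P) {f : ℕ+ → ℕ+} {S : Set ℕ+}
    (hf : Set.InjOn f S) {u v : Word} (hu : ∀ x ∈ u, x ∈ S) (hv : ∀ x ∈ v, x ∈ S) :
    ∫ ω, T ξ (u.map f) ω * T ξ (v.map f) ω ∂P = ∫ ω, T ξ u ω * T ξ v ω ∂P := by
  have hS : ∀ e ∈ edgeSet u ∪ edgeSet v, ∀ x ∈ e, x ∈ S := by
    intro e he x hx
    rcases Finset.mem_union.1 he with he | he
    · exact hu x (mem_supp.1 (mem_supp_of_mem_edgeSet he hx))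
    · exact hv x (mem_supp.1 (mem_supp_of_mem_edgeSet he hx))
  rw [h.integral_T_mul_T, h.integral_T_mul_T, edgeSet_map, edgeSet_map, ← Finset.image_union,
    Finset.prod_image fun e he e' he' => sym2_map_injOn hf (hS e he) (hS e' he')]
  refine Finset.prod_congr rfl fun e he => ?_
  rw [passages_map hf hu (hS e he), passages_map hf hv (hS e he),
    h.integral_comp (Sym2.map f e) (φ := fun x => x ^ _) (by fun_prop), repEdge_map hf (hS e he),
    ← h.integral_comp e (φ := fun x => x ^ _) (by fun_prop)]

lemma integral_T_map (h : IsWignerEnsemble ξ P) {f : ℕ+ → ℕ+} {S : Set ℕ+}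
    (hf : Set.InjOn f S) {u : Word} (hu : ∀ x ∈ u, x ∈ S) :
    ∫ ω, T ξ (u.map f) ω ∂P = ∫ ω, T ξ u ω ∂P := by
  have := h.integral_T_mul_T_map hf hu (v := []) (by simp)
  simpa [T, edgeSet] using this

variable [IsProbabilityMeasure P] in
/-- The covariance of two words only depends on the equivalence class of the pair. -/
lemma integral_TBar_mul_TBar_of_pairEquiv (h : IsWignerEnsemble ξ P) {a b : Word × Word}
    (hab : PairEquiv a b) :
    ∫ ω, TBar ξ P b.1 ω * TBar ξ P b.2 ω ∂P = ∫ ω, TBar ξ P a.1 ω * TBar ξ P a.2 ω ∂P := by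
  obtain ⟨f, hf, h1, h2⟩ := hab
  have hu : ∀ x ∈ a.1, x ∈ (pairSupp a : Set ℕ+) := fun x hx => by simp [pairSupp, mem_supp, hx]
  have hv : ∀ x ∈ a.2, x ∈ (pairSupp a : Set ℕ+) := fun x hx => by simp [pairSupp, mem_supp, hx]
  rw [h.integral_TBar_mul_TBar, h.integral_TBar_mul_TBar, h1, h2,
    h.integral_T_mul_T_map hf.injOn hu hv, h.integral_T_map hf.injOn hu, h.integral_T_map hf.injOn hv]

end IsWignerEnsemble

end Entries

/-! ### Words with bounded letters -/

/-- The letters `1, …, N`. -/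
def letters (N : ℕ) : Finset ℕ+ := (Finset.range N).map ⟨Nat.succPNat, Nat.succPNat_injective⟩

lemma mem_letters {N : ℕ} {s : ℕ+} : s ∈ letters N ↔ (s : ℕ) ≤ N := by
  simp only [letters, Finset.mem_map, Finset.mem_range, Function.Embedding.coeFn_mk]
  constructor
  · rintro ⟨a, ha, rfl⟩
    simpa using ha
  · intro h
    exact ⟨s.natPred, by have := s.natPred_add_one; omega, PNat.succPNat_natPred s⟩

@[simp] lemma card_letters (N : ℕ) : (letters N).card = N := by simp [letters]

/-- The words of length `n` with letters at most `N`. -/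
noncomputable def boundedWords (N n : ℕ) : Finset Word := (finite_bounded n N).toFinset

lemma mem_boundedWords {N n : ℕ} {w : Word} :
    w ∈ boundedWords N n ↔ w.length = n ∧ IsBoundedWord N w := by
  simp [boundedWords]

open Classical in
/-- The closed words with `k` steps, starting at `1`, with letters at most `N`. -/
noncomputable def closedWords (N k : ℕ) : Finset Word :=
  {w ∈ boundedWords N (k + 1) | IsClosedFromOne w}

lemma mem_closedWords {N k : ℕ} {w : Word} :
    w ∈ closedWords N k ↔ IsClosedFromOne w ∧ w.length = k + 1 ∧ IsBoundedWord N w := by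
  classical
  simp only [closedWords, Finset.mem_filter, mem_boundedWords]
  exact and_comm

open Classical in
/-- The words with `k` steps from `a` to `1` with letters at most `N`. -/
noncomputable def pathWords (N k : ℕ) (a : ℕ+) : Finset Word :=
  {w ∈ boundedWords N (k + 1) | w.head? = some a ∧ w.getLast? = some 1}

lemma mem_pathWords {N k : ℕ} {a : ℕ+} {w : Word} : w ∈ pathWords N k a ↔
    (w.length = k + 1 ∧ IsBoundedWord N w) ∧ w.head? = some a ∧ w.getLast? = some 1 := by
  classical
  simp only [pathWords, Finset.mem_filter, mem_boundedWords]

lemma pathWords_one (N k : ℕ) : pathWords N k 1 = closedWords N k := by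
  ext w
  rw [mem_pathWords, mem_closedWords, IsClosedFromOne, and_comm]

lemma sum_pathWords_succ (N k : ℕ) {a : ℕ+} (ha : (a : ℕ) ≤ N) (φ : Word → ℝ) :
    ∑ w ∈ pathWords N (k + 1) a, φ w =
      ∑ j : Fin N, ∑ w ∈ pathWords N k (j : ℕ).succPNat, φ (a :: w) := by
  classical
  rw [Finset.sum_sigma']
  symm
  refine Finset.sum_bij (fun (x : (_ : Fin N) × Word) _ => a :: x.2) ?_ ?_ ?_ fun _ _ => rfl
  · rintro ⟨j, w⟩ hw
    obtain ⟨⟨h1, h2⟩, h3, h4⟩ := mem_pathWords.1 (Finset.mem_sigma.1 hw).2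
    cases w with
    | nil => simp at h1
    | cons b l =>
      refine mem_pathWords.2 ⟨⟨by simpa using h1, ?_⟩, rfl, by simpa using h4⟩
      intro s hs
      rcases List.mem_cons.1 hs with rfl | hs
      · exact ha
      · exact h2 s hs
  · rintro ⟨j, w⟩ hw ⟨j', w'⟩ hw' heq
    obtain ⟨-, h3, -⟩ := mem_pathWords.1 (Finset.mem_sigma.1 hw).2
    obtain ⟨-, h3', -⟩ := mem_pathWords.1 (Finset.mem_sigma.1 hw').2
    obtain rfl : w = w' := by simpa using heq
    dsimp only at h3 h3'
    rw [h3, Option.some_inj] at h3'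
    have := Nat.succPNat_injective h3'
    obtain rfl : j = j' := Fin.ext this
    rfl
  · intro w hw
    obtain ⟨⟨h1, h2⟩, h3, h4⟩ := mem_pathWords.1 hw
    match w, h1, h2, h3, h4 with
    | x :: b :: l, h1, h2, h3, h4 =>
      obtain rfl : x = a := by simpa using h3
      have hb := h2 b (by simp)
      have hb' := b.natPred_add_one
      refine ⟨⟨⟨b.natPred, by omega⟩, b :: l⟩, ?_, rfl⟩
      refine Finset.mem_sigma.2 ⟨Finset.mem_univ _, mem_pathWords.2
        ⟨⟨by simpa using h1, fun s hs => h2 s (List.mem_cons_of_mem _ hs)⟩, ?_, by simpa using h4⟩⟩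
      simp

/-! ### Entries of matrix powers as sums over words -/

section Power

variable {Ω : Type*} (ξ : Sym2 ℕ+ → Ω → ℝ)

/-- Induction on `k` by prepending a letter; this is why the starting index is arbitrary while the
end stays at `1`. -/
lemma wignerMatrix_pow_apply (N : ℕ) [NeZero N] (k : ℕ) (i : Fin N) (ω : Ω) :
    (wignerMatrix ξ N ω ^ k) i 0 =
      (√(N : ℝ))⁻¹ ^ k * ∑ w ∈ pathWords N k (i : ℕ).succPNat, T ξ w ω := by
  induction k generalizing i with
  | zero =>
    simp only [pow_zero, one_mul]
    have hT : ∀ w ∈ pathWords N 0 (i : ℕ).succPNat, T ξ w ω = 1 := by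
      intro w hw
      obtain ⟨⟨h1, -⟩, -⟩ := mem_pathWords.1 hw
      obtain ⟨a, rfl⟩ := List.length_eq_one_iff.1 h1
      simp [T, edgeSet]
    rw [Finset.sum_congr rfl hT]
    by_cases hi : i = 0
    · subst hi
      have : pathWords N 0 (((0 : Fin N) : ℕ).succPNat) = {[1]} := by
        ext w
        rw [mem_pathWords, Finset.mem_singleton]
        constructor
        · rintro ⟨⟨h1, -⟩, -, h2⟩
          obtain ⟨a, rfl⟩ := List.length_eq_one_iff.1 h1
          simpa using h2
        · rintro rfl
          refine ⟨⟨rfl, ?_⟩, rfl, rfl⟩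
          simp [IsBoundedWord, Nat.one_le_iff_ne_zero, NeZero.ne N]
      rw [this]
      simp
    · have : pathWords N 0 (i : ℕ).succPNat = ∅ := by
        rw [Finset.eq_empty_iff_forall_notMem]
        intro w hw
        obtain ⟨⟨h1, -⟩, h2, h3⟩ := mem_pathWords.1 hw
        obtain ⟨a, rfl⟩ := List.length_eq_one_iff.1 h1
        simp only [List.head?_cons, Option.some.injEq, List.getLast?_singleton] at h2 h3
        rw [h2] at h3
        have h4 : (i : ℕ).succPNat = (0 : ℕ).succPNat := h3
        exact hi (Fin.ext (Nat.succPNat_injective h4))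
      rw [this]
      simp [hi]
  | succ k ih =>
    rw [pow_succ', Matrix.mul_apply]
    simp_rw [ih]
    rw [sum_pathWords_succ N k (by simp), Finset.mul_sum]
    refine Finset.sum_congr rfl fun j _ => ?_
    have hcons : ∀ w ∈ pathWords N k (j : ℕ).succPNat, T ξ ((i : ℕ).succPNat :: w) ω =
        ξ s((i : ℕ).succPNat, (j : ℕ).succPNat) ω * T ξ w ω := by
      intro w hw
      obtain ⟨-, h3, -⟩ := mem_pathWords.1 hw
      cases w with
      | nil => simp at h3
      | cons b l =>
        obtain rfl : b = (j : ℕ).succPNat := by simpa using h3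
        simp [T_eq_prod_steps]
    rw [Finset.sum_congr rfl hcons, ← Finset.mul_sum]
    simp only [wignerMatrix, Matrix.of_apply]
    rw [div_eq_mul_inv, pow_succ]
    ring

lemma wignerMatrix_pow_zero_zero (N : ℕ) [NeZero N] (k : ℕ) (ω : Ω) :
    (wignerMatrix ξ N ω ^ k) 0 0 = (√(N : ℝ))⁻¹ ^ k * ∑ w ∈ closedWords N k, T ξ w ω := by
  rw [wignerMatrix_pow_apply, ← pathWords_one]
  rfl

lemma SBar_eq_sum [MeasurableSpace Ω] {P : Measure Ω} [IsProbabilityMeasure P]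
    (h : IsWignerEnsemble ξ P) (N : ℕ) [NeZero N] (k : ℕ) (ω : Ω) :
    SBar ξ P N k ω = √(N : ℝ) * (√(N : ℝ))⁻¹ ^ k * ∑ w ∈ closedWords N k, TBar ξ P w ω := by
  simp_rw [SBar, wignerMatrix_pow_zero_zero]
  rw [integral_const_mul, integral_finsetSum _ fun w _ => (h.hasMoments_T w).integrable, ← mul_sub,
    ← Finset.sum_sub_distrib, mul_assoc]
  rfl

end Power

/-! ### Counting tuples of words by weight -/

lemma exists_range_superset {t N : ℕ} (hN : 1 ≤ N) {S : Finset ℕ+} (hS : S ⊆ letters N)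
    (hcard : S.card ≤ t) : ∃ f : Fin t → ℕ+, (∀ j, f j ∈ letters N) ∧ ∀ x ∈ S, ∃ j, f j = x := by
  classical
  let φ := S.equivFin
  refine ⟨fun j => if h : (j : ℕ) < S.card then φ.symm ⟨j, h⟩ else 1, fun j => ?_, fun x hx => ?_⟩
  · dsimp only
    split_ifs with h
    · exact hS (φ.symm ⟨j, h⟩).2
    · exact mem_letters.2 (by simpa using hN)
  · have hlt := (φ ⟨x, hx⟩).2
    refine ⟨⟨φ ⟨x, hx⟩, hlt.trans_le hcard⟩, ?_⟩
    simp

section Counting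

variable {ι : Type*} [Fintype ι] [DecidableEq ι]

/-- The letter `1` costs nothing. List the at most `t` other letters, in `N ^ t` ways, then fill
every position of the tuple from at most `t + 1` letters. -/
lemma card_tuples_le (κ : ι → ℕ) (t N : ℕ) (hN : 1 ≤ N) :
    (({w ∈ Fintype.piFinset fun i => closedWords N (κ i) | (tupleSupp w).card ≤ t + 1}).card : ℝ) ≤
      ((t + 1) ^ Fintype.card ((i : ι) × Fin (κ i + 1)) : ℕ) * (N : ℝ) ^ t := by
  let J := (i : ι) × Fin (κ i + 1)
  let A : Finset (ι → Word) :=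
    {w ∈ Fintype.piFinset fun i => closedWords N (κ i) | (tupleSupp w).card ≤ t + 1}
  let F : Finset (Fin t → ℕ+) := Fintype.piFinset fun _ => letters N
  let R : (Fin t → ℕ+) → Finset ℕ+ := fun f => insert 1 (Finset.univ.image f)
  have hsub : A ⊆ F.biUnion fun f => {w ∈ A | ∀ i, ∀ x ∈ w i, x ∈ R f} := by
    intro w hw
    obtain ⟨h1, h2⟩ := Finset.mem_filter.1 hw
    have hlet : tupleSupp w ⊆ letters N := by
      intro x hx
      obtain ⟨i, -, hi⟩ := Finset.mem_biUnion.1 hx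
      exact mem_letters.2 ((mem_closedWords.1 (Fintype.mem_piFinset.1 h1 i)).2.2 x (mem_supp.1 hi))
    have hcard : ((tupleSupp w).erase 1).card ≤ t := by
      by_cases h : 1 ∈ tupleSupp w
      · rw [Finset.card_erase_of_mem h]; omega
      -- Only the empty tuple misses the letter `1`.
      · have hι : IsEmpty ι := ⟨fun i => h (supp_subset_tupleSupp w i
          (one_mem_supp (mem_closedWords.1 (Fintype.mem_piFinset.1 h1 i)).1))⟩
        simp [tupleSupp]
    obtain ⟨f, hf, hf2⟩ := exists_range_superset hN ((Finset.erase_subset _ _).trans hlet) hcard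
    refine Finset.mem_biUnion.2 ⟨f, Fintype.mem_piFinset.2 hf, Finset.mem_filter.2 ⟨hw, ?_⟩⟩
    intro i x hx
    by_cases hx1 : x = 1
    · simp [R, hx1]
    · obtain ⟨j, hj⟩ := hf2 x (Finset.mem_erase.2 ⟨hx1,
        supp_subset_tupleSupp w i (mem_supp.2 hx)⟩)
      simp [R, ← hj]
  have hfib : ∀ f ∈ F, ({w ∈ A | ∀ i, ∀ x ∈ w i, x ∈ R f}).card ≤ (t + 1) ^ Fintype.card J := by
    intro f _
    have hR : (R f).card ≤ t + 1 := (Finset.card_insert_le _ _).trans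
      (Nat.add_le_add_right (Finset.card_image_le.trans (by simp)) 1)
    have hlen : ∀ w ∈ A, ∀ i, (w i).length = κ i + 1 := fun w hw i =>
      (mem_closedWords.1 (Fintype.mem_piFinset.1 (Finset.mem_filter.1 hw).1 i)).2.1
    calc ({w ∈ A | ∀ i, ∀ x ∈ w i, x ∈ R f}).card
        ≤ (Fintype.piFinset fun _ : J => R f).card := by
          refine Finset.card_le_card_of_injOn
            (fun w (j : J) => (w j.1).getD j.2 1) (fun w hw => ?_) (fun w hw w' hw' heq => ?_)
          · obtain ⟨h1, h2⟩ := Finset.mem_filter.1 hw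
            refine Fintype.mem_piFinset.2 fun j => h2 j.1 _ ?_
            have := hlen w h1 j.1
            dsimp only
            rw [List.getD_eq_getElem _ _ (by rw [this]; exact j.2.2)]
            exact List.getElem_mem _
          · have h1 := hlen w (Finset.mem_filter.1 hw).1
            have h1' := hlen w' (Finset.mem_filter.1 hw').1
            funext i
            refine List.ext_getElem ((h1 i).trans (h1' i).symm) fun m hm hm' => ?_
            have := congrFun heq ⟨i, ⟨m, by rw [← h1 i]; exact hm⟩⟩
            dsimp only at this
            rwa [List.getD_eq_getElem _ _ hm, List.getD_eq_getElem _ _ hm'] at this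
      _ = (R f).card ^ Fintype.card J := by simp
      _ ≤ _ := Nat.pow_le_pow_left hR _
  have h := (Finset.card_le_card hsub).trans (Finset.card_biUnion_le_card_mul _ _ _ hfib)
  have hF : F.card = N ^ t := by simp [F]
  rw [hF, mul_comm] at h
  exact_mod_cast h

end Counting

/-! ### Counting the members of an equivalence class -/

open Classical in
/-- The pairs of words with letters at most `N` equivalent to `a`, the first word starting at
`1`. -/
noncomputable def classMembers (N : ℕ) (a : Word × Word) : Finset (Word × Word) :=
  {p ∈ boundedWords N a.1.length ×ˢ boundedWords N a.2.length | PairEquiv a p ∧ p.1.head? = some 1}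

lemma PairEquiv.length_eq {a p : Word × Word} (h : PairEquiv a p) :
    p.1.length = a.1.length ∧ p.2.length = a.2.length := by
  obtain ⟨f, -, h1, h2⟩ := h
  simp [h1, h2]

lemma mem_classMembers {N : ℕ} {a p : Word × Word} : p ∈ classMembers N a ↔
    PairEquiv a p ∧ p.1.head? = some 1 ∧ IsBoundedWord N p.1 ∧ IsBoundedWord N p.2 := by
  classical
  simp only [classMembers, Finset.mem_filter, Finset.mem_product, mem_boundedWords]
  constructor
  · rintro ⟨⟨h1, h2⟩, h3, h4⟩
    exact ⟨h3, h4, h1.2, h2.2⟩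
  · rintro ⟨h1, h2, h3, h4⟩
    exact ⟨⟨⟨h1.length_eq.1, h3⟩, h1.length_eq.2, h4⟩, h1, h2⟩

lemma mem_pairSupp {a : Word × Word} {x : ℕ+} : x ∈ pairSupp a ↔ x ∈ a.1 ∨ x ∈ a.2 := by
  simp [pairSupp, mem_supp]

lemma bijOn_pairSupp_map {a : Word × Word} {f : ℕ+ → ℕ+} (hf : Set.InjOn f (pairSupp a)) :
    Set.BijOn f (pairSupp a) (pairSupp (a.1.map f, a.2.map f)) := by
  have : pairSupp (a.1.map f, a.2.map f) = (pairSupp a).image f := by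
    simp [pairSupp, supp_map, Finset.image_union]
  rw [this, Finset.coe_image]
  exact hf.bijOn_image

/-- Members correspond to embeddings of the letters other than `1` into the `n` available ones: the
relabelling has to fix `1`, and it is determined by its effect on the words because every letter of
the support occurs in one of them. -/
lemma card_classMembers (n : ℕ) (a : Word × Word) (ha : a.1.head? = some 1) :
    (classMembers (n + 1) a).card = n.descFactorial (pairWt a - 1) := by
  classical
  let A := (pairSupp a).erase 1
  let B := (letters (n + 1)).erase 1
  have h1a : 1 ∈ pairSupp a := mem_pairSupp.2 (Or.inl (List.mem_of_mem_head? ha))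
  have h1n : 1 ∈ letters (n + 1) := mem_letters.2 (by simp)
  have hA : Fintype.card A = pairWt a - 1 := by
    rw [Fintype.card_coe, Finset.card_erase_of_mem h1a, pairWt]
  have hB : Fintype.card B = n := by
    rw [Fintype.card_coe, Finset.card_erase_of_mem h1n, card_letters, Nat.add_sub_cancel]
  let ext : (A ↪ B) → ℕ+ → ℕ+ := fun g x => if h : x ∈ A then (g ⟨x, h⟩ : ℕ+) else 1
  have hext1 : ∀ g, ext g 1 = 1 := fun g => by simp [ext, A]
  have hextA : ∀ g x (h : x ∈ A), ext g x = g ⟨x, h⟩ := fun g x h => by simp [ext, h]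
  have hne1 : ∀ g x (h : x ∈ A), ext g x ≠ 1 := fun g x h => by
    rw [hextA g x h]
    exact (Finset.mem_erase.1 (g ⟨x, h⟩).2).1
  have hcases : ∀ x ∈ pairSupp a, x = 1 ∨ x ∈ A := fun x hx => by
    by_cases h : x = 1
    · exact Or.inl h
    · exact Or.inr (Finset.mem_erase.2 ⟨h, hx⟩)
  have hinj : ∀ g, Set.InjOn (ext g) (pairSupp a) := by
    intro g x hx y hy hxy
    rcases hcases x hx with rfl | hx' <;> rcases hcases y hy with rfl | hy'
    · rfl
    · rw [hext1] at hxy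
      exact absurd hxy.symm (hne1 g y hy')
    · rw [hext1] at hxy
      exact absurd hxy (hne1 g x hx')
    · rw [hextA g x hx', hextA g y hy'] at hxy
      simpa using g.injective (Subtype.ext hxy)
  have hbd : ∀ g x, ext g x ≤ (n + 1 : ℕ) := by
    intro g x
    simp only [ext]
    split_ifs with h
    · exact mem_letters.1 (Finset.mem_erase.1 (g ⟨x, h⟩).2).2
    · simp
  have himage : (Finset.univ : Finset (A ↪ B)).image (fun g => (a.1.map (ext g), a.2.map (ext g))) =
      classMembers (n + 1) a := by
    ext p
    rw [mem_classMembers, Finset.mem_image]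
    constructor
    · rintro ⟨g, -, rfl⟩
      refine ⟨⟨ext g, bijOn_pairSupp_map (hinj g), rfl, rfl⟩, by simp [ha, hext1], ?_, ?_⟩ <;>
      · intro s hs
        obtain ⟨x, -, rfl⟩ := List.mem_map.1 hs
        exact hbd g x
    · rintro ⟨⟨f, hf, h1, h2⟩, h3, h4, h5⟩
      have hf1 : f 1 = 1 := by simpa [h1, ha] using h3
      have hfB : ∀ x : A, f x ∈ B := by
        rintro ⟨x, hx⟩
        obtain ⟨hx1, hxs⟩ := Finset.mem_erase.1 hx
        refine Finset.mem_erase.2 ⟨fun h => hx1 (hf.injOn hxs h1a (h.trans hf1.symm)),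
          mem_letters.2 ?_⟩
        rcases mem_pairSupp.1 (hf.mapsTo hxs) with h | h
        · exact h4 _ h
        · exact h5 _ h
      let g : A ↪ B := ⟨fun x => ⟨f x, hfB x⟩, fun x y hxy => Subtype.ext
        (hf.injOn (Finset.mem_erase.1 x.2).2 (Finset.mem_erase.1 y.2).2 (by simpa using hxy))⟩
      have hfg : ∀ x ∈ pairSupp a, ext g x = f x := by
        intro x hx
        rcases hcases x hx with rfl | hx'
        · rw [hext1, hf1]
        · rw [hextA g x hx']
          rfl
      refine ⟨g, Finset.mem_univ _, Prod.ext ?_ ?_⟩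
      · rw [h1]
        exact List.map_congr_left fun x hx => hfg x (mem_pairSupp.2 (Or.inl hx))
      · rw [h2]
        exact List.map_congr_left fun x hx => hfg x (mem_pairSupp.2 (Or.inr hx))
  rw [← himage, Finset.card_image_of_injective, Finset.card_univ, Fintype.card_embedding_eq, hA, hB]
  intro g g' hgg
  obtain ⟨h1, h2⟩ := Prod.ext_iff.1 hgg
  refine DFunLike.ext _ _ fun x => Subtype.ext ?_
  have hx := (Finset.mem_erase.1 x.2).2
  have : ext g x = ext g' x := by
    rcases mem_pairSupp.1 hx with h | h
    · exact List.map_inj_left.1 h1 x h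
    · exact List.map_inj_left.1 h2 x h
  rw [hextA g x x.2, hextA g' x x.2] at this
  exact this

/-- Sum of an invariant function over a set of pairs, in terms of representatives of the classes
which the set meets. -/
lemma sum_eq_sum_quotient {α : Type*} (κ : α → Word × Word)
    [Fintype (Quotient (Setoid.comap κ ⟨PairEquiv, pairEquiv_equivalence⟩))]
    (B : Finset (Word × Word)) (g : Word × Word → ℝ) (hg : ∀ a b, PairEquiv a b → g b = g a)
    (hB : ∀ p ∈ B, ∃ x, PairEquiv (κ x) p) (c : ℕ)
    (hc : ∀ x, ∃ M : Finset (Word × Word), (∀ p, p ∈ M ↔ p ∈ B ∧ PairEquiv (κ x) p) ∧ M.card = c) :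
    ∑ p ∈ B, g p =
      c * ∑ q : Quotient (Setoid.comap κ ⟨PairEquiv, pairEquiv_equivalence⟩), g (κ q.out) := by
  classical
  rcases isEmpty_or_nonempty α with hα | hα
  · have hB0 : B = ∅ := Finset.eq_empty_iff_forall_notMem.2 fun p hp => hα.elim (hB p hp).choose
    have : IsEmpty (Quotient (Setoid.comap κ ⟨PairEquiv, pairEquiv_equivalence⟩)) :=
      ⟨fun q => hα.elim q.out⟩
    simp [hB0]
  choose! x hx using hB
  let s : Setoid α := Setoid.comap κ ⟨PairEquiv, pairEquiv_equivalence⟩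
  have hcl : ∀ p ∈ B, ∀ q : Quotient s, (⟦x p⟧ : Quotient s) = q ↔ PairEquiv (κ q.out) p := by
    intro p hp q
    constructor
    · rintro rfl
      exact pairEquiv_equivalence.trans (Quotient.mk_out (s := s) (x p)) (hx p hp)
    · intro h
      rw [← Quotient.out_eq q]
      exact Quotient.sound (s := s) (pairEquiv_equivalence.trans (hx p hp) (pairEquiv_equivalence.symm h))
  rw [← Finset.sum_fiberwise B (fun p => (⟦x p⟧ : Quotient s)) g, Finset.mul_sum]
  refine Finset.sum_congr rfl fun q _ => ?_
  obtain ⟨M, hM, hMc⟩ := hc q.out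
  have hfib : {p ∈ B | (⟦x p⟧ : Quotient s) = q} = M := by
    ext p
    rw [Finset.mem_filter, hM]
    exact and_congr_right fun hp => hcl p hp q
  rw [hfib, Finset.sum_congr rfl (fun p hp => hg _ p ((hM p).1 hp).2), Finset.sum_const, hMc,
    nsmul_eq_mul]

lemma tendsto_descFactorial_div_pow (t : ℕ) :
    Tendsto (fun n : ℕ => (n.descFactorial t : ℝ) / ((n + 1 : ℕ) : ℝ) ^ t) atTop (nhds 1) := by
  induction t with
  | zero => simp
  | succ t ih =>
    have h1 : Tendsto (fun n : ℕ => ((n - t : ℕ) : ℝ) / ((n + 1 : ℕ) : ℝ)) atTop (nhds 1) := by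
      have h2 : Tendsto (fun n : ℕ => 1 - ((t : ℝ) + 1) / ((n : ℝ) + 1)) atTop (nhds (1 - 0)) :=
        tendsto_const_nhds.sub (tendsto_const_nhds.div_atTop
          (tendsto_atTop_add_const_right _ _ tendsto_natCast_atTop_atTop))
      rw [sub_zero] at h2
      refine h2.congr' ?_
      filter_upwards [eventually_ge_atTop t] with n hn
      rw [Nat.cast_sub hn]
      push_cast
      field_simp
      ring
    have h3 := h1.mul ih
    rw [one_mul] at h3
    refine h3.congr fun n => ?_
    rw [Nat.descFactorial_succ]
    push_cast
    rw [pow_succ']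
    field_simp

/-! ### Negligible sums -/

/-- The normalization of the sum over the words with `k` steps. -/
noncomputable def scale (N k : ℕ) : ℝ := √(N : ℝ) * (√(N : ℝ))⁻¹ ^ k

lemma scale_nonneg (N k : ℕ) : 0 ≤ scale N k := by
  unfold scale
  positivity

section Negligible

variable {ι : Type*} [Fintype ι]

lemma prod_scale (N : ℕ) (κ : ι → ℕ) :
    ∏ i, scale N (κ i) = √(N : ℝ) ^ Fintype.card ι * (√(N : ℝ))⁻¹ ^ ∑ i, κ i := by
  simp [scale, Finset.prod_mul_distrib, Finset.prod_pow_eq_pow_sum]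

lemma one_le_card_tupleSupp [Nonempty ι] {w : ι → Word} (hw : ∀ i, IsClosedFromOne (w i)) :
    1 ≤ (tupleSupp w).card :=
  Finset.card_pos.2
    ⟨1, supp_subset_tupleSupp w (Classical.arbitrary ι) (one_mem_supp (hw _))⟩

lemma tendsto_inv_sqrt_succ :
    Tendsto (fun n : ℕ => (√((n + 1 : ℕ) : ℝ))⁻¹) atTop (nhds 0) := by
  refine tendsto_inv_atTop_zero.comp (Real.tendsto_sqrt_atTop.comp ?_)
  exact tendsto_natCast_atTop_atTop.comp (tendsto_add_atTop_nat 1)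

variable [DecidableEq ι]

/-- A sum over tuples of words of non-maximal weight is negligible. -/
lemma tendsto_sum_tuples_zero [Nonempty ι] (κ : ι → ℕ) (M : ℝ) (G : (ι → Word) → ℝ)
    (hG : ∀ w, (∀ i, IsClosedFromOne (w i) ∧ (w i).length = κ i + 1) → |G w| ≤ M)
    (hwt : ∀ w, (∀ i, IsClosedFromOne (w i) ∧ (w i).length = κ i + 1) → G w ≠ 0 →
      2 * (tupleSupp w).card + Fintype.card ι ≤ ∑ i, κ i + 1) :
    Tendsto (fun n : ℕ => (∏ i, scale (n + 1) (κ i)) *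
      ∑ w ∈ Fintype.piFinset fun i => closedWords (n + 1) (κ i), G w) atTop (nhds 0) := by
  classical
  have hmem : ∀ N, ∀ w ∈ Fintype.piFinset fun i => closedWords N (κ i),
      ∀ i, IsClosedFromOne (w i) ∧ (w i).length = κ i + 1 := fun N w hw i => by
    have := mem_closedWords.1 (Fintype.mem_piFinset.1 hw i)
    exact ⟨this.1, this.2.1⟩
  -- In the opposite case even the single letter `1` violates the bound of `hwt`, so every term
  -- vanishes.
  by_cases hsmall : Fintype.card ι + 2 ≤ ∑ i, κ i + 1
  swap
  · refine tendsto_const_nhds.congr fun n => ?_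
    rw [Finset.sum_eq_zero, mul_zero]
    intro w hw
    by_contra hne
    have h1 := hwt w (hmem _ w hw) hne
    have h2 := one_le_card_tupleSupp fun i => (hmem _ w hw i).1
    omega
  -- Here `t + 1` is the largest weight compatible with `hwt`. There are `O(N ^ t)` such tuples, and
  -- `ht1` says that the normalization beats this by a factor `√N`.
  obtain ⟨t, ht1, ht2⟩ : ∃ t, 2 * t + Fintype.card ι + 1 ≤ ∑ i, κ i ∧
      ∑ i, κ i + 1 < 2 * (t + 2) + Fintype.card ι :=
    ⟨(∑ i, κ i + 1 - Fintype.card ι) / 2 - 1, by omega, by omega⟩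
  set L : ℕ := (t + 1) ^ Fintype.card ((i : ι) × Fin (κ i + 1))
  have hbound : ∀ n : ℕ, |(∏ i, scale (n + 1) (κ i)) *
      ∑ w ∈ Fintype.piFinset fun i => closedWords (n + 1) (κ i), G w| ≤
        |M| * L * (√((n + 1 : ℕ) : ℝ))⁻¹ := by
    intro n
    have hs1 : 1 ≤ √((n + 1 : ℕ) : ℝ) := by
      rw [Real.one_le_sqrt]
      push_cast
      linarith [n.cast_nonneg (α := ℝ)]
    set s := √((n + 1 : ℕ) : ℝ) with hs
    have hsq : ((n + 1 : ℕ) : ℝ) = s ^ 2 := (Real.sq_sqrt (Nat.cast_nonneg _)).symm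
    have hsum : |∑ w ∈ Fintype.piFinset fun i => closedWords (n + 1) (κ i), G w| ≤
        |M| * (L * (s ^ 2) ^ t) := by
      have h1 : ∑ w ∈ Fintype.piFinset fun i => closedWords (n + 1) (κ i), G w =
          ∑ w ∈ Fintype.piFinset (fun i => closedWords (n + 1) (κ i)) with
            (tupleSupp w).card ≤ t + 1, G w := by
        symm
        refine Finset.sum_subset (Finset.filter_subset _ _) fun w hw hnot => ?_
        by_contra hne
        have := hwt w (hmem _ w hw) hne
        rw [Finset.mem_filter, not_and] at hnot
        have := hnot hw
        omega
      rw [h1]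
      calc |∑ w ∈ Fintype.piFinset (fun i => closedWords (n + 1) (κ i)) with
            (tupleSupp w).card ≤ t + 1, G w|
          ≤ ∑ w ∈ Fintype.piFinset (fun i => closedWords (n + 1) (κ i)) with
            (tupleSupp w).card ≤ t + 1, |G w| := Finset.abs_sum_le_sum_abs _ _
        _ ≤ _ := Finset.sum_le_card_nsmul _ _ |M| fun w hw =>
            (hG w (hmem _ w (Finset.mem_filter.1 hw).1)).trans (le_abs_self M)
        _ ≤ _ := by
            rw [nsmul_eq_mul, mul_comm, ← hsq]
            gcongr
            exact card_tuples_le κ t (n + 1) (by omega)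
    rw [abs_mul, abs_of_nonneg (Finset.prod_nonneg fun i _ => scale_nonneg _ _), prod_scale, ← hs]
    have hs0 : 0 < s := by linarith
    calc s ^ Fintype.card ι * s⁻¹ ^ (∑ i, κ i) *
          |∑ w ∈ Fintype.piFinset fun i => closedWords (n + 1) (κ i), G w|
        ≤ s ^ Fintype.card ι * s⁻¹ ^ (2 * t + Fintype.card ι + 1) * (|M| * (L * (s ^ 2) ^ t)) := by
          gcongr ?_ * ?_ * ?_
          exact pow_le_pow_of_le_one (by positivity) (inv_le_one_of_one_le₀ hs1) ht1
      _ = |M| * L * s⁻¹ := by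
          rw [pow_succ, pow_add, ← pow_mul]
          simp only [inv_pow]
          field_simp
  refine squeeze_zero_norm hbound ?_
  simpa using tendsto_inv_sqrt_succ.const_mul (|M| * L)

end Negligible

lemma sum_product_eq_sum_piFinset (A : Fin 2 → Finset Word) (g : Word × Word → ℝ) :
    ∑ p ∈ A 0 ×ˢ A 1, g p = ∑ w ∈ Fintype.piFinset A, g (w 0, w 1) := by
  symm
  refine Finset.sum_equiv (finTwoArrowEquiv Word) (fun w => ?_) fun w _ => rfl
  rw [Fintype.mem_piFinset, Fin.forall_fin_two, Finset.mem_product]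
  rfl

/-! ### Invariance under equivalence of pairs -/

lemma tupleSupp_pair (w : Fin 2 → Word) : tupleSupp w = pairSupp (w 0, w 1) := by
  ext x; simp [tupleSupp, pairSupp, Fin.exists_fin_two]

lemma PairEquiv.pairWt_eq {a b : Word × Word} (h : PairEquiv a b) : pairWt b = pairWt a := by
  obtain ⟨f, hf, -, -⟩ := h
  have : pairSupp b = (pairSupp a).image f := by
    rw [← Finset.coe_inj, Finset.coe_image, hf.image_eq]
  rw [pairWt, pairWt, this, Finset.card_image_of_injOn hf.injOn]

lemma IsClosedFromOne.map {w : Word} (hw : IsClosedFromOne w) {f : ℕ+ → ℕ+} (hf : f 1 = 1) :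
    IsClosedFromOne (w.map f) := by
  simp [IsClosedFromOne, hw.1, hw.2, hf]

lemma NoSelfEdge.map {w : Word} (hw : NoSelfEdge w) {f : ℕ+ → ℕ+} {S : Set ℕ+}
    (hf : Set.InjOn f S) (hS : ∀ x ∈ w, x ∈ S) : NoSelfEdge (w.map f) := by
  intro e he
  rw [edgeSet_map, Finset.mem_image] at he
  obtain ⟨e', he', rfl⟩ := he
  have h1 := hw e' he'
  have h2 : ∀ x ∈ e', x ∈ S := fun x hx => hS x (mem_supp.1 (mem_supp_of_mem_edgeSet he' hx))
  induction e' with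
  | h a b =>
    simp only [Sym2.map_mk, Sym2.mk_isDiag_iff] at h1 ⊢
    exact fun h => h1 (hf (h2 a (by simp)) (h2 b (by simp)) h)

lemma IsCLTPair.of_pairEquiv {a b : Word × Word} (ha : IsCLTPair a) (h : PairEquiv a b) :
    IsCLTPair b := by
  have hwt := h.pairWt_eq
  have hlen := h.length_eq
  obtain ⟨f, hf, h1, h2⟩ := h
  have hu : ∀ x ∈ a.1, x ∈ (pairSupp a : Set ℕ+) := fun x hx => mem_pairSupp.2 (Or.inl hx)
  have hv : ∀ x ∈ a.2, x ∈ (pairSupp a : Set ℕ+) := fun x hx => mem_pairSupp.2 (Or.inr hx)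
  have hS : ∀ e ∈ edgeSet a.1 ∪ edgeSet a.2, ∀ x ∈ e, x ∈ (pairSupp a : Set ℕ+) := by
    intro e he x hx
    rcases Finset.mem_union.1 he with he | he
    · exact hu x (mem_supp.1 (mem_supp_of_mem_edgeSet he hx))
    · exact hv x (mem_supp.1 (mem_supp_of_mem_edgeSet he hx))
  refine ⟨⟨fun e he => ?_, ?_⟩, by rw [hwt, hlen.1, hlen.2]; exact ha.2⟩
  · rw [h1, h2, edgeSet_map, edgeSet_map, ← Finset.image_union, Finset.mem_image] at he
    obtain ⟨e', he', rfl⟩ := he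
    rw [h1, h2, passages_map hf.injOn hu (hS e' he'), passages_map hf.injOn hv (hS e' he')]
    exact ha.1.1 e' he'
  · obtain ⟨e, he⟩ := ha.1.2
    rw [Finset.mem_inter] at he
    refine ⟨Sym2.map f e, Finset.mem_inter.2 ⟨?_, ?_⟩⟩
    · rw [h1, edgeSet_map]; exact Finset.mem_image_of_mem _ he.1
    · rw [h2, edgeSet_map]; exact Finset.mem_image_of_mem _ he.2

/-- The count of `classMembers` is here the factorial of `pairWt p - 1`, hence positive. -/
lemma exists_normalized {p : Word × Word} (hp : p.1.head? = some 1) :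
    ∃ b, b ∈ classMembers (pairWt p) p := by
  have h1 : 1 ≤ pairWt p := Finset.card_pos.2 ⟨1, mem_pairSupp.2 (Or.inl (List.mem_of_mem_head? hp))⟩
  have h2 := card_classMembers (pairWt p - 1) p hp
  rw [Nat.sub_add_cancel h1, Nat.descFactorial_self] at h2
  have h3 := Finset.card_pos.1 (h2 ▸ Nat.factorial_pos _)
  exact h3

lemma PairEquiv.exists_map {a b : Word × Word} (h : PairEquiv a b) (ha : a.1.head? = some 1)
    (hb : b.1.head? = some 1) :
    ∃ f : ℕ+ → ℕ+, f 1 = 1 ∧ Set.InjOn f (pairSupp a) ∧ b.1 = a.1.map f ∧ b.2 = a.2.map f := by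
  obtain ⟨f, hf, h1, h2⟩ := h
  exact ⟨f, by simpa [h1, ha] using hb, hf.injOn, h1, h2⟩

/-! ### The limit of the covariances -/

open Classical in
/-- The closed words with `k` steps and without self-edges, with letters at most `N`. -/
noncomputable def freeWords (N k : ℕ) : Finset Word := {w ∈ closedWords N k | NoSelfEdge w}

lemma mem_freeWords {N k : ℕ} {w : Word} :
    w ∈ freeWords N k ↔
      IsClosedFromOne w ∧ NoSelfEdge w ∧ w.length = k + 1 ∧ IsBoundedWord N w := by
  classical
  simp only [freeWords, Finset.mem_filter, mem_closedWords]
  tauto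

open Classical in
/-- The CLT pairs of closed words without self-edges, with letters at most `N`. -/
noncomputable def cltPairsUpTo (N k l : ℕ) : Finset (Word × Word) :=
  {p ∈ freeWords N k ×ˢ freeWords N l | IsCLTPair p}

lemma mem_cltPairsUpTo {N k l : ℕ} {p : Word × Word} :
    p ∈ cltPairsUpTo N k l ↔ (p.1 ∈ freeWords N k ∧ p.2 ∈ freeWords N l) ∧ IsCLTPair p := by
  classical
  simp only [cltPairsUpTo, Finset.mem_filter, Finset.mem_product]

lemma mem_cltPairsUpTo_of_pairEquiv {N N' k l : ℕ} {a b : Word × Word}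
    (ha : a ∈ cltPairsUpTo N k l) (h : PairEquiv a b) (hb : b.1.head? = some 1)
    (h1 : IsBoundedWord N' b.1) (h2 : IsBoundedWord N' b.2) : b ∈ cltPairsUpTo N' k l := by
  rw [mem_cltPairsUpTo, mem_freeWords, mem_freeWords] at ha ⊢
  obtain ⟨⟨⟨h3, h4, h5, -⟩, h6, h7, h8, -⟩, h9⟩ := ha
  have hclt := h9.of_pairEquiv h
  have hlen := h.length_eq
  obtain ⟨f, hf1, hf, h10, h11⟩ := h.exists_map h3.1 hb
  refine ⟨⟨⟨?_, ?_, hlen.1.trans h5, h1⟩, ?_, ?_, hlen.2.trans h8, h2⟩, hclt⟩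
  · rw [h10]; exact h3.map hf1
  · rw [h10]; exact h4.map hf fun x hx => mem_pairSupp.2 (Or.inl hx)
  · rw [h11]; exact h6.map hf1
  · rw [h11]; exact h7.map hf fun x hx => mem_pairSupp.2 (Or.inr hx)

lemma two_mul_pairWt_of_mem {N k l : ℕ} {p : Word × Word} (hp : p ∈ cltPairsUpTo N k l) :
    2 * pairWt p = k + l := by
  rw [mem_cltPairsUpTo, mem_freeWords, mem_freeWords] at hp
  have h1 := hp.2.2
  have h2 := hp.1.1.2.2.1
  have h3 := hp.1.2.2.2.1
  omega

lemma CLTPairs.mem {k l : ℕ} (x : CLTPairs k l) : x.1 ∈ cltPairsUpTo ((k + l) / 2) k l := by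
  rw [mem_cltPairsUpTo, mem_freeWords, mem_freeWords]
  obtain ⟨h1, h2, h3⟩ := x.2
  exact ⟨⟨h1, h2⟩, h3⟩

section Covariance

variable {Ω : Type*} [MeasurableSpace Ω] {P : Measure Ω} [IsProbabilityMeasure P]
  {ξ : Sym2 ℕ+ → Ω → ℝ}

/-- The summand depends only on the class. All CLT pairs have weight `(k + l) / 2`, so all classes
have the same number of members; one letter is fixed to be `1`, whence the `- 1`. -/
lemma sum_cltPairsUpTo (h : IsWignerEnsemble ξ P) (n k l : ℕ) :
    ∑ p ∈ cltPairsUpTo (n + 1) k l, ∫ ω, TBar ξ P p.1 ω * TBar ξ P p.2 ω ∂P =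
      n.descFactorial ((k + l) / 2 - 1) * covA ξ P k l := by
  refine @sum_eq_sum_quotient (CLTPairs k l) (fun a => a.1)
    (instFintypeQuotientCLTPairsCltSetoid k l) (cltPairsUpTo (n + 1) k l)
    (fun p => ∫ ω, TBar ξ P p.1 ω * TBar ξ P p.2 ω ∂P)
    (fun a b hab => h.integral_TBar_mul_TBar_of_pairEquiv hab) (fun p hp => ?_) _ fun x => ?_
  · have hhead := (mem_freeWords.1 (mem_cltPairsUpTo.1 hp).1.1).1.1
    obtain ⟨b, hb⟩ := exists_normalized hhead
    obtain ⟨h1, h2, h3, h4⟩ := mem_classMembers.1 hb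
    have hwt := two_mul_pairWt_of_mem hp
    have := mem_cltPairsUpTo.1 (mem_cltPairsUpTo_of_pairEquiv hp h1 h2 h3 h4)
    rw [mem_freeWords, mem_freeWords] at this
    refine ⟨⟨b, ?_⟩, pairEquiv_equivalence.symm h1⟩
    have hN : pairWt p = (k + l) / 2 := by omega
    rw [hN] at this
    exact ⟨this.1.1, this.1.2, this.2⟩
  · have hx := x.mem
    have hhead := (mem_freeWords.1 (mem_cltPairsUpTo.1 hx).1.1).1.1
    have hwt := two_mul_pairWt_of_mem hx
    refine ⟨classMembers (n + 1) x.1, fun p => ?_, ?_⟩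
    · rw [mem_classMembers]
      constructor
      · rintro ⟨h1, h2, h3, h4⟩
        exact ⟨mem_cltPairsUpTo_of_pairEquiv hx h1 h2 h3 h4, h1⟩
      · rintro ⟨h1, h2⟩
        rw [mem_cltPairsUpTo, mem_freeWords, mem_freeWords] at h1
        exact ⟨h2, h1.1.1.1.1, h1.1.1.2.2.2, h1.1.2.2.2.2⟩
    · rw [card_classMembers n x.1 hhead]
      congr 1
      omega

/-- The normalization `N ^ (1 - (k + l) / 2)` exactly balances the growth of the size of a class. -/
lemma tendsto_scale_mul_sum_cltPairs (h : IsWignerEnsemble ξ P) (k l : ℕ) :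
    Tendsto (fun n : ℕ => scale (n + 1) k * scale (n + 1) l *
      ∑ p ∈ cltPairsUpTo (n + 1) k l, ∫ ω, TBar ξ P p.1 ω * TBar ξ P p.2 ω ∂P) atTop
      (nhds (covA ξ P k l)) := by
  simp_rw [sum_cltPairsUpTo h]
  rcases isEmpty_or_nonempty (CLTPairs k l) with he | ⟨⟨x⟩⟩
  · have : IsEmpty (Quotient (cltSetoid k l)) := ⟨fun q => he.elim q.out⟩
    simp [covA]
  · have hwt := two_mul_pairWt_of_mem x.mem
    have hhead := (mem_freeWords.1 (mem_cltPairsUpTo.1 x.mem).1.1).1.1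
    have hpos : 1 ≤ pairWt x.1 :=
      Finset.card_pos.2 ⟨1, mem_pairSupp.2 (Or.inl (List.mem_of_mem_head? hhead))⟩
    obtain ⟨t, ht⟩ : ∃ t, (k + l) / 2 = t + 1 := ⟨pairWt x.1 - 1, by omega⟩
    have hkl : k + l = 2 * t + 2 := by omega
    have h1 := (tendsto_descFactorial_div_pow t).mul_const (covA ξ P k l)
    rw [one_mul] at h1
    refine h1.congr fun n => ?_
    rw [ht, Nat.add_sub_cancel]
    have hs0 : 0 < √((n + 1 : ℕ) : ℝ) := by positivity
    have hsq : ((n + 1 : ℕ) : ℝ) = √((n + 1 : ℕ) : ℝ) ^ 2 :=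
      (Real.sq_sqrt (Nat.cast_nonneg _)).symm
    have h2 : scale (n + 1) k * scale (n + 1) l = (((n + 1 : ℕ) : ℝ) ^ t)⁻¹ := by
      have : scale (n + 1) k * scale (n + 1) l =
          √((n + 1 : ℕ) : ℝ) ^ 2 * (√((n + 1 : ℕ) : ℝ))⁻¹ ^ (k + l) := by
        simp only [scale]
        ring
      rw [this, hkl]
      conv_rhs => rw [hsq]
      generalize √((n + 1 : ℕ) : ℝ) = s at hs0
      rw [← pow_mul, pow_add]
      simp only [inv_pow]
      field_simp
    rw [h2]
    ring

lemma isLinked_of_integral_ne_zero (h : IsWignerEnsemble ξ P) {w : Fin 2 → Word}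
    (hw : ∫ ω, TBar ξ P (w 0) ω * TBar ξ P (w 1) ω ∂P ≠ 0) : IsLinked w := by
  by_contra hl
  have := h.integral_prod_TBar_eq_zero w hl
  simp_rw [Fin.prod_univ_two] at this
  exact hw this

lemma exists_abs_integral_TBar_mul_TBar_le (h : IsWignerEnsemble ξ P) (k : ℕ) :
    ∃ M : ℝ, 0 ≤ M ∧ ∀ w : Fin 2 → Word, (∀ i, (w i).length ≤ k) →
      |∫ ω, TBar ξ P (w 0) ω * TBar ξ P (w 1) ω ∂P| ≤ M := by
  simpa only [Fin.prod_univ_two] using h.exists_abs_integral_prod_TBar_le (Fin 2) k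

/-- A linked pair of maximal weight is a CLT pair. -/
lemma IsLinked.isCLTPair {w : Fin 2 → Word} (hl : IsLinked w)
    (hwt : 2 * (tupleSupp w).card + 2 = (w 0).length + (w 1).length) : IsCLTPair (w 0, w 1) := by
  rw [tupleSupp_pair] at hwt
  refine ⟨⟨fun e he => ?_, ?_⟩, hwt⟩
  · have := hl.1 e (by
      simpa [tupleEdges, Fin.exists_fin_two] using he)
    rwa [Fin.sum_univ_two] at this
  · obtain ⟨j, hj, e, h1, h2⟩ := hl.2 0
    obtain rfl : j = 1 := by omega
    exact ⟨e, Finset.mem_inter.2 ⟨mem_edgeSet.2 h1, mem_edgeSet.2 h2⟩⟩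

/-- The part of `SBar` coming from words without self-edges. -/
noncomputable def freePart (ξ : Sym2 ℕ+ → Ω → ℝ) (P : Measure Ω) (N k : ℕ) (ω : Ω) : ℝ :=
  scale N k * ∑ w ∈ freeWords N k, TBar ξ P w ω

lemma hasMoments_freePart (h : IsWignerEnsemble ξ P) (N k : ℕ) :
    HasMoments (freePart ξ P N k) P :=
  (hasMoments_sum _ fun w _ => h.hasMoments_TBar w).const_mul _

/-- The covariances of the parts without self-edges converge to `A(k, l)`. -/
theorem tendsto_integral_freePart_mul_freePart (h : IsWignerEnsemble ξ P) (k l : ℕ) :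
    Tendsto (fun n : ℕ => ∫ ω, freePart ξ P (n + 1) k ω * freePart ξ P (n + 1) l ω ∂P) atTop
      (nhds (covA ξ P k l)) := by
  classical
  let κ : Fin 2 → ℕ := ![k, l]
  let g : Word × Word → ℝ := fun p => ∫ ω, TBar ξ P p.1 ω * TBar ξ P p.2 ω ∂P
  -- The pairs without self-edges that are not CLT pairs: those with nonzero covariance are linked,
  -- so their weight falls short of the maximum.
  let G : Word × Word → ℝ := fun p =>
    if (NoSelfEdge p.1 ∧ NoSelfEdge p.2) ∧ ¬ IsCLTPair p then g p else 0
  obtain ⟨M, hM0, hM⟩ := exists_abs_integral_TBar_mul_TBar_le h (k + l + 1)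
  have hneg := tendsto_sum_tuples_zero κ M (fun w => G (w 0, w 1)) ?_ ?_
  · have hlim := (tendsto_scale_mul_sum_cltPairs h k l).add hneg
    rw [add_zero] at hlim
    refine hlim.congr fun n => ?_
    have hexp : ∫ ω, freePart ξ P (n + 1) k ω * freePart ξ P (n + 1) l ω ∂P =
        scale (n + 1) k * scale (n + 1) l *
          ∑ p ∈ freeWords (n + 1) k ×ˢ freeWords (n + 1) l, g p := by
      have h1 : ∀ ω, freePart ξ P (n + 1) k ω * freePart ξ P (n + 1) l ω =
          scale (n + 1) k * scale (n + 1) l * ∑ p ∈ freeWords (n + 1) k ×ˢ freeWords (n + 1) l,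
            TBar ξ P p.1 ω * TBar ξ P p.2 ω := by
        intro ω
        rw [Finset.sum_product]
        simp only [freePart]
        rw [← Finset.sum_mul_sum]
        ring
      simp_rw [h1]
      rw [integral_const_mul, integral_finsetSum _ fun p _ =>
        ((h.hasMoments_TBar p.1).mul (h.hasMoments_TBar p.2)).integrable]
    have hsum : ∑ w ∈ Fintype.piFinset fun i => closedWords (n + 1) (κ i), G (w 0, w 1) =
        ∑ p ∈ freeWords (n + 1) k ×ˢ freeWords (n + 1) l with ¬ IsCLTPair p, g p := by
      rw [← sum_product_eq_sum_piFinset (fun i => closedWords (n + 1) (κ i)) G,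
        ← Finset.sum_filter]
      refine Finset.sum_congr ?_ fun _ _ => rfl
      ext p
      simp only [Finset.mem_filter, Finset.mem_product, freeWords, κ, Matrix.cons_val_zero,
        Matrix.cons_val_one]
      tauto
    have hκ : ∏ i, scale (n + 1) (κ i) = scale (n + 1) k * scale (n + 1) l := Fin.prod_univ_two _
    rw [hexp, hsum, hκ, ← mul_add]
    congr 1
    exact Finset.sum_filter_add_sum_filter_not _ _ _
  · intro w hw
    simp only [G]
    split_ifs
    · refine hM w fun i => ?_
      rw [(hw i).2]
      fin_cases i <;> simp [κ]
    · simpa using hM0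
  · intro w hw hne
    simp only [G] at hne
    split_ifs at hne with hcond
    · have hl := isLinked_of_integral_ne_zero h hne
      have h1 := hl.two_mul_card_add_card_le fun i => (hw i).1
      have h0 := (hw 0).2
      have h0' := (hw 1).2
      have h2 : 2 * (tupleSupp w).card + 2 ≠ (w 0).length + (w 1).length :=
        fun heq => hcond.2 (hl.isCLTPair heq)
      rw [Fin.sum_univ_two] at h1 ⊢
      rw [Fintype.card_fin] at h1 ⊢
      omega
    · exact absurd rfl hne

end Covariance

/-! ### Counting one-loop words -/

lemma IsOneLoop.map {w : Word} (hw : IsOneLoop w) {f : ℕ+ → ℕ+} (hf1 : f 1 = 1) {S : Set ℕ+}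
    (hf : Set.InjOn f S) (hS : ∀ x ∈ w, x ∈ S) : IsOneLoop (w.map f) := by
  have h1S : (1 : ℕ+) ∈ S := hS 1 (List.mem_of_mem_head? hw.closed.1)
  have hes : ∀ e ∈ edgeSet w, ∀ x ∈ e, x ∈ S := fun e he x hx =>
    hS x (mem_supp.1 (mem_supp_of_mem_edgeSet he hx))
  have h11 : Sym2.map f s(1, 1) = s(1, 1) := by simp [hf1]
  have h11S : ∀ x ∈ s((1 : ℕ+), 1), x ∈ S := by
    intro x hx
    have : x = 1 := by simpa using hx
    rwa [this]
  refine ⟨hw.closed.map hf1, ?_, ?_, ?_⟩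
  · rw [← h11, passages_map hf hS h11S, hw.passages_one]
  · intro e he hne
    rw [edgeSet_map, Finset.mem_image] at he
    obtain ⟨e', he', rfl⟩ := he
    have h2 := hw.passages_two e' he' (by rintro rfl; exact hne h11)
    rw [passages_map hf hS (hes e' he')]
    refine ⟨h2.1, ?_⟩
    have h3 := h2.2
    have h4 := hes e' he'
    clear he' hne h2
    induction e' with
    | h a b =>
      simp only [Sym2.map_mk, Sym2.mk_isDiag_iff] at h3 ⊢
      exact fun h => h3 (hf (h4 a (by simp)) (h4 b (by simp)) h)
  · rw [wt, supp_map, Finset.card_image_of_injOn, List.length_map]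
    · exact hw.weight
    · exact hf.mono fun x hx => hS x (mem_supp.1 hx)

open Classical in
/-- The one-loop words with `k` steps and letters at most `N`. -/
noncomputable def oneLoopUpTo (N k : ℕ) : Finset Word := {w ∈ closedWords N k | IsOneLoop w}

lemma mem_oneLoopUpTo {N k : ℕ} {w : Word} :
    w ∈ oneLoopUpTo N k ↔ w ∈ closedWords N k ∧ IsOneLoop w := by
  classical
  simp only [oneLoopUpTo, Finset.mem_filter]

lemma OneLoopWords.isOneLoop {k : ℕ} (x : OneLoopWords k) : IsOneLoop x.1 ∧ x.1.length = k + 1 :=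
  (isOneLoop_iff _ _).1 x.2

lemma IsOneLoop.of_pairEquiv {w : Word} (hw : IsOneLoop w) {b : Word × Word}
    (h : PairEquiv (w, w) b) (hb : b.1.head? = some 1) : IsOneLoop b.1 ∧ b.2 = b.1 := by
  obtain ⟨f, hf1, hf, h1, h2⟩ := h.exists_map hw.closed.1 hb
  refine ⟨?_, h2.trans h1.symm⟩
  rw [h1]
  exact hw.map hf1 hf fun x hx => mem_pairSupp.2 (Or.inl hx)

/-- Equivalence of one-loop words, through pairs. -/
abbrev oneLoopPairSetoid (k : ℕ) : Setoid (OneLoopWords k) :=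
  Setoid.comap (fun w : OneLoopWords k => ((w.1, w.1) : Word × Word))
    ⟨PairEquiv, pairEquiv_equivalence⟩

lemma oneLoopSetoid_eq (k : ℕ) : oneLoopSetoid k = oneLoopPairSetoid k :=
  Setoid.ext fun x y => wordEquiv_iff x.1 y.1

/-- The letters of a one-loop word are unbounded, but each class has a representative whose letters
are at most the weight. -/
instance (k : ℕ) : Finite (Quotient (oneLoopPairSetoid k)) := by
  let S : Set Word := {w | w.length = k + 1 ∧ IsBoundedWord (k + 1) w}
  have hS : Finite S := (finite_bounded (k + 1) (k + 1)).to_subtype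
  have : Finite {x : OneLoopWords k // x.1 ∈ S} :=
    Finite.of_injective (β := S) (fun x => ⟨x.1.1, x.2⟩) (fun x y hxy => by
      exact Subtype.ext (Subtype.ext (by simpa using hxy)))
  refine Finite.of_surjective
    (fun x : {x : OneLoopWords k // x.1 ∈ S} => (⟦x.1⟧ : Quotient (oneLoopPairSetoid k))) ?_
  intro q
  obtain ⟨x, rfl⟩ := Quotient.exists_rep q
  obtain ⟨hx, hlen⟩ := x.isOneLoop
  obtain ⟨b, hb⟩ := exists_normalized (p := (x.1, x.1)) hx.closed.1
  obtain ⟨h1, h2, h3, -⟩ := mem_classMembers.1 hb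
  obtain ⟨h4, h5⟩ := hx.of_pairEquiv h1 h2
  have hlenb : b.1.length = k + 1 := h1.length_eq.1.trans hlen
  refine ⟨⟨⟨b.1, (isOneLoop_iff _ _).2 ⟨h4, hlenb⟩⟩, hlenb, fun s hs => (h3 s hs).trans ?_⟩, ?_⟩
  · have hwt := hx.weight
    have : pairWt (x.1, x.1) = wt x.1 := by simp [pairWt, pairSupp, wt]
    omega
  · refine Quotient.sound (s := oneLoopPairSetoid k) ?_
    refine pairEquiv_equivalence.symm ?_
    have : b = (b.1, b.1) := Prod.ext rfl h5
    rwa [this] at h1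

/-- A word is treated as the diagonal pair `(w, w)`, so that the count of the members of a class of
pairs applies. -/
lemma card_oneLoopUpTo (n k : ℕ) :
    ((oneLoopUpTo (n + 1) k).card : ℝ) = n.descFactorial ((k + 1) / 2 - 1) * aConst k := by
  classical
  let := Fintype.ofFinite (Quotient (oneLoopPairSetoid k))
  have h1 := sum_eq_sum_quotient (fun w : OneLoopWords k => ((w.1, w.1) : Word × Word))
    ((oneLoopUpTo (n + 1) k).image fun w => (w, w)) (fun _ => 1) (fun _ _ _ => rfl) ?_
    (n.descFactorial ((k + 1) / 2 - 1)) ?_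
  · simp only [Finset.sum_const, nsmul_eq_mul, mul_one, Finset.card_univ] at h1
    rw [Finset.card_image_of_injective _ (fun a b h => (Prod.ext_iff.1 h).1)] at h1
    rw [h1, aConst, oneLoopSetoid_eq, Nat.card_eq_fintype_card]
  · intro p hp
    obtain ⟨w, hw, rfl⟩ := Finset.mem_image.1 hp
    obtain ⟨hw1, hw2⟩ := mem_oneLoopUpTo.1 hw
    exact ⟨⟨w, (isOneLoop_iff _ _).2 ⟨hw2, (mem_closedWords.1 hw1).2.1⟩⟩,
      pairEquiv_equivalence.refl _⟩
  · intro x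
    obtain ⟨hx, hlen⟩ := x.isOneLoop
    refine ⟨classMembers (n + 1) (x.1, x.1), fun p => ?_, ?_⟩
    · rw [mem_classMembers, Finset.mem_image]
      constructor
      · rintro ⟨h1, h2, h3, h4⟩
        obtain ⟨h5, h6⟩ := hx.of_pairEquiv h1 h2
        exact ⟨⟨p.1, mem_oneLoopUpTo.2 ⟨mem_closedWords.2
          ⟨h5.closed, h1.length_eq.1.trans hlen, h3⟩, h5⟩, Prod.ext rfl h6.symm⟩, h1⟩
      · rintro ⟨⟨w, hw, rfl⟩, h2⟩
        have h3 := mem_closedWords.1 (mem_oneLoopUpTo.1 hw).1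
        exact ⟨h2, h3.1.1, h3.2.2, h3.2.2⟩
    · rw [card_classMembers n _ hx.closed.1]
      have hwt := hx.weight
      have : pairWt (x.1, x.1) = wt x.1 := by simp [pairWt, pairSupp, wt]
      congr 1
      omega

/-- A class has of order `N ^ ((k - 1) / 2)` members, the inverse of the normalization; for even `k`
there are no such words. -/
lemma tendsto_scale_mul_card_oneLoopUpTo (k : ℕ) :
    Tendsto (fun n : ℕ => scale (n + 1) k * (oneLoopUpTo (n + 1) k).card) atTop
      (nhds (aConst k)) := by
  simp_rw [card_oneLoopUpTo]
  rcases isEmpty_or_nonempty (OneLoopWords k) with he | ⟨⟨x⟩⟩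
  · have : IsEmpty (Quotient (oneLoopSetoid k)) := ⟨fun q => he.elim q.out⟩
    simp [aConst]
  · obtain ⟨hx, hlen⟩ := x.isOneLoop
    have hwt := hx.weight
    obtain ⟨t, ht⟩ : ∃ t, k = 2 * t + 1 := ⟨wt x.1 - 1, by omega⟩
    have h1 := (tendsto_descFactorial_div_pow t).mul_const (aConst k : ℝ)
    rw [one_mul] at h1
    refine h1.congr fun n => ?_
    have hexp : (k + 1) / 2 - 1 = t := by omega
    rw [hexp]
    have hs0 : 0 < √((n + 1 : ℕ) : ℝ) := by positivity
    have hsq : ((n + 1 : ℕ) : ℝ) = √((n + 1 : ℕ) : ℝ) ^ 2 :=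
      (Real.sq_sqrt (Nat.cast_nonneg _)).symm
    have h2 : scale (n + 1) k = (((n + 1 : ℕ) : ℝ) ^ t)⁻¹ := by
      rw [scale, ht]
      conv_rhs => rw [hsq]
      generalize √((n + 1 : ℕ) : ℝ) = s at hs0
      rw [← pow_mul, pow_succ]
      simp only [inv_pow]
      field_simp
    rw [h2]
    ring

/-! ### The contribution of words with self-edges -/

section LoopPart

variable {Ω : Type*} [MeasurableSpace Ω] {P : Measure Ω} [IsProbabilityMeasure P]
  {ξ : Sym2 ℕ+ → Ω → ℝ}

-- The square expands into covariances of pairs of words, so it suffices that no pair of maximal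
-- weight contributes.
omit [IsProbabilityMeasure P] in
lemma tendsto_integral_sq_sum_zero (k : ℕ) (D : Word → Ω → ℝ) (hD : ∀ w, HasMoments (D w) P)
    (p : Word → Prop) [DecidablePred p] (M : ℝ) (hM0 : 0 ≤ M)
    (hM : ∀ w : Fin 2 → Word, (∀ i, IsClosedFromOne (w i) ∧ (w i).length = k + 1) →
      (∀ i, p (w i)) → |∫ ω, D (w 0) ω * D (w 1) ω ∂P| ≤ M)
    (hwt : ∀ w : Fin 2 → Word, (∀ i, IsClosedFromOne (w i) ∧ (w i).length = k + 1) →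
      (∀ i, p (w i)) → ∫ ω, D (w 0) ω * D (w 1) ω ∂P ≠ 0 → 2 * (tupleSupp w).card + 1 ≤ 2 * k) :
    Tendsto (fun n : ℕ => ∫ ω, (scale (n + 1) k *
      ∑ w ∈ closedWords (n + 1) k with p w, D w ω) ^ 2 ∂P) atTop (nhds 0) := by
  let G : Word × Word → ℝ := fun q => if p q.1 ∧ p q.2 then ∫ ω, D q.1 ω * D q.2 ω ∂P else 0
  have hneg := tendsto_sum_tuples_zero (fun _ : Fin 2 => k) M (fun w => G (w 0, w 1)) ?_ ?_
  · refine hneg.congr fun n => ?_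
    rw [← sum_product_eq_sum_piFinset (fun _ => closedWords (n + 1) k) G, Fin.prod_univ_two]
    simp only [G]
    rw [← Finset.sum_filter]
    have h1 : ∀ ω, (scale (n + 1) k * ∑ w ∈ closedWords (n + 1) k with p w, D w ω) ^ 2 =
        scale (n + 1) k * scale (n + 1) k *
          ∑ q ∈ closedWords (n + 1) k ×ˢ closedWords (n + 1) k with p q.1 ∧ p q.2,
            D q.1 ω * D q.2 ω := by
      intro ω
      rw [Finset.filter_product, Finset.sum_product]
      dsimp only
      rw [← Finset.sum_mul_sum]
      ring
    simp_rw [h1]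
    rw [integral_const_mul, integral_finsetSum _ fun q _ => ((hD q.1).mul (hD q.2)).integrable]
  · intro w hw
    simp only [G]
    split_ifs with hp
    · exact hM w hw (Fin.forall_fin_two.2 hp)
    · simpa using hM0
  · intro w hw hne
    simp only [G] at hne
    split_ifs at hne with hp
    · have := hwt w hw (Fin.forall_fin_two.2 hp) hne
      simp only [Fintype.card_fin, Fin.sum_univ_two]
      omega
    · exact absurd rfl hne

omit [MeasurableSpace Ω] in
lemma T_one_one (ξ : Sym2 ℕ+ → Ω → ℝ) (ω : Ω) : T ξ [1, 1] ω = ξ s(1, 1) ω := by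
  simp [T_eq_prod_steps]

omit [MeasurableSpace Ω] in
lemma IsOneLoop.T_eq {w : Word} (hw : IsOneLoop w) (ξ : Sym2 ℕ+ → Ω → ℝ) (ω : Ω) :
    T ξ w ω = ξ s(1, 1) ω * ∏ e ∈ (edgeSet w).erase s(1, 1), ξ e ω ^ 2 := by
  have h11 : s(1, 1) ∈ edgeSet w := by rw [mem_edgeSet, hw.passages_one]; simp
  rw [T, ← Finset.mul_prod_erase _ _ h11, hw.passages_one, pow_one]
  congr 1
  refine Finset.prod_congr rfl fun e he => ?_
  rw [Finset.mem_erase] at he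
  rw [(hw.passages_two e he.2 he.1).1]

omit [IsProbabilityMeasure P] in
lemma IsOneLoop.integral_prod_sq (h : IsWignerEnsemble ξ P) {w : Word} (hw : IsOneLoop w) :
    ∫ ω, ∏ e ∈ (edgeSet w).erase s(1, 1), ξ e ω ^ 2 ∂P = 1 := by
  rw [h.integral_prod _ (fun _ x => x ^ 2) (by fun_prop)]
  refine Finset.prod_eq_one fun e he => ?_
  rw [Finset.mem_erase] at he
  exact h.integral_sq (hw.passages_two e he.2 he.1).2

/-- The covariance of two one-loop words, minus the entry `ξ s(1, 1)`, vanishes when the words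
share no edge other than the loop at `1`. -/
lemma integral_oneLoop_mul_oneLoop_eq_zero (h : IsWignerEnsemble ξ P) {u v : Word}
    (hu : IsOneLoop u) (hv : IsOneLoop v)
    (huv : ∀ e ∈ edgeSet u, e ≠ s(1, 1) → e ∉ edgeSet v) :
    ∫ ω, (T ξ u ω - ξ s(1, 1) ω) * (T ξ v ω - ξ s(1, 1) ω) ∂P = 0 := by
  set R : Word → Ω → ℝ := fun w ω => ∏ e ∈ (edgeSet w).erase s(1, 1), ξ e ω ^ 2 with hR
  have hRm : ∀ w, Measurable[sigmaEdges ξ ((edgeSet w).erase s(1, 1))] (R w) := fun w =>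
    Finset.measurable_fun_prod _ fun e he => (measurable_sigmaEdges he).pow_const 2
  have hRint : ∀ w, HasMoments (R w) P := fun w =>
    hasMoments_prod _ fun e _ => (h.hasMoments e).pow 2
  -- Both differences contain the factor `ξ₁₁`. The factor `R u - 1` is centred, off-diagonal
  -- entries having variance one, and is independent of `ξ₁₁` and of `R v`.
  have h1 : ∀ ω, (T ξ u ω - ξ s(1, 1) ω) * (T ξ v ω - ξ s(1, 1) ω) =
      ((ξ s(1, 1) ω) ^ 2 * (R v ω - 1)) * (R u ω - 1) := by
    intro ω
    rw [hu.T_eq, hv.T_eq]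
    simp only [hR]
    ring
  simp_rw [h1]
  rw [h.integral_mul_of_disjoint (A := ((((edgeSet u).erase s(1, 1) : Finset _) : Set (Sym2 ℕ+)))ᶜ)
    (B := ((edgeSet u).erase s(1, 1) : Finset _)) disjoint_compl_left]
  · rw [integral_sub (hRint u).integrable (integrable_const _), hu.integral_prod_sq h]
    simp
  · refine Measurable.mul ((measurable_sigmaEdges (by simp)).pow_const 2) ?_
    refine Measurable.sub_const ((hRm v).mono (sigmaEdges_mono (B := ((((edgeSet u).erase s(1, 1) : Finset _) :
      Set (Sym2 ℕ+)))ᶜ) fun e he he' => ?_) le_rfl) _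
    simp only [Finset.coe_erase, Set.mem_sdiff, Finset.mem_coe, Set.mem_singleton_iff] at he he'
    exact huv e he'.1 he'.2 he.1
  · exact (hRm u).sub_const _

lemma isLinked_of_isOneLoop {w : Fin 2 → Word} (hw : ∀ i, IsOneLoop (w i)) : IsLinked w := by
  refine ⟨fun e he => ?_, fun i => ?_⟩
  · rw [Fin.sum_univ_two]
    by_cases h1 : e = s(1, 1)
    · rw [h1, (hw 0).passages_one, (hw 1).passages_one]
    · obtain ⟨i, -, hi⟩ := Finset.mem_biUnion.1 he
      have h2 := ((hw i).passages_two e hi h1).1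
      revert h2
      fin_cases i <;> simp only [Fin.zero_eta, Fin.mk_one] <;> omega
  · obtain ⟨j, hj⟩ := exists_ne i
    exact ⟨j, hj.symm, s(1, 1), by simp [(hw i).passages_one], by simp [(hw j).passages_one]⟩

-- Two one-loop words are always linked through the loop at `1`. At maximal weight they share
-- nothing else, and the covariance vanishes once `ξ₁₁` has been subtracted.
open Classical in
lemma tendsto_integral_sq_oneLoop (h : IsWignerEnsemble ξ P) (k : ℕ) :
    Tendsto (fun n : ℕ => ∫ ω, (scale (n + 1) k *
      ∑ w ∈ closedWords (n + 1) k with IsOneLoop w, (T ξ w ω - ξ s(1, 1) ω)) ^ 2 ∂P) atTop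
      (nhds 0) := by
  obtain ⟨M, hM0, hM⟩ := exists_abs_integral_TBar_mul_TBar_le h (k + 2)
  refine tendsto_integral_sq_sum_zero k (fun w ω => T ξ w ω - ξ s(1, 1) ω)
    (fun w => (h.hasMoments_T w).sub (h.hasMoments _)) IsOneLoop (4 * M) (by positivity)
    (fun w hw hp => ?_) fun w hw hp hne => ?_
  · have hbar : ∀ u, IsOneLoop u → ∀ ω, T ξ u ω = TBar ξ P u ω := fun u hu ω => by
      rw [TBar, h.integral_T_eq_zero hu.passages_one, sub_zero]
    -- Seeing `ξ₁₁` as the variable of the word `[1, 1]` makes the uniform bound on covariances of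
    -- words available for each of the four terms, whence `4 * M`.
    have hbar1 : ∀ ω, ξ s(1, 1) ω = TBar ξ P [1, 1] ω := fun ω => by
      rw [TBar]
      simp_rw [T_one_one]
      rw [h.integral_eq_zero, sub_zero]
    have hint : ∀ u v : Word, Integrable (fun ω => TBar ξ P u ω * TBar ξ P v ω) P := fun u v =>
      ((h.hasMoments_TBar u).mul (h.hasMoments_TBar v)).integrable
    have hexp : ∫ ω, (T ξ (w 0) ω - ξ s(1, 1) ω) * (T ξ (w 1) ω - ξ s(1, 1) ω) ∂P =
        ∫ ω, TBar ξ P (w 0) ω * TBar ξ P (w 1) ω ∂P - ∫ ω, TBar ξ P (w 0) ω * TBar ξ P [1, 1] ω ∂P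
        - (∫ ω, TBar ξ P [1, 1] ω * TBar ξ P (w 1) ω ∂P -
          ∫ ω, TBar ξ P [1, 1] ω * TBar ξ P [1, 1] ω ∂P) := by
      have hsub : ∀ u v u' v' : Word, Integrable (fun ω =>
          TBar ξ P u ω * TBar ξ P v ω - TBar ξ P u' ω * TBar ξ P v' ω) P :=
        fun _ _ _ _ => (hint _ _).sub (hint _ _)
      rw [← integral_sub (hint _ _) (hint _ _), ← integral_sub (hint _ _) (hint _ _),
        ← integral_sub (hsub _ _ _ _) (hsub _ _ _ _)]
      refine integral_congr_ae (Eventually.of_forall fun ω => ?_)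
      dsimp only
      rw [hbar _ (hp 0), hbar _ (hp 1), hbar1]
      ring
    have hb : ∀ u v : Word, u.length ≤ k + 2 → v.length ≤ k + 2 →
        |∫ ω, TBar ξ P u ω * TBar ξ P v ω ∂P| ≤ M := fun u v hu hv =>
      hM ![u, v] (Fin.forall_fin_two.2 ⟨hu, hv⟩)
    have h0 := (hw 0).2
    have h1 := (hw 1).2
    rw [hexp]
    have a1 := abs_le.1 (hb (w 0) (w 1) (by omega) (by omega))
    have a2 := abs_le.1 (hb (w 0) [1, 1] (by omega) (by simp))
    have a3 := abs_le.1 (hb [1, 1] (w 1) (by simp) (by omega))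
    have a4 := abs_le.1 (hb [1, 1] [1, 1] (by simp) (by simp))
    rw [abs_le]
    constructor <;> linarith [a1.1, a1.2, a2.1, a2.2, a3.1, a3.2, a4.1, a4.2]
  · by_contra hlt
    refine hne (integral_oneLoop_mul_oneLoop_eq_zero h (hp 0) (hp 1) ?_)
    refine ((isLinked_of_isOneLoop hp).isOneLoop (fun i => (hw i).1) ?_ (g := s(1, 1)) (by simp)
      (edgeSet_subset_tupleEdges w 0 ?_) 0 1 (by decide)).2
    · rw [Fin.sum_univ_two, (hw 0).2, (hw 1).2]
      omega
    · rw [mem_edgeSet, (hp 0).passages_one]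
      simp

-- A self-edge in a linked pair of maximal weight makes both words one-loop words, which are
-- excluded here.
open Classical in
lemma tendsto_integral_sq_otherLoops (h : IsWignerEnsemble ξ P) (k : ℕ) :
    Tendsto (fun n : ℕ => ∫ ω, (scale (n + 1) k *
      ∑ w ∈ closedWords (n + 1) k with ¬ NoSelfEdge w ∧ ¬ IsOneLoop w, TBar ξ P w ω) ^ 2 ∂P) atTop
      (nhds 0) := by
  obtain ⟨M, hM0, hM⟩ := exists_abs_integral_TBar_mul_TBar_le h (k + 1)
  refine tendsto_integral_sq_sum_zero k (TBar ξ P) h.hasMoments_TBar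
    (fun w => ¬ NoSelfEdge w ∧ ¬ IsOneLoop w) M hM0 (fun w hw hp => hM w fun i => (hw i).2.le)
    fun w hw hp hne => ?_
  by_contra hlt
  have hl := isLinked_of_integral_ne_zero h hne
  have hloop := (hp 0).1
  simp only [NoSelfEdge, not_forall, not_not] at hloop
  obtain ⟨g, hg, hgd⟩ := hloop
  refine (hp 0).2 (hl.isOneLoop (fun i => (hw i).1) ?_ hgd (edgeSet_subset_tupleEdges w 0 hg) 0 1
    (by decide)).1
  rw [Fin.sum_univ_two, (hw 0).2, (hw 1).2]
  omega

/-- The part of `SBar` which vanishes in the limit. -/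
noncomputable def remainder (ξ : Sym2 ℕ+ → Ω → ℝ) (P : Measure Ω) (N : ℕ) [NeZero N] (k : ℕ)
    (ω : Ω) : ℝ :=
  SBar ξ P N k ω - freePart ξ P N k ω - aConst k * ξ s(1, 1) ω

-- Besides the free words there are one-loop words and the other words with self-edges. Replacing
-- each one-loop variable by `ξ₁₁` produces the coefficient in the last term, which tends to zero.
open Classical in
lemma remainder_eq (h : IsWignerEnsemble ξ P) (N : ℕ) [NeZero N] (k : ℕ) (ω : Ω) :
    remainder ξ P N k ω =
      scale N k * ∑ w ∈ closedWords N k with ¬ NoSelfEdge w ∧ ¬ IsOneLoop w, TBar ξ P w ω +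
      scale N k * ∑ w ∈ closedWords N k with IsOneLoop w, (T ξ w ω - ξ s(1, 1) ω) +
      (scale N k * (oneLoopUpTo N k).card - aConst k) * ξ s(1, 1) ω := by
  have hloop : ∀ w, IsOneLoop w → ¬ NoSelfEdge w := fun w hw hn =>
    hn s(1, 1) (by rw [mem_edgeSet, hw.passages_one]; simp) (by simp)
  have h1 : ∑ w ∈ closedWords N k, TBar ξ P w ω = ∑ w ∈ freeWords N k, TBar ξ P w ω +
      (∑ w ∈ closedWords N k with ¬ NoSelfEdge w ∧ ¬ IsOneLoop w, TBar ξ P w ω +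
        ∑ w ∈ closedWords N k with IsOneLoop w, TBar ξ P w ω) := by
    rw [← Finset.sum_filter_add_sum_filter_not (closedWords N k) NoSelfEdge,
      ← Finset.sum_filter_add_sum_filter_not ({w ∈ closedWords N k | ¬ NoSelfEdge w}) IsOneLoop,
      Finset.filter_filter, Finset.filter_filter]
    rw [add_comm (∑ w ∈ closedWords N k with ¬ NoSelfEdge w ∧ IsOneLoop w, TBar ξ P w ω)]
    congr 3
    ext w
    simp only [Finset.mem_filter]
    exact and_congr_right fun _ => ⟨fun h => h.2, fun h => ⟨hloop w h, h⟩⟩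
  have h2 : ∑ w ∈ closedWords N k with IsOneLoop w, (T ξ w ω - ξ s(1, 1) ω) =
      ∑ w ∈ closedWords N k with IsOneLoop w, TBar ξ P w ω -
        (oneLoopUpTo N k).card * ξ s(1, 1) ω := by
    rw [Finset.sum_sub_distrib, Finset.sum_const, nsmul_eq_mul, oneLoopUpTo]
    congr 1
    refine Finset.sum_congr rfl fun w hw => ?_
    rw [TBar, h.integral_T_eq_zero (Finset.mem_filter.1 hw).2.passages_one, sub_zero]
  rw [remainder, SBar_eq_sum ξ h, h1, h2, freePart, scale]
  ring

lemma hasMoments_SBar (h : IsWignerEnsemble ξ P) (N : ℕ) [NeZero N] (k : ℕ) :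
    HasMoments (SBar ξ P N k) P := by
  have : SBar ξ P N k = fun ω => scale N k * ∑ w ∈ closedWords N k, TBar ξ P w ω :=
    funext fun ω => SBar_eq_sum ξ h N k ω
  rw [this]
  exact (hasMoments_sum _ fun w _ => h.hasMoments_TBar w).const_mul _

lemma hasMoments_remainder (h : IsWignerEnsemble ξ P) (N : ℕ) [NeZero N] (k : ℕ) :
    HasMoments (remainder ξ P N k) P :=
  ((hasMoments_SBar h N k).sub (hasMoments_freePart h N k)).sub ((h.hasMoments _).const_mul _)

theorem tendsto_integral_sq_remainder (h : IsWignerEnsemble ξ P) (k : ℕ) :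
    Tendsto (fun n : ℕ => ∫ ω, remainder ξ P (n + 1) k ω ^ 2 ∂P) atTop (nhds 0) := by
  classical
  have h1 := tendsto_integral_sq_otherLoops h k
  have h2 := tendsto_integral_sq_oneLoop h k
  have h3 : Tendsto (fun n : ℕ => (scale (n + 1) k * (oneLoopUpTo (n + 1) k).card - aConst k) ^ 2 *
      ∫ ω, ξ s(1, 1) ω ^ 2 ∂P) atTop (nhds 0) := by
    have := (((tendsto_scale_mul_card_oneLoopUpTo k).sub_const (aConst k : ℝ)).pow 2).mul_const
      (∫ ω, ξ s(1, 1) ω ^ 2 ∂P)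
    simpa using this
  -- The factor comes from `(a + b + c)² ≤ 3 (a² + b² + c²)`.
  have h4 := ((h1.add h2).add h3).const_mul 3
  rw [add_zero, add_zero, mul_zero] at h4
  refine squeeze_zero (fun n => integral_nonneg fun ω => sq_nonneg _) (fun n => ?_) h4
  have m1 : HasMoments (fun ω => scale (n + 1) k * ∑ w ∈ closedWords (n + 1) k with
      ¬ NoSelfEdge w ∧ ¬ IsOneLoop w, TBar ξ P w ω) P :=
    (hasMoments_sum _ fun w _ => h.hasMoments_TBar w).const_mul _
  have m2 : HasMoments (fun ω => scale (n + 1) k *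
      ∑ w ∈ closedWords (n + 1) k with IsOneLoop w, (T ξ w ω - ξ s(1, 1) ω)) P :=
    (hasMoments_sum _ fun w _ => (h.hasMoments_T w).sub (h.hasMoments _)).const_mul _
  have m3 := (h.hasMoments s(1, 1)).pow 2
  have i3 := (m3.const_mul ((scale (n + 1) k * (oneLoopUpTo (n + 1) k).card - aConst k) ^ 2)).integrable
  rw [← integral_const_mul, ← integral_add (m1.pow 2).integrable (m2.pow 2).integrable,
    ← integral_add ((m1.pow 2).add (m2.pow 2)).integrable i3, ← integral_const_mul]
  refine integral_mono ((hasMoments_remainder h (n + 1) k).pow 2).integrable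
    (((((m1.pow 2).add (m2.pow 2)).integrable).add i3).const_mul 3) fun ω => ?_
  dsimp only [Pi.add_apply]
  rw [remainder_eq h, ← mul_pow]
  generalize scale (n + 1) k * ∑ w ∈ closedWords (n + 1) k with ¬ NoSelfEdge w ∧ ¬ IsOneLoop w, _ = a
  generalize scale (n + 1) k * ∑ w ∈ closedWords (n + 1) k with IsOneLoop w, _ = b
  generalize (scale (n + 1) k * _ - aConst k) * ξ s(1, 1) ω = c
  nlinarith [sq_nonneg (a - b), sq_nonneg (b - c), sq_nonneg (a - c)]

end LoopPart

/-! ### The defect of the pairing formula -/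

section Defect

variable {Ω : Type*} [MeasurableSpace Ω] {ι : Type*} [Fintype ι] [DecidableEq ι]

/-- The product of the mixed moments over `s` and over its complement. -/
noncomputable def splitMoment (P : Measure Ω) (s : Finset ι) (X : ι → Ω → ℝ) : ℝ :=
  (∫ ω, ∏ i ∈ s, X i ω ∂P) * ∫ ω, ∏ i ∈ sᶜ, X i ω ∂P

omit [MeasurableSpace Ω] in
lemma prod_ite_eq_mul (s : Finset ι) (X : ι → Ω → ℝ) (z : Ω × Ω) :
    ∏ i, X i (if i ∈ s then z.1 else z.2) = (∏ i ∈ s, X i z.1) * ∏ i ∈ sᶜ, X i z.2 := by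
  rw [← Finset.prod_mul_prod_compl s]
  congr 1
  · exact Finset.prod_congr rfl fun i hi => by rw [if_pos hi]
  · exact Finset.prod_congr rfl fun i hi => by rw [if_neg (Finset.mem_compl.1 hi)]

variable (P : Measure Ω) [IsProbabilityMeasure P]

/-- Two independent copies turn a product of moments into one integral of a product over all
indices, which makes the multilinearity evident. -/
lemma splitMoment_eq_integral (s : Finset ι) (X : ι → Ω → ℝ) :
    splitMoment P s X = ∫ z, ∏ i, X i (if i ∈ s then z.1 else z.2) ∂(P.prod P) := by
  simp_rw [prod_ite_eq_mul]
  exact (integral_prod_mul _ _).symm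

lemma integrable_prod_ite (s : Finset ι) {X : ι → Ω → ℝ} (hX : ∀ i, HasMoments (X i) P) :
    Integrable (fun z : Ω × Ω => ∏ i, X i (if i ∈ s then z.1 else z.2)) (P.prod P) := by
  simp_rw [prod_ite_eq_mul]
  exact (hasMoments_prod s fun i _ => hX i).integrable.mul_prod
    (hasMoments_prod sᶜ fun i _ => hX i).integrable

lemma splitMoment_sum {J : Type*} (s : Finset ι) (A : ι → Finset J) (c : ι → J → ℝ)
    {X : ι → J → Ω → ℝ} (hX : ∀ i j, HasMoments (X i j) P) :
    splitMoment P s (fun i ω => ∑ j ∈ A i, c i j * X i j ω) =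
      ∑ p ∈ Fintype.piFinset A, (∏ i, c i (p i)) * splitMoment P s fun i => X i (p i) := by
  simp_rw [splitMoment_eq_integral, Finset.prod_univ_sum, Finset.prod_mul_distrib]
  rw [integral_finsetSum _ fun p _ => (integrable_prod_ite P s fun i => hX i (p i)).const_mul _]
  simp_rw [integral_const_mul]

/-- The difference between a mixed moment and its Gaussian value computed by pairing `a` with the
other indices. -/
noncomputable def defect (a : ι) (X : ι → Ω → ℝ) : ℝ :=
  splitMoment P Finset.univ X - ∑ j ∈ Finset.univ.erase a, splitMoment P {a, j} X

lemma defect_sum {J : Type*} (a : ι) (A : ι → Finset J) (c : ι → J → ℝ)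
    {X : ι → J → Ω → ℝ} (hX : ∀ i j, HasMoments (X i j) P) :
    defect P a (fun i ω => ∑ j ∈ A i, c i j * X i j ω) =
      ∑ p ∈ Fintype.piFinset A, (∏ i, c i (p i)) * defect P a fun i => X i (p i) := by
  simp only [defect, splitMoment_sum P _ A c hX]
  rw [Finset.sum_comm, ← Finset.sum_sub_distrib]
  refine Finset.sum_congr rfl fun p _ => ?_
  rw [← Finset.mul_sum, mul_sub]

end Defect

/-! ### The defect of a tuple of words -/

section WordDefect

lemma IsLinked.of_compl {ι : Type*} [Fintype ι] [DecidableEq ι] {w : ι → Word} {s : Finset ι}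
    (h1 : IsLinked fun i : s => w i) (h2 : IsLinked fun i : (sᶜ : Finset ι) => w i) :
    IsLinked w := by
  refine ⟨fun e he => ?_, fun i => ?_⟩
  · obtain ⟨i, -, hi⟩ := Finset.mem_biUnion.1 he
    rw [← Finset.sum_add_sum_compl s]
    by_cases his : i ∈ s
    · have := h1.1 e (edgeSet_subset_tupleEdges (fun i : s => w i) ⟨i, his⟩ hi)
      rw [Finset.sum_coe_sort s fun i => passages (w i) e] at this
      omega
    · have := h2.1 e (edgeSet_subset_tupleEdges (fun i : (sᶜ : Finset ι) => w i)
        ⟨i, Finset.mem_compl.2 his⟩ hi)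
      rw [Finset.sum_coe_sort sᶜ fun i => passages (w i) e] at this
      omega
  · by_cases his : i ∈ s
    · obtain ⟨j, hj, hs⟩ := h1.2 ⟨i, his⟩
      exact ⟨j, fun h => hj (Subtype.ext h), hs⟩
    · obtain ⟨j, hj, hs⟩ := h2.2 ⟨i, Finset.mem_compl.2 his⟩
      exact ⟨j, fun h => hj (Subtype.ext h), hs⟩

variable {Ω : Type*} [MeasurableSpace Ω] {P : Measure Ω} [IsProbabilityMeasure P]
  {ξ : Sym2 ℕ+ → Ω → ℝ} {ι : Type*} [Fintype ι] [DecidableEq ι]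

omit [Fintype ι] [DecidableEq ι] in
lemma isLinked_of_integral_prod_ne_zero (h : IsWignerEnsemble ξ P) {w : ι → Word} {s : Finset ι}
    (hne : ∫ ω, ∏ i ∈ s, TBar ξ P (w i) ω ∂P ≠ 0) : IsLinked fun i : s => w i := by
  by_contra hl
  refine hne ?_
  rw [← h.integral_prod_TBar_eq_zero _ hl]
  congr 1 with ω
  exact (Finset.prod_coe_sort s fun i => TBar ξ P (w i) ω).symm

omit [DecidableEq ι] in
lemma exists_abs_integral_prod_finset_TBar_le (h : IsWignerEnsemble ξ P) (k : ℕ) :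
    ∃ M : ℝ, 0 ≤ M ∧ ∀ (s : Finset ι) (w : ι → Word), (∀ i, (w i).length ≤ k) →
      |∫ ω, ∏ i ∈ s, TBar ξ P (w i) ω ∂P| ≤ M := by
  choose M hM0 hM using fun s : Finset ι => h.exists_abs_integral_prod_TBar_le s k
  refine ⟨∑ s, M s, Finset.sum_nonneg fun s _ => hM0 s, fun s w hw => ?_⟩
  refine le_trans ?_ (Finset.single_le_sum (fun s _ => hM0 s) (Finset.mem_univ s))
  have := hM s (fun i => w i) fun i => hw i
  have hprod : ∀ ω, ∏ i : s, TBar ξ P (w i) ω = ∏ i ∈ s, TBar ξ P (w i) ω := fun ω =>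
    Finset.prod_coe_sort s fun i => TBar ξ P (w i) ω
  simpa only [hprod] using this

lemma exists_abs_defect_TBar_le (h : IsWignerEnsemble ξ P) (a : ι) (k : ℕ) :
    ∃ M : ℝ, 0 ≤ M ∧ ∀ w : ι → Word, (∀ i, (w i).length ≤ k) →
      |defect P a fun i => TBar ξ P (w i)| ≤ M := by
  obtain ⟨M, hM0, hM⟩ := exists_abs_integral_prod_finset_TBar_le (ι := ι) h k
  have hsplit : ∀ (s : Finset ι) (w : ι → Word), (∀ i, (w i).length ≤ k) →
      |splitMoment P s fun i => TBar ξ P (w i)| ≤ M * M := fun s w hw => by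
    rw [splitMoment, abs_mul]
    exact mul_le_mul (hM s w hw) (hM sᶜ w hw) (abs_nonneg _) hM0
  refine ⟨M * M + (Finset.univ.erase a).card * (M * M), by positivity, fun w hw => ?_⟩
  refine (abs_sub _ _).trans (add_le_add (hsplit _ w hw) ?_)
  refine (Finset.abs_sum_le_sum_abs _ _).trans ?_
  rw [← nsmul_eq_mul]
  exact Finset.sum_le_card_nsmul _ _ _ fun j _ => hsplit _ w hw

/-- The pairing formula is exact for tuples of words of maximal weight. -/
lemma defect_TBar_eq_zero (h : IsWignerEnsemble ξ P) (a : ι) {w : ι → Word}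
    (hw : ∀ i, IsClosedFromOne (w i)) (hs : ∀ i, NoSelfEdge (w i))
    (hwt : ∑ i, ((w i).length - 1) + 2 ≤ 2 * (tupleSupp w).card + Fintype.card ι) :
    defect P a (fun i => TBar ξ P (w i)) = 0 := by
  have hne : Nonempty ι := ⟨a⟩
  have huniv : splitMoment P Finset.univ (fun i => TBar ξ P (w i)) =
      ∫ ω, ∏ i, TBar ξ P (w i) ω ∂P := by simp [splitMoment]
  -- A nonzero pairing term makes `{a, j}` and its complement linked separately, hence the whole
  -- tuple linked.
  have hpair : ∀ j, splitMoment P {a, j} (fun i => TBar ξ P (w i)) ≠ 0 →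
      IsLinked w ∧ ShareEdge (w a) (w j) := by
    intro j hj
    have h1 := isLinked_of_integral_prod_ne_zero h (left_ne_zero_of_mul hj)
    have h2 := isLinked_of_integral_prod_ne_zero h (right_ne_zero_of_mul hj)
    refine ⟨h1.of_compl h2, ?_⟩
    obtain ⟨⟨i, hi⟩, hai, hsh⟩ := h1.2 ⟨a, by simp⟩
    rw [Finset.mem_insert, Finset.mem_singleton] at hi
    rcases hi with rfl | rfl
    · exact absurd rfl hai
    · exact hsh
  by_cases hl : IsLinked w
  · obtain ⟨b, hab, hsh⟩ := hl.2 a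
    have hone : ∑ j ∈ Finset.univ.erase a, splitMoment P {a, j} (fun i => TBar ξ P (w i)) =
        splitMoment P {a, b} (fun i => TBar ξ P (w i)) := by
      refine Finset.sum_eq_single_of_mem b (by simp [hab.symm]) fun j hj hjb => ?_
      by_contra hj0
      exact hjb (hl.eq_of_shareEdge hw hs hwt (Finset.ne_of_mem_erase hj).symm hab
        (hpair j hj0).2 hsh)
    -- Only the partner `b` of `a` survives among the pairings. No third word shares an edge with
    -- `a` or `b`, so the mixed moment factorizes in the same way.
    rw [defect, hone, huniv, sub_eq_zero, splitMoment]
    simp_rw [← Finset.prod_mul_prod_compl {a, b} fun i => TBar ξ P (w i) _]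
    refine h.integral_mul_of_disjoint (A := {e | e ∈ edgeSet (w a) ∨ e ∈ edgeSet (w b)})
      (B := {e | e ∈ edgeSet (w a) ∨ e ∈ edgeSet (w b)}ᶜ) disjoint_compl_right
      (Finset.measurable_fun_prod _ fun i hi => measurable_TBar fun e he => ?_)
      (Finset.measurable_fun_prod _ fun i hi => measurable_TBar fun e he => ?_)
    · rw [Finset.mem_insert, Finset.mem_singleton] at hi
      rcases hi with rfl | rfl
      · exact Or.inl he
      · exact Or.inr he
    · rw [Finset.mem_compl, Finset.mem_insert, Finset.mem_singleton, not_or] at hi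
      have he' := mem_edgeSet.1 he
      rintro (hea | heb)
      · exact hi.2 (hl.eq_of_shareEdge hw hs hwt (Ne.symm hi.1) hab
          ⟨e, mem_edgeSet.1 hea, he'⟩ hsh)
      · exact hi.1 (hl.eq_of_shareEdge hw hs hwt (Ne.symm hi.2) hab.symm
          ⟨e, mem_edgeSet.1 heb, he'⟩ hsh.symm)
  · rw [defect, huniv, h.integral_prod_TBar_eq_zero w hl, zero_sub, neg_eq_zero]
    exact Finset.sum_eq_zero fun j _ => by_contra fun hj => hl (hpair j hj).1

/-- Multilinearity expands the defect over tuples of free words: those of maximal weight have no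
defect, and the others are negligible. -/
lemma tendsto_defect_freePart (h : IsWignerEnsemble ξ P) (a : ι) (κ : ι → ℕ) :
    Tendsto (fun n : ℕ => defect P a fun i => freePart ξ P (n + 1) (κ i)) atTop (nhds 0) := by
  classical
  have hne : Nonempty ι := ⟨a⟩
  obtain ⟨M, hM0, hM⟩ := exists_abs_defect_TBar_le (ι := ι) h a (∑ i, κ i + 1)
  let G : (ι → Word) → ℝ := fun w =>
    if ∀ i, NoSelfEdge (w i) then defect P a fun i => TBar ξ P (w i) else 0
  refine (tendsto_sum_tuples_zero κ M G (fun w hw => ?_) fun w hw hG => ?_).congr fun n => ?_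
  · simp only [G]
    split_ifs
    · refine hM w fun i => ?_
      rw [(hw i).2]
      have := Finset.single_le_sum (f := κ) (fun i _ => Nat.zero_le _) (Finset.mem_univ i)
      omega
    · simpa using hM0
  · simp only [G] at hG
    split_ifs at hG with hs
    · by_contra hlt
      refine hG (defect_TBar_eq_zero h a (fun i => (hw i).1) hs ?_)
      have : ∑ i, ((w i).length - 1) = ∑ i, κ i :=
        Finset.sum_congr rfl fun i _ => by rw [(hw i).2, Nat.add_sub_cancel]
      omega
    · exact absurd rfl hG
  · have h1 : (fun i => freePart ξ P (n + 1) (κ i)) = fun i ω =>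
        ∑ w ∈ freeWords (n + 1) (κ i), scale (n + 1) (κ i) * TBar ξ P w ω := by
      funext i ω
      rw [freePart, Finset.mul_sum]
    rw [h1, defect_sum P a (fun i => freeWords (n + 1) (κ i)) (fun i _ => scale (n + 1) (κ i))
      fun _ w => h.hasMoments_TBar w, ← Finset.mul_sum]
    congr 1
    simp only [G]
    rw [← Finset.sum_filter]
    refine Finset.sum_congr ?_ fun _ _ => rfl
    ext w
    simp only [Finset.mem_filter, Fintype.mem_piFinset, freeWords]
    exact forall_and.symm

end WordDefect

/-! ### Moments of linear combinations -/

section Moments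

variable {Ω : Type*} [MeasurableSpace Ω] {P : Measure Ω} [IsProbabilityMeasure P]
  {ξ : Sym2 ℕ+ → Ω → ℝ}

/-- A linear combination of the parts without self-edges. -/
noncomputable def freeComb (ξ : Sym2 ℕ+ → Ω → ℝ) (P : Measure Ω) (K : Finset ℕ) (c : ℕ → ℝ)
    (N : ℕ) (ω : Ω) : ℝ :=
  ∑ k ∈ K, c k * freePart ξ P N k ω

lemma hasMoments_freeComb (h : IsWignerEnsemble ξ P) (K : Finset ℕ) (c : ℕ → ℝ) (N : ℕ) :
    HasMoments (freeComb ξ P K c N) P :=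
  hasMoments_sum _ fun k _ => (hasMoments_freePart h N k).const_mul _

lemma integral_freeComb (h : IsWignerEnsemble ξ P) (K : Finset ℕ) (c : ℕ → ℝ) (N : ℕ) :
    ∫ ω, freeComb ξ P K c N ω ∂P = 0 := by
  simp only [freeComb]
  rw [integral_finsetSum _ fun k _ => ((hasMoments_freePart h N k).const_mul _).integrable]
  refine Finset.sum_eq_zero fun k _ => ?_
  simp only [freePart]
  rw [integral_const_mul, integral_const_mul,
    integral_finsetSum _ fun w _ => (h.hasMoments_TBar w).integrable,
    Finset.sum_eq_zero fun w _ => h.integral_TBar w, mul_zero, mul_zero]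

lemma tendsto_integral_sq_freeComb (h : IsWignerEnsemble ξ P) (K : Finset ℕ) (c : ℕ → ℝ) :
    Tendsto (fun n : ℕ => ∫ ω, freeComb ξ P K c (n + 1) ω ^ 2 ∂P) atTop
      (nhds (∑ k ∈ K, ∑ l ∈ K, c k * c l * covA ξ P k l)) := by
  have h1 : Tendsto (fun n : ℕ => ∑ k ∈ K, ∑ l ∈ K, c k * c l *
      ∫ ω, freePart ξ P (n + 1) k ω * freePart ξ P (n + 1) l ω ∂P) atTop
      (nhds (∑ k ∈ K, ∑ l ∈ K, c k * c l * covA ξ P k l)) :=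
    tendsto_finsetSum _ fun k _ => tendsto_finsetSum _ fun l _ =>
      (tendsto_integral_freePart_mul_freePart h k l).const_mul _
  refine h1.congr fun n => ?_
  have hint : ∀ k l, HasMoments (fun ω => c k * c l *
      (freePart ξ P (n + 1) k ω * freePart ξ P (n + 1) l ω)) P := fun k l =>
    ((hasMoments_freePart h _ k).mul (hasMoments_freePart h _ l)).const_mul _
  have h2 : ∀ ω, freeComb ξ P K c (n + 1) ω ^ 2 = ∑ k ∈ K, ∑ l ∈ K, c k * c l *
      (freePart ξ P (n + 1) k ω * freePart ξ P (n + 1) l ω) := by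
    intro ω
    rw [freeComb, sq, Finset.sum_mul_sum]
    exact Finset.sum_congr rfl fun k _ => Finset.sum_congr rfl fun l _ => by ring
  simp_rw [h2]
  rw [integral_finsetSum _ fun k _ => (hasMoments_sum _ fun l _ => hint k l).integrable]
  refine Finset.sum_congr rfl fun k _ => ?_
  rw [integral_finsetSum _ fun l _ => (hint k l).integrable]
  exact Finset.sum_congr rfl fun l _ => (integral_const_mul _ _).symm

/-- The defect is expanded for `m + 2` copies of one combination: pairing the index `0` with each of
the `m + 1` others gives the same product, as in Gaussian integration by parts. -/
lemma tendsto_moment_recursion (h : IsWignerEnsemble ξ P) (K : Finset ℕ) (c : ℕ → ℝ) (m : ℕ) :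
    Tendsto (fun n : ℕ => ∫ ω, freeComb ξ P K c (n + 1) ω ^ (m + 2) ∂P -
      (m + 1) * ((∫ ω, freeComb ξ P K c (n + 1) ω ^ 2 ∂P) *
        ∫ ω, freeComb ξ P K c (n + 1) ω ^ m ∂P)) atTop (nhds 0) := by
  have h1 : Tendsto (fun n : ℕ => ∑ κ ∈ Fintype.piFinset fun _ : Fin (m + 2) => K,
      (∏ i, c (κ i)) * defect P 0 fun i => freePart ξ P (n + 1) (κ i)) atTop
      (nhds (∑ κ ∈ Fintype.piFinset fun _ : Fin (m + 2) => K, (∏ i, c (κ i)) * 0)) :=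
    tendsto_finsetSum _ fun κ _ => (tendsto_defect_freePart h 0 κ).const_mul _
  simp only [mul_zero, Finset.sum_const_zero] at h1
  refine h1.congr fun n => ?_
  rw [← defect_sum P (0 : Fin (m + 2)) (fun _ => K) (fun _ => c) fun _ k => hasMoments_freePart h (n + 1) k]
  change defect P (0 : Fin (m + 2)) (fun _ => freeComb ξ P K c (n + 1)) = _
  have h2 : ∀ j ∈ Finset.univ.erase (0 : Fin (m + 2)),
      splitMoment P {0, j} (fun _ => freeComb ξ P K c (n + 1)) =
        (∫ ω, freeComb ξ P K c (n + 1) ω ^ 2 ∂P) * ∫ ω, freeComb ξ P K c (n + 1) ω ^ m ∂P := by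
    intro j hj
    have hc := Finset.card_pair (Finset.ne_of_mem_erase hj).symm
    simp only [splitMoment, Finset.prod_const, Finset.card_compl, hc, Fintype.card_fin,
      Nat.add_sub_cancel]
  rw [defect, Finset.sum_congr rfl h2]
  simp [splitMoment]

/-- The moments of a centred Gaussian variable of variance `v`. -/
def gaussMoment (v : ℝ) : ℕ → ℝ
  | 0 => 1
  | 1 => 0
  | m + 2 => (m + 1) * (v * gaussMoment v m)

theorem tendsto_moment_freeComb (h : IsWignerEnsemble ξ P) (K : Finset ℕ) (c : ℕ → ℝ) (m : ℕ) :
    Tendsto (fun n : ℕ => ∫ ω, freeComb ξ P K c (n + 1) ω ^ m ∂P) atTop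
      (nhds (gaussMoment (∑ k ∈ K, ∑ l ∈ K, c k * c l * covA ξ P k l) m)) := by
  induction m using Nat.twoStepInduction with
  | zero => simp [gaussMoment]
  | one => simp [gaussMoment, integral_freeComb h]
  | more m ih _ =>
    have h1 := (tendsto_moment_recursion h K c m).add
      (((tendsto_integral_sq_freeComb h K c).mul ih).const_mul (m + 1 : ℝ))
    simpa [gaussMoment] using h1

end Moments

/-! ### From moments to characteristic functions -/

/-- Induction on `n`: the derivative of one Taylor remainder is `I` times the preceding one, and the
mean value inequality integrates the bound. -/
lemma norm_exp_mul_I_sub_sum_le_of_nonneg (n : ℕ) {x : ℝ} (hx : 0 ≤ x) :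
    ‖Complex.exp (x * Complex.I) - ∑ j ∈ Finset.range n, (x * Complex.I) ^ j / (j.factorial : ℂ)‖ ≤
      x ^ n / n.factorial := by
  induction n generalizing x with
  | zero => simp [Complex.norm_exp_ofReal_mul_I]
  | succ n ih =>
    let g : ℕ → ℝ → ℂ := fun n x =>
      Complex.exp (x * Complex.I) - ∑ j ∈ Finset.range n, (x * Complex.I) ^ j / (j.factorial : ℂ)
    have hlin : ∀ y : ℝ, HasDerivAt (fun y : ℝ => (y : ℂ) * Complex.I) Complex.I y := fun y => by
      simpa using (Complex.ofRealCLM.hasDerivAt (x := y)).mul_const Complex.I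
    have hderiv : ∀ y, HasDerivAt (g (n + 1)) (Complex.I * g n y) y := by
      intro y
      have h1 := (hlin y).cexp
      have h2 : HasDerivAt (fun y : ℝ => ∑ j ∈ Finset.range n,
          ((y : ℂ) * Complex.I) ^ (j + 1) / ((j + 1).factorial : ℂ))
          (∑ j ∈ Finset.range n, ((j + 1 : ℕ) * ((y : ℂ) * Complex.I) ^ j * Complex.I) /
            ((j + 1).factorial : ℂ)) y :=
        HasDerivAt.fun_sum fun j _ => by simpa using ((hlin y).pow (j + 1)).div_const _
      have h3 : g (n + 1) = fun z : ℝ => Complex.exp (z * Complex.I) -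
          (∑ j ∈ Finset.range n, ((z : ℂ) * Complex.I) ^ (j + 1) / ((j + 1).factorial : ℂ) + 1) := by
        funext z
        simp [g, Finset.sum_range_succ']
      have h4 : Complex.I * g n y = Complex.exp (y * Complex.I) * Complex.I -
          ∑ j ∈ Finset.range n, ((j + 1 : ℕ) * ((y : ℂ) * Complex.I) ^ j * Complex.I) /
            ((j + 1).factorial : ℂ) := by
        simp only [g]
        rw [mul_sub, mul_comm, Finset.mul_sum]
        congr 1
        refine Finset.sum_congr rfl fun j _ => ?_
        rw [Nat.factorial_succ]
        push_cast
        have : (j : ℂ) + 1 ≠ 0 := by exact_mod_cast Nat.succ_ne_zero j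
        have : (j.factorial : ℂ) ≠ 0 := by exact_mod_cast j.factorial_ne_zero
        field_simp
      rw [h3, h4]
      exact h1.sub (h2.add_const 1)
    have hB : ∀ y : ℝ, HasDerivAt (fun y : ℝ => y ^ (n + 1) / (n + 1).factorial)
        (y ^ n / n.factorial) y := by
      intro y
      have h1 : y ^ n / n.factorial = (n + 1 : ℕ) * y ^ n / ((n + 1).factorial : ℝ) := by
        rw [Nat.factorial_succ]
        push_cast
        have : (n : ℝ) + 1 ≠ 0 := by positivity
        field_simp
      rw [h1]
      simpa using (hasDerivAt_pow (n + 1) y).div_const ((n + 1).factorial : ℝ)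
    refine image_norm_le_of_norm_deriv_right_le_deriv_boundary (f := g (n + 1)) (a := 0) (b := x)
      (fun y _ => (hderiv y).continuousAt.continuousWithinAt)
      (fun y _ => (hderiv y).hasDerivWithinAt) ?_ hB (fun y hy => ?_) ⟨hx, le_rfl⟩
    · simp [g, Finset.sum_range_succ']
    · rw [norm_mul, Complex.norm_I, one_mul]
      exact ih hy.1

lemma norm_exp_mul_I_sub_sum_le (n : ℕ) (x : ℝ) :
    ‖Complex.exp (x * Complex.I) - ∑ j ∈ Finset.range n, (x * Complex.I) ^ j / (j.factorial : ℂ)‖ ≤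
      |x| ^ n / n.factorial := by
  rcases le_total 0 x with hx | hx
  · rw [abs_of_nonneg hx]
    exact norm_exp_mul_I_sub_sum_le_of_nonneg n hx
  · rw [abs_of_nonpos hx, ← Complex.norm_conj]
    convert norm_exp_mul_I_sub_sum_le_of_nonneg n (neg_nonneg.2 hx) using 2
    simp [← Complex.exp_conj, map_sum]

/-! ### Gaussian moments and the exponential series -/

lemma gaussMoment_two_mul_div (v : ℝ) (m : ℕ) :
    gaussMoment v (2 * m) / (2 * m).factorial = (v / 2) ^ m / m.factorial := by
  induction m with
  | zero => simp [gaussMoment]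
  | succ m ih =>
    have h1 : gaussMoment v (2 * (m + 1)) = (2 * m + 1) * (v * gaussMoment v (2 * m)) := by
      rw [show 2 * (m + 1) = 2 * m + 2 by ring, gaussMoment]
      push_cast
      ring
    have h2 : (((2 * (m + 1)).factorial : ℕ) : ℝ) =
        (2 * (m + 1)) * ((2 * m + 1) * (2 * m).factorial) := by
      rw [show 2 * (m + 1) = 2 * m + 1 + 1 by ring, Nat.factorial_succ, Nat.factorial_succ]
      push_cast
      ring
    have h3 : ((2 * m).factorial : ℝ) ≠ 0 := by exact_mod_cast Nat.factorial_ne_zero _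
    have h4 : (m.factorial : ℝ) ≠ 0 := by exact_mod_cast Nat.factorial_ne_zero _
    rw [div_eq_div_iff h3 h4] at ih
    rw [h1, h2, Nat.factorial_succ]
    push_cast
    have h5 : (m : ℝ) + 1 ≠ 0 := by positivity
    have h6 : 2 * (m : ℝ) + 1 ≠ 0 := by positivity
    rw [div_eq_div_iff (by positivity) (by positivity)]
    linear_combination v * (2 * m + 1) * (m + 1) * ih

lemma gaussMoment_two_mul_add_one (v : ℝ) (m : ℕ) : gaussMoment v (2 * m + 1) = 0 := by
  induction m with
  | zero => simp [gaussMoment]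
  | succ m ih =>
    rw [show 2 * (m + 1) + 1 = 2 * m + 1 + 2 by ring, gaussMoment, ih, mul_zero, mul_zero]

lemma sum_gaussMoment (v : ℝ) (m : ℕ) :
    ∑ j ∈ Finset.range (2 * m), Complex.I ^ j / (j.factorial : ℂ) * (gaussMoment v j : ℂ) =
      ∑ r ∈ Finset.range m, (-(v : ℂ) / 2) ^ r / (r.factorial : ℂ) := by
  induction m with
  | zero => simp
  | succ m ih =>
    rw [show 2 * (m + 1) = 2 * m + 1 + 1 by ring, Finset.sum_range_succ, Finset.sum_range_succ, ih,
      gaussMoment_two_mul_add_one, Finset.sum_range_succ]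
    have h1 : (gaussMoment v (2 * m) : ℂ) / ((2 * m).factorial : ℂ) =
        ((v : ℂ) / 2) ^ m / (m.factorial : ℂ) := by
      exact_mod_cast congrArg (Complex.ofReal) (gaussMoment_two_mul_div v m)
    rw [Complex.ofReal_zero, mul_zero, add_zero, div_mul_eq_mul_div, mul_div_assoc, h1, pow_mul,
      Complex.I_sq, neg_div, neg_pow ((v : ℂ) / 2) m, mul_div_assoc]

section MomentMethod

variable {Ω : Type*} [MeasurableSpace Ω] {P : Measure Ω} [IsProbabilityMeasure P]

/-- The Taylor bound integrated. The even order expresses the error by a moment, without absolute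
values. -/
lemma norm_integral_exp_sub_sum_le {X : Ω → ℝ} (hX : HasMoments X P) (m : ℕ) :
    ‖∫ ω, Complex.exp (X ω * Complex.I) ∂P - ∑ j ∈ Finset.range (2 * m),
      Complex.I ^ j / (j.factorial : ℂ) * ((∫ ω, X ω ^ j ∂P : ℝ) : ℂ)‖ ≤
      (∫ ω, X ω ^ (2 * m) ∂P) / (2 * m).factorial := by
  have hmeas : AEStronglyMeasurable X P := hX.integrable.aestronglyMeasurable
  have hexp : Integrable (fun ω => Complex.exp (X ω * Complex.I)) P := by
    refine Integrable.of_bound (C := 1) ?_ (Eventually.of_forall fun ω => ?_)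
    · exact (by fun_prop : Continuous fun x : ℝ => Complex.exp (x * Complex.I)).comp_aestronglyMeasurable
        hmeas
    · rw [Complex.norm_exp_ofReal_mul_I]
  have hpow : ∀ j, Integrable (fun ω => (X ω * Complex.I) ^ j / (j.factorial : ℂ)) P := by
    intro j
    have := ((hX.pow j).integrable.ofReal (𝕜 := ℂ)).mul_const (Complex.I ^ j / (j.factorial : ℂ))
    refine this.congr (Eventually.of_forall fun ω => ?_)
    simp only [Complex.coe_algebraMap, RCLike.ofReal_pow, mul_pow]
    simp [mul_div_assoc]
  have hj : ∀ j, Complex.I ^ j / (j.factorial : ℂ) * ((∫ ω, X ω ^ j ∂P : ℝ) : ℂ) =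
      ∫ ω, (X ω * Complex.I) ^ j / (j.factorial : ℂ) ∂P := by
    intro j
    rw [← integral_complex_ofReal, ← integral_const_mul]
    congr 1 with ω
    push_cast
    ring
  simp_rw [hj]
  rw [← integral_finsetSum _ fun j _ => hpow j, ← integral_sub hexp (integrable_finsetSum _ fun j _ => hpow j),
    ← integral_div]
  refine norm_integral_le_of_norm_le ((hX.pow _).integrable.div_const _)
    (Eventually.of_forall fun ω => ?_)
  have := norm_exp_mul_I_sub_sum_le (2 * m) (X ω)
  rwa [pow_mul, sq_abs, ← pow_mul] at this

/-- If all moments converge to Gaussian moments then the characteristic function at `1` converges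
to the Gaussian one. -/
theorem tendsto_integral_exp_of_moments {X : ℕ → Ω → ℝ} (hX : ∀ n, HasMoments (X n) P) (v : ℝ)
    (hlim : ∀ m, Tendsto (fun n => ∫ ω, X n ω ^ m ∂P) atTop (nhds (gaussMoment v m))) :
    Tendsto (fun n => ∫ ω, Complex.exp (X n ω * Complex.I) ∂P) atTop
      (nhds (Complex.exp (-(v : ℂ) / 2))) := by
  rw [Metric.tendsto_atTop']
  intro ε hε
  have hS : Tendsto (fun m => ∑ r ∈ Finset.range m, (-(v : ℂ) / 2) ^ r / (r.factorial : ℂ)) atTop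
      (nhds (Complex.exp (-(v : ℂ) / 2))) := by
    rw [Complex.exp_eq_exp_ℂ]
    exact (NormedSpace.expSeries_div_hasSum_exp (-(v : ℂ) / 2)).tendsto_sum_nat
  have hb : Tendsto (fun m : ℕ => (v / 2) ^ m / (m.factorial : ℝ)) atTop (nhds 0) :=
    FloorSemiring.tendsto_pow_div_factorial_atTop _
  -- The truncation order is fixed before `n` grows. The tail of the exponential series and the
  -- limiting Taylor error are both below `ε / 4`; the moments of order at most `2 * m` then do the
  -- rest.
  obtain ⟨m, hm1, hm2⟩ := ((hS.eventually (Metric.ball_mem_nhds _ (half_pos (half_pos hε)))).and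
    (hb.eventually (gt_mem_nhds (half_pos (half_pos hε))))).exists
  have h1 : Tendsto (fun n => ∑ j ∈ Finset.range (2 * m),
      Complex.I ^ j / (j.factorial : ℂ) * ((∫ ω, X n ω ^ j ∂P : ℝ) : ℂ)) atTop
      (nhds (∑ r ∈ Finset.range m, (-(v : ℂ) / 2) ^ r / (r.factorial : ℂ))) := by
    rw [← sum_gaussMoment]
    exact tendsto_finsetSum _ fun j _ =>
      ((Complex.continuous_ofReal.tendsto _).comp (hlim j)).const_mul _
  have h2 : Tendsto (fun n => (∫ ω, X n ω ^ (2 * m) ∂P) / (2 * m).factorial) atTop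
      (nhds ((v / 2) ^ m / (m.factorial : ℝ))) := by
    rw [← gaussMoment_two_mul_div]
    exact (hlim (2 * m)).div_const _
  have hev := ((h1.eventually (Metric.ball_mem_nhds _ (half_pos (half_pos hε)))).and
    (h2.eventually (gt_mem_nhds hm2)))
  obtain ⟨N, hN⟩ := eventually_atTop.1 hev
  refine ⟨N, fun n hn => ?_⟩
  obtain ⟨h3, h4⟩ := hN n hn.le
  have h5 := norm_integral_exp_sub_sum_le (hX n) m
  rw [← dist_eq_norm] at h5
  have hm1' : dist (∑ r ∈ Finset.range m, (-(v : ℂ) / 2) ^ r / (r.factorial : ℂ))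
    (Complex.exp (-(v : ℂ) / 2)) < ε / 2 / 2 := hm1
  have h6 := dist_triangle4 (∫ ω, Complex.exp (X n ω * Complex.I) ∂P)
    (∑ j ∈ Finset.range (2 * m), Complex.I ^ j / (j.factorial : ℂ) * ((∫ ω, X n ω ^ j ∂P : ℝ) : ℂ))
    (∑ r ∈ Finset.range m, (-(v : ℂ) / 2) ^ r / (r.factorial : ℂ)) (Complex.exp (-(v : ℂ) / 2))
  linarith

end MomentMethod

/-! ### Triangular factorization of positive semidefinite kernels -/

open InnerProductSpace in
/-- The Gram matrix of a sequence of vectors has a triangular factorization. -/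
lemma exists_triangular_of_inner {E : Type*} [NormedAddCommGroup E] [InnerProductSpace ℝ E]
    (v : ℕ → E) : ∃ c : ℕ → ℕ → ℝ, (∀ k j, k < j → c k j = 0) ∧
      ∀ k l, inner ℝ (v k) (v l) = ∑ j ∈ Finset.range (k + 1), c k j * c l j := by
  set e := gramSchmidtNormed ℝ v with he
  have horth : ∀ i j, i ≠ j → inner ℝ (e i) (e j) = 0 := by
    intro i j hij
    simp [he, gramSchmidtNormed, inner_smul_left, inner_smul_right,
      gramSchmidt_orthogonal ℝ v hij]
  -- If the vectors are linearly dependent some `e i` vanish, and this identity replaces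
  -- normalization.
  have hself : ∀ i, inner ℝ (e i) (e i) • e i = e i := by
    intro i
    by_cases h0 : e i = 0
    · simp [h0]
    · rw [real_inner_self_eq_norm_sq, gramSchmidtNormed_unit_length' h0]
      simp
  have hexp : ∀ k, v k = ∑ j ∈ Finset.range (k + 1), inner ℝ (e j) (v k) • e j := by
    intro k
    have hmem : v k ∈ Submodule.span ℝ (e '' Set.Iic k) := by
      rw [he, span_gramSchmidtNormed, span_gramSchmidt_Iic]
      exact Submodule.subset_span ⟨k, Set.mem_Iic.2 le_rfl, rfl⟩
    refine Submodule.span_induction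
      (p := fun x _ => x = ∑ j ∈ Finset.range (k + 1), inner ℝ (e j) x • e j) ?_ ?_ ?_ ?_ hmem
    · rintro _ ⟨i, hi, rfl⟩
      rw [Finset.sum_eq_single_of_mem i (Finset.mem_range.2 (Nat.lt_succ_of_le hi))
        fun j _ hj => by rw [horth j i hj, zero_smul], hself]
    · simp
    · intro x y _ _ hx hy
      simp only [inner_add_right, add_smul, Finset.sum_add_distrib]
      rw [← hx, ← hy]
    · intro a x _ hx
      simp only [inner_smul_right, mul_smul]
      rw [← Finset.smul_sum, ← hx]
  refine ⟨fun k j => inner ℝ (e j) (v k), fun k j hkj => ?_, fun k l => ?_⟩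
  · dsimp only
    rw [hexp k, inner_sum]
    refine Finset.sum_eq_zero fun i hi => ?_
    rw [inner_smul_right, horth j i (by have := Finset.mem_range.1 hi; omega), mul_zero]
  · conv_lhs => rw [hexp k, sum_inner]
    exact Finset.sum_congr rfl fun j _ => real_inner_smul_left _ _ _

/-- A positive semidefinite kernel on `ℕ` has a triangular factorization. -/
lemma exists_triangular_factor (A : ℕ → ℕ → ℝ) (hsymm : ∀ k l, A k l = A l k)
    (hpos : ∀ (K : Finset ℕ) (c : ℕ → ℝ), 0 ≤ ∑ k ∈ K, ∑ l ∈ K, c k * c l * A k l) :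
    ∃ c : ℕ → ℕ → ℝ, (∀ k j, k < j → c k j = 0) ∧
      ∀ k l, A k l = ∑ j ∈ Finset.range (k + 1), c k j * c l j := by
  -- The reproducing kernel Hilbert space of `A` realizes `A` as a Gram matrix.
  let K : Matrix ℕ ℕ (ℝ →L[ℝ] ℝ) := Matrix.of fun k l => A k l • (1 : ℝ →L[ℝ] ℝ)
  have hK : K.PosSemidef := by
    have htfae := (RKHS.posSemidef_tfae (K := K)).out 0 2
    refine htfae.2 ⟨?_, fun c => ?_⟩
    · ext k l
      simp [K, Matrix.conjTranspose_apply, hsymm l k]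
    · refine (hpos c.support c).trans_eq ?_
      simp only [Finsupp.sum, K, RCLike.re_to_real]
      refine Finset.sum_congr rfl fun k _ => Finset.sum_congr rfl fun l _ => ?_
      simp [hsymm l k]
      ring
  have : Fact K.PosSemidef := ⟨hK⟩
  obtain ⟨c, hc0, hc⟩ := exists_triangular_of_inner fun k : ℕ =>
    RKHS.kerFun (RKHS.OfKernel K) k (1 : ℝ)
  refine ⟨c, hc0, fun k l => ?_⟩
  rw [← hc k l, ← RKHS.kernel_inner, RKHS.OfKernel.kernel_ofKernel, hsymm k l]
  simp [K]

/-! ### Construction of the limit -/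

section StandardGaussian

/-- The law of a sequence of independent standard Gaussian variables. -/
noncomputable abbrev stdGaussianSeq : Measure (ℕ → ℝ) := Measure.infinitePi fun _ => gaussianReal 0 1

lemma hasGaussianLaw_stdGaussianSeq_eval (j : ℕ) :
    HasGaussianLaw (fun x : ℕ → ℝ => x j) stdGaussianSeq :=
  ⟨by rw [Measure.infinitePi_map_eval]; infer_instance⟩

lemma iIndepFun_stdGaussianSeq : iIndepFun (fun (j : ℕ) (x : ℕ → ℝ) => x j) stdGaussianSeq :=
  iIndepFun_infinitePi (X := fun _ x => x) fun _ => measurable_id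

lemma isGaussianProcess_stdGaussianSeq :
    IsGaussianProcess (fun (j : ℕ) (x : ℕ → ℝ) => x j) stdGaussianSeq where
  hasGaussianLaw I := iIndepFun.hasGaussianLaw (X := fun (i : I) (x : ℕ → ℝ) => x i)
    (fun i => hasGaussianLaw_stdGaussianSeq_eval i)
    (iIndepFun_stdGaussianSeq.precomp Subtype.val_injective)

lemma integral_stdGaussianSeq_eval (j : ℕ) : ∫ x, x j ∂stdGaussianSeq = 0 := by
  have h := integral_id_gaussianReal (μ := 0) (v := 1)
  rw [← Measure.infinitePi_map_eval (fun _ : ℕ => gaussianReal 0 1) j,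
    integral_map (measurable_pi_apply j).aemeasurable (by fun_prop)] at h
  exact h

lemma integral_stdGaussianSeq_eval_sq (j : ℕ) : ∫ x, x j ^ 2 ∂stdGaussianSeq = 1 := by
  have h := variance_fun_id_gaussianReal (μ := 0) (v := 1)
  rw [variance_of_integral_eq_zero (by fun_prop) integral_id_gaussianReal,
    ← Measure.infinitePi_map_eval (fun _ : ℕ => gaussianReal 0 1) j,
    integral_map (measurable_pi_apply j).aemeasurable (by fun_prop)] at h
  simpa using h

lemma integral_stdGaussianSeq_eval_mul (i j : ℕ) :
    ∫ x, x i * x j ∂stdGaussianSeq = if i = j then 1 else 0 := by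
  split_ifs with h
  · subst h
    simp_rw [← sq]
    exact integral_stdGaussianSeq_eval_sq i
  · rw [(iIndepFun_stdGaussianSeq.indepFun h).integral_fun_mul_eq_mul_integral
      (measurable_pi_apply i).aestronglyMeasurable (measurable_pi_apply j).aestronglyMeasurable,
      integral_stdGaussianSeq_eval, zero_mul]

end StandardGaussian

section Existence

variable {Ω : Type*} [MeasurableSpace Ω] {P : Measure Ω} [IsProbabilityMeasure P]
  {ξ : Sym2 ℕ+ → Ω → ℝ}

/-- Symmetry here, and positivity in `covA_nonneg`, are inherited from the covariances of which
`covA` is the limit. -/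
lemma covA_comm (h : IsWignerEnsemble ξ P) (k l : ℕ) : covA ξ P k l = covA ξ P l k := by
  refine tendsto_nhds_unique (tendsto_integral_freePart_mul_freePart h k l) ?_
  simpa only [mul_comm] using tendsto_integral_freePart_mul_freePart h l k

lemma covA_nonneg (h : IsWignerEnsemble ξ P) (K : Finset ℕ) (c : ℕ → ℝ) :
    0 ≤ ∑ k ∈ K, ∑ l ∈ K, c k * c l * covA ξ P k l :=
  ge_of_tendsto' (tendsto_integral_sq_freeComb h K c) fun _ => integral_nonneg fun _ => sq_nonneg _

/-- Thanks to the triangular factor, each `η k` is a finite combination of independent standard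
Gaussians, so no series has to converge; `ζ` is the other coordinate of a product space. -/
theorem exists_isLimitFamily (h : IsWignerEnsemble ξ P) :
    ∃ (Ω' : Type) (_ : MeasurableSpace Ω') (P' : Measure Ω') (_ : IsProbabilityMeasure P')
      (ζ : Ω' → ℝ) (η : ℕ → Ω' → ℝ), IsLimitFamily ξ P P' ζ η := by
  obtain ⟨c, hc0, hc⟩ := exists_triangular_factor (covA ξ P) (covA_comm h) (covA_nonneg h)
  have hm := h.measurable s(1, 1)
  have hprob : IsProbabilityMeasure (P.map (ξ s(1, 1))) := Measure.isProbabilityMeasure_map hm.aemeasurable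
  let η : ℕ → (ℕ → ℝ) → ℝ := fun k x => ∑ j ∈ Finset.range (k + 1), c k j * x j
  have hη : ∀ k, Measurable (η k) := fun k => by fun_prop
  have hgauss : IsGaussianProcess (fun (k : {k : ℕ // 2 ≤ k}) => η k) stdGaussianSeq := by
    refine isGaussianProcess_stdGaussianSeq.of_isGaussianProcess fun k =>
      ⟨Finset.range (k + 1), ∑ j : Finset.range (k + 1), c k j • ContinuousLinearMap.proj j, fun x => ?_⟩
    simp only [η, sum_apply, smul_apply,
      ContinuousLinearMap.proj_apply, Finset.restrict, smul_eq_mul]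
    exact (Finset.sum_coe_sort (Finset.range (k + 1)) fun j => c k j * x j).symm
  have hsnd : MeasurePreserving (Prod.snd : ℝ × (ℕ → ℝ) → ℕ → ℝ)
      ((P.map (ξ s(1, 1))).prod stdGaussianSeq) stdGaussianSeq := measurePreserving_snd
  refine ⟨ℝ × (ℕ → ℝ), inferInstance, (P.map (ξ s(1, 1))).prod stdGaussianSeq, inferInstance,
    Prod.fst, fun k z => η k z.2, ⟨⟨fun I => ⟨?_⟩⟩, fun k _ => ?_, fun k l _ _ => ?_, ?_, ?_⟩⟩
  · have h1 := (hgauss.hasGaussianLaw I).isGaussian_map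
    rw [← hsnd.map_eq, Measure.map_map (by fun_prop) measurable_snd] at h1
    exact h1
  · rw [integral_fun_snd]
    simp only [η]
    rw [integral_finsetSum _ fun j _ =>
      ((hasGaussianLaw_stdGaussianSeq_eval j).integrable).const_mul _]
    simp [integral_const_mul, integral_stdGaussianSeq_eval]
  · rw [integral_fun_snd (fun x => η k x * η l x)]
    have hint : ∀ i j, Integrable (fun x : ℕ → ℝ => c k i * c l j * (x i * x j)) stdGaussianSeq :=
      fun i j => ((hasGaussianLaw_stdGaussianSeq_eval i).memLp_two.integrable_mul
        (hasGaussianLaw_stdGaussianSeq_eval j).memLp_two).const_mul _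
    have h1 : ∀ x, η k x * η l x = ∑ i ∈ Finset.range (k + 1), ∑ j ∈ Finset.range (l + 1),
        c k i * c l j * (x i * x j) := by
      intro x
      simp only [η]
      rw [Finset.sum_mul_sum]
      exact Finset.sum_congr rfl fun i _ => Finset.sum_congr rfl fun j _ => by ring
    simp_rw [h1]
    rw [integral_finsetSum _ fun i _ => integrable_finsetSum _ fun j _ => hint i j, hc k l]
    simp only [probReal_univ, one_smul]
    refine Finset.sum_congr rfl fun i _ => ?_
    rw [integral_finsetSum _ fun j _ => hint i j]
    simp_rw [integral_const_mul, integral_stdGaussianSeq_eval_mul, mul_ite, mul_one, mul_zero]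
    rw [Finset.sum_ite_eq]
    -- An index `i > l` lies outside the second sum, but there `c l i = 0` by triangularity.
    split_ifs with hi
    · rfl
    · rw [hc0 l i (by rw [Finset.mem_range] at hi; omega), mul_zero]
  · exact ⟨measurable_fst.aemeasurable, hm.aemeasurable, measurePreserving_fst.map_eq⟩
  · exact indepFun_prod (X := fun x : ℝ => x)
      (Y := fun (x : ℕ → ℝ) (k : {k : ℕ // 2 ≤ k}) => η k x) measurable_id (by fun_prop)

end Existence

/-! ### The constants `a_k` -/

/-- The weight relation forces `k + 1` to be even. -/
lemma aConst_of_even {k : ℕ} (hk : Even k) : aConst k = 0 := by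
  have he : IsEmpty (OneLoopWords k) := ⟨fun x => by
    obtain ⟨hx, hlen⟩ := x.isOneLoop
    have hwt := hx.weight
    obtain ⟨t, rfl⟩ := hk
    omega⟩
  have : IsEmpty (Quotient (oneLoopSetoid k)) := ⟨fun q => he.elim q.out⟩
  simp [aConst]

lemma eq_of_isClosedFromOne_of_length_eq_two {w : Word} (hw : IsClosedFromOne w)
    (hlen : w.length = 2) : w = [1, 1] := by
  obtain ⟨a, b, rfl⟩ := List.length_eq_two.1 hlen
  obtain ⟨h1, h2⟩ := hw
  simp_all

lemma aConst_one : aConst 1 = 1 := by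
  have hword : IsOneLoop [1, 1] :=
    ⟨by simp [IsClosedFromOne], by simp [passages], by simp [edgeSet], by simp [wt, supp]⟩
  have : Unique (OneLoopWords 1) :=
    { default := ⟨[1, 1], (isOneLoop_iff _ _).2 ⟨hword, rfl⟩⟩
      uniq := fun x => Subtype.ext
        (eq_of_isClosedFromOne_of_length_eq_two x.isOneLoop.1.closed x.isOneLoop.2) }
  rw [aConst, Nat.card_eq_one_iff_unique]
  exact ⟨Quotient.mk_surjective.subsingleton, ⟨⟦default⟧⟩⟩

/-- The only closed word with one step from `1` is `[1, 1]`, a self-edge. -/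
lemma freePart_one {Ω : Type*} [MeasurableSpace Ω] (ξ : Sym2 ℕ+ → Ω → ℝ) (P : Measure Ω) (N : ℕ)
    (ω : Ω) : freePart ξ P N 1 ω = 0 := by
  rw [freePart, Finset.sum_eq_zero, mul_zero]
  intro w hw
  obtain ⟨h1, h2, h3, -⟩ := mem_freeWords.1 hw
  rw [eq_of_isClosedFromOne_of_length_eq_two h1 h3] at h2
  exact absurd (h2 s(1, 1) (by simp [edgeSet])) (by simp)

/-! ### Characteristic functions -/

section CharFun

variable {Ω : Type*} [MeasurableSpace Ω] {P : Measure Ω} [IsProbabilityMeasure P]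
  {ξ : Sym2 ℕ+ → Ω → ℝ}

lemma integrable_exp_mul_I {X : Ω → ℝ} (hX : AEStronglyMeasurable X P) :
    Integrable (fun ω => Complex.exp (X ω * Complex.I)) P := by
  refine Integrable.of_bound (C := 1) ?_ (Eventually.of_forall fun ω => ?_)
  · exact (by fun_prop : Continuous fun x : ℝ => Complex.exp (x * Complex.I)).comp_aestronglyMeasurable
      hX
  · rw [Complex.norm_exp_ofReal_mul_I]

lemma norm_exp_mul_I_sub_le (x y : ℝ) :
    ‖Complex.exp (x * Complex.I) - Complex.exp (y * Complex.I)‖ ≤ |x - y| := by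
  have h1 : Complex.exp (x * Complex.I) - Complex.exp (y * Complex.I) =
      Complex.exp (y * Complex.I) * (Complex.exp (Complex.I * (x - y : ℝ)) - 1) := by
    rw [mul_sub, ← Complex.exp_add]
    push_cast
    ring_nf
  rw [h1, norm_mul, Complex.norm_exp_ofReal_mul_I, one_mul]
  exact Real.norm_exp_I_mul_ofReal_sub_one_le

lemma norm_integral_exp_sub_le {X Y : Ω → ℝ} (hX : HasMoments X P) (hY : HasMoments Y P) :
    ‖∫ ω, Complex.exp (X ω * Complex.I) ∂P - ∫ ω, Complex.exp (Y ω * Complex.I) ∂P‖ ≤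
      ∫ ω, |X ω - Y ω| ∂P := by
  rw [← integral_sub (integrable_exp_mul_I hX.integrable.aestronglyMeasurable)
    (integrable_exp_mul_I hY.integrable.aestronglyMeasurable)]
  exact norm_integral_le_of_norm_le (hX.sub hY).abs.integrable
    (Eventually.of_forall fun ω => norm_exp_mul_I_sub_le _ _)

/-- Nonnegativity of the variance of `|X|`. -/
lemma sq_integral_abs_le {X : Ω → ℝ} (hX : HasMoments X P) :
    (∫ ω, |X ω| ∂P) ^ 2 ≤ ∫ ω, X ω ^ 2 ∂P := by
  have h1 := variance_nonneg (fun ω => |X ω|) P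
  rw [variance_eq_sub hX.abs.memLp_two] at h1
  simpa using h1

lemma tendsto_integral_abs_remainder (h : IsWignerEnsemble ξ P) (k : ℕ) :
    Tendsto (fun n : ℕ => ∫ ω, |remainder ξ P (n + 1) k ω| ∂P) atTop (nhds 0) := by
  have h1 := (Real.continuous_sqrt.tendsto _).comp (tendsto_integral_sq_remainder h k)
  rw [Real.sqrt_zero] at h1
  refine squeeze_zero (fun n => integral_nonneg fun ω => abs_nonneg _) (fun n => ?_) h1
  exact Real.le_sqrt_of_sq_le (sq_integral_abs_le (hasMoments_remainder h (n + 1) k))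

-- Free words use off-diagonal entries only; this gives the independence from `ξ₁₁`.
omit [IsProbabilityMeasure P] in
lemma measurable_freeComb (K : Finset ℕ) (c : ℕ → ℝ) (N : ℕ) :
    Measurable[sigmaEdges ξ {e | ¬ e.IsDiag}] (freeComb ξ P K c N) := by
  refine Finset.measurable_fun_sum _ fun k _ => Measurable.const_mul ?_ _
  refine Measurable.const_mul (Finset.measurable_fun_sum _ fun w hw => measurable_TBar ?_) _
  exact fun e he => (mem_freeWords.1 hw).2.1 e he

lemma integral_exp_add_freeComb (h : IsWignerEnsemble ξ P) (β : ℝ) (K : Finset ℕ) (c : ℕ → ℝ)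
    (N : ℕ) :
    ∫ ω, Complex.exp ((β * ξ s(1, 1) ω + freeComb ξ P K c N ω : ℝ) * Complex.I) ∂P =
      (∫ ω, Complex.exp ((β * ξ s(1, 1) ω : ℝ) * Complex.I) ∂P) *
        ∫ ω, Complex.exp (freeComb ξ P K c N ω * Complex.I) ∂P := by
  have hind := h.indepFun_of_disjoint (A := {s(1, 1)}) (B := {e | ¬ e.IsDiag}) (by simp)
    (measurable_sigmaEdges (Set.mem_singleton _)) (measurable_freeComb (P := P) K c N)
  rw [← hind.integral_fun_comp_mul_comp (f := fun x : ℝ => Complex.exp ((β * x : ℝ) * Complex.I))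
    (g := fun x : ℝ => Complex.exp (x * Complex.I)) (h.measurable _).aemeasurable
    (hasMoments_freeComb h K c N).integrable.aemeasurable
    (by fun_prop) (by fun_prop)]
  congr 1 with ω
  rw [← Complex.exp_add]
  push_cast
  ring_nf

/-- Convergence of the characteristic functions of the linear combinations of the `SBar`. -/
theorem tendsto_integral_exp_sum_SBar (h : IsWignerEnsemble ξ P) (K : Finset ℕ) (c : ℕ → ℝ) :
    Tendsto (fun n : ℕ => ∫ ω, Complex.exp ((∑ k ∈ K, c k * SBar ξ P (n + 1) k ω : ℝ) *
      Complex.I) ∂P) atTop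
      (nhds ((∫ ω, Complex.exp (((∑ k ∈ K, c k * aConst k) * ξ s(1, 1) ω : ℝ) * Complex.I) ∂P) *
        Complex.exp (-((∑ k ∈ K, ∑ l ∈ K, c k * c l * covA ξ P k l : ℝ) : ℂ) / 2))) := by
  have hfree := tendsto_integral_exp_of_moments (fun n => hasMoments_freeComb h K c (n + 1)) _
    (tendsto_moment_freeComb h K c)
  have hmain := hfree.const_mul
    (∫ ω, Complex.exp (((∑ k ∈ K, c k * aConst k) * ξ s(1, 1) ω : ℝ) * Complex.I) ∂P)
  simp_rw [← integral_exp_add_freeComb h] at hmain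
  have hrem : Tendsto (fun n : ℕ => ∑ k ∈ K, |c k| * ∫ ω, |remainder ξ P (n + 1) k ω| ∂P) atTop
      (nhds 0) := by
    simpa using tendsto_finsetSum K fun k _ => (tendsto_integral_abs_remainder h k).const_mul |c k|
  -- As `x ↦ exp (x * I)` is `1`-Lipschitz, dropping the remainders costs at most the sum of their
  -- weighted `L¹` norms.
  refine tendsto_of_tendsto_of_dist hmain (squeeze_zero (fun n => dist_nonneg) (fun n => ?_) hrem)
  have hS : HasMoments (fun ω => ∑ k ∈ K, c k * SBar ξ P (n + 1) k ω) P :=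
    hasMoments_sum _ fun k _ => (hasMoments_SBar h (n + 1) k).const_mul _
  have hY : HasMoments (fun ω => (∑ k ∈ K, c k * aConst k) * ξ s(1, 1) ω +
      freeComb ξ P K c (n + 1) ω) P :=
    ((h.hasMoments _).const_mul _).add (hasMoments_freeComb h K c (n + 1))
  rw [dist_comm, dist_eq_norm]
  refine (norm_integral_exp_sub_le hS hY).trans ?_
  have hint : ∀ k ∈ K, Integrable (fun ω => |c k| * |remainder ξ P (n + 1) k ω|) P := fun k _ =>
    ((hasMoments_remainder h (n + 1) k).abs.const_mul _).integrable
  simp_rw [← integral_const_mul]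
  rw [← integral_finsetSum _ hint]
  refine integral_mono (hS.sub hY).abs.integrable (integrable_finsetSum _ hint) fun ω => ?_
  have hdiff : ∑ k ∈ K, c k * SBar ξ P (n + 1) k ω - ((∑ k ∈ K, c k * aConst k) * ξ s(1, 1) ω +
      freeComb ξ P K c (n + 1) ω) = ∑ k ∈ K, c k * remainder ξ P (n + 1) k ω := by
    rw [freeComb, Finset.sum_mul, ← Finset.sum_add_distrib, ← Finset.sum_sub_distrib]
    refine Finset.sum_congr rfl fun k _ => ?_
    rw [remainder]
    ring
  dsimp only
  rw [hdiff]
  refine (Finset.abs_sum_le_sum_abs _ _).trans_eq ?_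
  simp_rw [abs_mul]

end CharFun

/-! ### The limit law -/

section Limit

variable {Ω : Type*} [MeasurableSpace Ω] {P : Measure Ω} [IsProbabilityMeasure P]
  {ξ : Sym2 ℕ+ → Ω → ℝ} {Ω' : Type*} [MeasurableSpace Ω'] {P' : Measure Ω'}
  [IsProbabilityMeasure P'] {ζ : Ω' → ℝ} {η : ℕ → Ω' → ℝ}

/-- The free part vanishes for `k = 1`, so the index `1` can stay in the covariance sums although
the family has no `η 1`. -/
lemma covA_one_left (h : IsWignerEnsemble ξ P) (l : ℕ) : covA ξ P 1 l = 0 := by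
  refine tendsto_nhds_unique (tendsto_integral_freePart_mul_freePart h 1 l) ?_
  simp [freePart_one]

-- The values `a_1 = 1`, and `a_k = 0` for even `k`, unite the three cases.
omit [MeasurableSpace Ω'] in
lemma limitEntry_eq (ζ : Ω' → ℝ) (η : ℕ → Ω' → ℝ) {k : ℕ} (hk : 1 ≤ k) (ω : Ω') :
    limitEntry ζ η k ω = aConst k * ζ ω + if 2 ≤ k then η k ω else 0 := by
  rw [limitEntry]
  by_cases h1 : k = 1
  · simp [h1, aConst_one]
  · rw [if_neg h1, if_pos (show 2 ≤ k by omega)]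
    split_ifs with he
    · simp [aConst_of_even he]
    · rfl

omit [IsProbabilityMeasure P] [IsProbabilityMeasure P'] in
lemma IsLimitFamily.aemeasurable_limitEntry (hL : IsLimitFamily ξ P P' ζ η) {k : ℕ} (hk : 1 ≤ k) :
    AEMeasurable (limitEntry ζ η k) P' := by
  rw [funext (limitEntry_eq ζ η hk)]
  refine (hL.law.aemeasurable_fst.const_mul _).add ?_
  by_cases h2 : 2 ≤ k
  · simpa only [if_pos h2] using hL.gaussian.aemeasurable ⟨k, h2⟩
  · simp only [if_neg h2]
    exact aemeasurable_const

-- A linear combination of a Gaussian process is Gaussian, and being centred its characteristic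
-- function at `1` depends on the variance alone.
omit [IsProbabilityMeasure P] [IsProbabilityMeasure P'] in
lemma IsLimitFamily.integral_exp_sum_eta (hL : IsLimitFamily ξ P P' ζ η)
    (J : Finset {k : ℕ // 2 ≤ k}) (c : ℕ → ℝ) :
    ∫ ω, Complex.exp ((∑ k ∈ J, c k * η k ω : ℝ) * Complex.I) ∂P' =
      Complex.exp (-((∑ k ∈ J, ∑ l ∈ J, c k * c l * covA ξ P k l : ℝ) : ℂ) / 2) := by
  set H : Ω' → ℝ := fun ω => ∑ k ∈ J, c k * η k ω with hH
  have hmem : ∀ k : {k : ℕ // 2 ≤ k}, MemLp (η k) 2 P' := fun k =>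
    (hL.gaussian.hasGaussianLaw_eval k).memLp_two
  have hint : ∀ k l : {k : ℕ // 2 ≤ k}, Integrable (fun ω => c k * c l * (η k ω * η l ω)) P' :=
    fun k l => ((hmem k).integrable_mul (hmem l)).const_mul _
  have hgauss : HasGaussianLaw H P' :=
    (hL.gaussian.smul fun k : {k : ℕ // 2 ≤ k} => c k).hasGaussianLaw_fun_sum (I := J)
  have hmean : ∫ ω, H ω ∂P' = 0 := by
    simp only [hH]
    rw [integral_finsetSum _ fun k _ =>
      (hL.gaussian.hasGaussianLaw_eval k).integrable.const_mul (c k)]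
    refine Finset.sum_eq_zero fun k _ => ?_
    rw [integral_const_mul, hL.mean k k.2, mul_zero]
  have hvar : ∫ ω, H ω ^ 2 ∂P' = ∑ k ∈ J, ∑ l ∈ J, c k * c l * covA ξ P k l := by
    have h1 : ∀ ω, H ω ^ 2 = ∑ k ∈ J, ∑ l ∈ J, c k * c l * (η k ω * η l ω) := by
      intro ω
      simp only [hH]
      rw [sq, Finset.sum_mul_sum]
      exact Finset.sum_congr rfl fun k _ => Finset.sum_congr rfl fun l _ => by ring
    simp_rw [h1]
    rw [integral_finsetSum _ fun k _ => integrable_finsetSum _ fun l _ => hint k l]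
    refine Finset.sum_congr rfl fun k _ => ?_
    rw [integral_finsetSum _ fun l _ => hint k l]
    refine Finset.sum_congr rfl fun l _ => ?_
    rw [integral_const_mul, hL.cov k l k.2 l.2]
  have hlaw := hgauss.map_eq_gaussianReal
  rw [variance_of_integral_eq_zero hgauss.aemeasurable hmean, hmean, hvar] at hlaw
  have hchar := charFun_apply_real (μ := P'.map H) 1
  rw [integral_map hgauss.aemeasurable (by fun_prop), hlaw, charFun_gaussianReal,
    Real.coe_toNNReal _ (by rw [← hvar]; exact integral_nonneg fun _ => sq_nonneg _)] at hchar
  simp only [Complex.ofReal_one, one_mul, Complex.ofReal_zero, mul_zero, zero_mul, one_pow,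
    mul_one, zero_sub] at hchar
  rw [← hchar, neg_div]

omit [IsProbabilityMeasure P'] in
/-- The characteristic function of the linear combinations of the limits. -/
theorem IsLimitFamily.integral_exp_sum_limitEntry (hL : IsLimitFamily ξ P P' ζ η)
    (h : IsWignerEnsemble ξ P) {K : Finset ℕ} (hK : ∀ k ∈ K, 1 ≤ k) (c : ℕ → ℝ) :
    ∫ ω, Complex.exp ((∑ k ∈ K, c k * limitEntry ζ η k ω : ℝ) * Complex.I) ∂P' =
      (∫ ω, Complex.exp (((∑ k ∈ K, c k * aConst k) * ξ s(1, 1) ω : ℝ) * Complex.I) ∂P) *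
        Complex.exp (-((∑ k ∈ K, ∑ l ∈ K, c k * c l * covA ξ P k l : ℝ) : ℂ) / 2) := by
  set β := ∑ k ∈ K, c k * aConst k
  set J : Finset {k : ℕ // 2 ≤ k} := K.subtype (2 ≤ ·)
  have hcov : ∑ k ∈ K, ∑ l ∈ K, c k * c l * covA ξ P k l =
      ∑ k ∈ J, ∑ l ∈ J, c k * c l * covA ξ P k l := by
    rw [Finset.sum_subtype_eq_sum_filter fun k => ∑ l ∈ J, c k * c l * covA ξ P k l]
    rw [Finset.sum_filter_of_ne fun k hk hne => ?_]
    · refine Finset.sum_congr rfl fun k _ => ?_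
      rw [Finset.sum_subtype_eq_sum_filter fun l => c k * c l * covA ξ P k l]
      refine (Finset.sum_filter_of_ne fun l hl hne => ?_).symm
      by_contra h2
      obtain rfl : l = 1 := by have := hK l hl; omega
      rw [covA_comm h, covA_one_left h, mul_zero] at hne
      exact hne rfl
    · by_contra h2
      obtain rfl : k = 1 := by have := hK k hk; omega
      simp [covA_one_left h] at hne
  have hsum : ∀ ω, ∑ k ∈ K, c k * limitEntry ζ η k ω = β * ζ ω + ∑ k ∈ J, c k * η k ω := by
    intro ω
    rw [Finset.sum_subtype_eq_sum_filter fun k => c k * η k ω, Finset.sum_filter, Finset.sum_mul,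
      ← Finset.sum_add_distrib]
    refine Finset.sum_congr rfl fun k hk => ?_
    rw [limitEntry_eq ζ η (hK k hk)]
    split_ifs <;> ring
  have hη : AEMeasurable (fun ω (k : {k : ℕ // 2 ≤ k}) => η k ω) P' :=
    aemeasurable_pi_lambda _ fun k => hL.gaussian.aemeasurable k
  have hζ : ∫ ω, Complex.exp ((β * ξ s(1, 1) ω : ℝ) * Complex.I) ∂P =
      ∫ ω, Complex.exp ((β * ζ ω : ℝ) * Complex.I) ∂P' :=
    (hL.law.comp (u := fun x : ℝ => Complex.exp ((β * x : ℝ) * Complex.I))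
      (by fun_prop)).integral_eq.symm
  rw [hcov, ← hL.integral_exp_sum_eta J c, hζ,
    ← hL.indep.integral_fun_comp_mul_comp
      (f := fun x : ℝ => Complex.exp ((β * x : ℝ) * Complex.I))
      (g := fun x : {k : ℕ // 2 ≤ k} → ℝ => Complex.exp ((∑ k ∈ J, c k * x k : ℝ) * Complex.I))
      hL.law.aemeasurable_fst hη (by fun_prop)
      (Measurable.aestronglyMeasurable (by fun_prop))]
  congr 1 with ω
  rw [hsum, ← Complex.exp_add]
  push_cast
  ring_nf

/-- The joint convergence. -/
theorem tendstoInDistribution_SBar (h : IsWignerEnsemble ξ P) (hL : IsLimitFamily ξ P P' ζ η)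
    (K : ℕ) :
    TendstoInDistribution
      (fun (n : ℕ) (ω : Ω) (i : Fin K) => SBar ξ P (n + 1) ((i : ℕ) + 1) ω) atTop
      (fun (ω : Ω') (i : Fin K) => limitEntry ζ η ((i : ℕ) + 1) ω) (fun _ => P) P' := by
  -- Characteristic functions need an inner product, so the vectors are carried to Euclidean space
  -- and brought back by continuity at the end.
  have hX : ∀ n : ℕ, AEMeasurable (fun ω => WithLp.toLp 2
      fun i : Fin K => SBar ξ P (n + 1) ((i : ℕ) + 1) ω) P := fun n =>
    (PiLp.continuous_toLp 2 _).measurable.comp_aemeasurable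
      (aemeasurable_pi_lambda _ fun i => (hasMoments_SBar h (n + 1) _).integrable.aemeasurable)
  have hZ : AEMeasurable (fun ω => WithLp.toLp 2
      fun i : Fin K => limitEntry ζ η ((i : ℕ) + 1) ω) P' :=
    (PiLp.continuous_toLp 2 _).measurable.comp_aemeasurable
      (aemeasurable_pi_lambda _ fun i => hL.aemeasurable_limitEntry (Nat.le_add_left 1 i))
  have hmain : TendstoInDistribution (fun (n : ℕ) (ω : Ω) => WithLp.toLp 2
      fun i : Fin K => SBar ξ P (n + 1) ((i : ℕ) + 1) ω) atTop
      (fun ω => WithLp.toLp 2 fun i : Fin K => limitEntry ζ η ((i : ℕ) + 1) ω)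
      (fun _ => P) P' := by
    refine ⟨hX, hZ, ProbabilityMeasure.tendsto_iff_tendsto_charFun.2 fun t => ?_⟩
    -- The coordinate `i` of `Fin K` carries the power `i + 1`, hence the shift; the value `0` is
    -- only a default.
    let c : ℕ → ℝ := fun k => if hk : k - 1 < K then t ⟨k - 1, hk⟩ else 0
    let S : Finset ℕ := (Finset.range K).map ⟨Nat.succ, Nat.succ_injective⟩
    have hS : ∀ k ∈ S, 1 ≤ k := fun k hk => by
      obtain ⟨j, -, rfl⟩ := Finset.mem_map.1 hk
      exact Nat.succ_pos j
    have hinner : ∀ x : ℕ → ℝ, inner ℝ (WithLp.toLp 2 fun i : Fin K => x ((i : ℕ) + 1)) t =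
        ∑ k ∈ S, c k * x k := by
      intro x
      rw [PiLp.inner_apply, Finset.sum_map, Finset.sum_range]
      exact Finset.sum_congr rfl fun i _ => by simp [c, mul_comm]
    have hlim := tendsto_integral_exp_sum_SBar h S c
    rw [← hL.integral_exp_sum_limitEntry h hS c] at hlim
    simp_rw [← hinner] at hlim
    simp only [ProbabilityMeasure.coe_mk, charFun_apply]
    rw [integral_map hZ (by fun_prop)]
    exact hlim.congr fun n => (integral_map (hX n) (by fun_prop)).symm
  exact hmain.continuous_comp (g := WithLp.ofLp) (PiLp.continuous_ofLp 2 _)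

lemma tendstoInDistribution_SBar_single (h : IsWignerEnsemble ξ P)
    (hL : IsLimitFamily ξ P P' ζ η) {k : ℕ} (hk : 1 ≤ k) :
    TendstoInDistribution (fun n : ℕ => SBar ξ P (n + 1) k) atTop (limitEntry ζ η k)
      (fun _ => P) P' := by
  obtain ⟨j, rfl⟩ : ∃ j, k = j + 1 := ⟨k - 1, by omega⟩
  exact (tendstoInDistribution_SBar h hL (j + 1)).continuous_comp (g := fun x => x (Fin.last j))
    (continuous_apply _)

end Limit

end WignerCLT

open WignerCLT in
theorem mainTheorem1 {Ω : Type*} [MeasurableSpace Ω] (P : Measure Ω) [IsProbabilityMeasure P]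
    (ξ : Sym2 ℕ+ → Ω → ℝ) (hξ : IsWignerEnsemble ξ P) :
    (∃ (Ω' : Type) (_ : MeasurableSpace Ω') (P' : Measure Ω') (_ : IsProbabilityMeasure P')
        (ζ : Ω' → ℝ) (η : ℕ → Ω' → ℝ), IsLimitFamily ξ P P' ζ η) ∧
    ∀ (Ω' : Type*) [MeasurableSpace Ω'] (P' : Measure Ω') [IsProbabilityMeasure P']
        (ζ : Ω' → ℝ) (η : ℕ → Ω' → ℝ), IsLimitFamily ξ P P' ζ η →
      (∀ k, 2 ≤ k → Even k →
        TendstoInDistribution (fun n : ℕ => SBar ξ P (n + 1) k) atTop (η k) (fun _ => P) P') ∧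
      (∀ k, 3 ≤ k → Odd k →
        TendstoInDistribution (fun n : ℕ => SBar ξ P (n + 1) k) atTop
          (fun ω => aConst k * ζ ω + η k ω) (fun _ => P) P') ∧
      (∀ K : ℕ,
        TendstoInDistribution
          (fun (n : ℕ) (ω : Ω) (i : Fin K) => SBar ξ P (n + 1) ((i : ℕ) + 1) ω) atTop
          (fun (ω : Ω') (i : Fin K) => limitEntry ζ η ((i : ℕ) + 1) ω) (fun _ => P) P') := by
  refine ⟨exists_isLimitFamily hξ, fun Ω' _ P' _ ζ η hL => ⟨fun k hk he => ?_, fun k hk ho => ?_,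
    tendstoInDistribution_SBar hξ hL⟩⟩
  · have h1 : limitEntry ζ η k = η k := funext fun ω => by
      rw [limitEntry, if_neg (show k ≠ 1 by omega), if_pos he]
    rw [← h1]
    exact tendstoInDistribution_SBar_single hξ hL (by omega)
  · have h1 : limitEntry ζ η k = fun ω => aConst k * ζ ω + η k ω := funext fun ω => by
      rw [limitEntry, if_neg (show k ≠ 1 by omega), if_neg (Nat.not_even_iff_odd.2 ho)]
    rw [← h1]
    exact tendstoInDistribution_SBar_single hξ hL (by omega)
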